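/- Let $U\subset\mathbb R^2$ be open, let $A,B,C\in C^\infty(U)$, and consider the third-order ODE $y'''=F(x,y,y',y'')$ with $$F(x,y,p,q)=\tfrac32\frac{q^2}{p}+A(x,y)p^3+C(x,y)p^2+B(x,y)p,\qquad (x,y)\in U,\ p\neq0 .$$ For any smooth $F(x,y,p,q)$ with $F_{qq}\ne0$ put $K=\frac16(F_{qx}+pF_{qy}+qF_{qp}+FF_{qq})-\frac19F_q^2-\frac12F_p$, $\omega^1=dy-p\,dx$, $\omega^2=dp-q\,dx$, $\omega^3=dq-F\,dx$, $\omega^4=dx$, and, on the 6-dimensional space $\mathcal P_F$ with coordinates $(x,y,p,q,\alpha,\gamma)$, $\alpha\neq0$, let the Cartan coframe be $$\theta^1=\alpha\omega^1,\quad \theta^2=\tfrac16F_{qq}(\omega^2+\gamma\omega^1),\quad \theta^3=\tfrac{F_{qq}^2}{36\alpha}\bigl(\omega^3+(\gamma-\tfrac13F_q)\omega^2+(\tfrac12\gamma^2+K)\omega^1\bigr),\quad \theta^4=\tfrac{6\alpha}{F_{qq}}\omega^4,$$ $$\Omega^1=\tfrac1{F_{qq}}\bigl(-F_{qqq}\gamma^2+(\tfrac23F_{qqq}F_q+\tfrac13F_{qq}^2+2F_{qqp})\gamma+F_{qq}K_q+2F_{qqq}K-2F_{qqy}\bigr)\omega^1-\gamma\,\omega^4+\tfrac1\alpha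 d\alpha,$$ $$\begin{aligned}\Omega^2={}&-\tfrac{F_{qq}}{6\alpha}(\tfrac12\gamma^2+\tfrac13F_q\gamma+K)\omega^4+\tfrac1{6\alpha}\bigl(-\tfrac12F_{qqq}\gamma^2+(\tfrac13F_{qqq}F_q+F_{qqp})\gamma+F_{qqq}K-F_{qqy}\bigr)\omega^2\\&+\tfrac1{6\alpha}\bigl(-\tfrac12F_{qqq}\gamma^3+(\tfrac16F_{qq}^2+\tfrac13F_{qqq}F_q+F_{qqp})\gamma^2+(F_{qq}K_q-F_{qqy}+F_{qqq}K)\gamma\\&\qquad-\tfrac13F_{qq}F_{qy}-F_{qq}K_p-\tfrac13F_{qq}F_qK_q+\tfrac13F_{qq}^2K\bigr)\omega^1+\tfrac{F_{qq}}{6\alpha}d\gamma .\end{aligned}$$ Put $\tau^1=2\theta^1+\theta^4$, $\tau^2=\Omega^2$, $\tau^3=\Omega^2+2\theta^3$, $\tau^4=\theta^4$ and $\widetilde G_F=2\tau^1\tau^2+2\tau^3\tau^4$. Then, for the ODE above, with $\mathcal P=\mathcal P_F$ and $\mathcal M=\{(x,y,z,t):(x,y)\in U\}$: 1. $F_{qq}\neq0$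 on $\mathcal P$. The map $\pi:\mathcal P\to\mathcal M$, $\pi(x,y,p,q,\alpha,\gamma)=(x,y,z,t)$ with $z=\gamma/p$, $t=q/p+\gamma$, is a smooth surjective submersion with $\ker d\pi=\bigcap_i\ker\tau^i$; its fibres within each region of fixed signs of $p$ and $\alpha$ are non-empty and connected, so there $\mathcal M$ is the leaf space of this distribution. One has $\widetilde G_F=\pi^*G$ for exactly one tensor $G$ on $\mathcal M$, namely $$G=-[t^2+2B(x,y)]dx^2+2\,dt\,dx+[2A(x,y)-z^2]dy^2+2\,dz\,dy .$$ 2. $G$ is a smooth metric of split signature $(2,2)$ and is Einstein: $\mathrm{Ric}(G)=-G$. 3. Orient $\mathcal M$ by $dx\wedge dy\wedge dt\wedge dz$. At every point the anti-self-dual part of the Weyl tensor of $G$ has Petrov type D. At every point the self-dual part has type II or type D: it has type II where $Q\neq0$ and type D where $Q=0$, with $$Q=A_{xx}-tA_x-B_{yy}+zB_y .$$ Hence the Weyl tensor is of type D+D everywhere if and only if $A_x\equiv0$ and $B_y\equiv0$ (that is, locally $A=A(y)$, $B=B(x)$). Otherwise it is of type D+II generically: the set of points where it has type D+II is open, and every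 point of $\mathcal M$ at which $A_x\neq0$ or $B_y\neq0$ lies in its closure. Here, for the action of the Weyl tensor on the 3-dimensional space of self-dual (anti-self-dual) 2-forms, type D means Jordan form $\mathrm{diag}(\mu,\mu,-2\mu)$, and type II means a $2\times2$ Jordan block with eigenvalue $\mu$ together with the eigenvalue $-2\mu$, where $\mu\ne0$. 4. $G$ is invariant under fiber-preserving transformations. Let $\phi(x,y)=(\bar x(x),\bar y(x,y))$ be smooth and injective on $U$ with $\bar x'\bar y_y\neq0$, and let its prolongation to $(x,y,p,q)$ carry the ODE into an ODE $\bar y'''=\bar F(\bar x,\bar y,\bar y',\bar y'')$, with $\bar F$ any smooth function on an open set $\bar J$ of jets (the transformation being considered over those jets of the first ODE that are mapped into $\bar J$). Then there $\bar F_{\bar q\bar q}\ne0$, and the prolongation lifts to a smooth bijection $\psi$ from the corresponding part of $\mathcal P$ onto the corresponding part of $\mathcal P_{\bar F}$ that pulls back the coframe $(\bar\theta^1,\dots,\bar\theta^4,\bar\Omega^1,\bar\Omega^2)$ of $\bar F$ to that of $F$, and therefore $\psi^*\widetilde G_{\bar F}=\widetilde G_F=\pi^*G$. If moreover $\bar F$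 is again of the given form, with smooth coefficients $\bar A,\bar B,\bar C$ on $\phi(U)$ and with the transformation holding at all jets with $p\neq0\neq\bar p$, then there is a smooth bijection $\Phi$ from $\mathcal M$ onto $\bar{\mathcal M}=\{(\bar x,\bar y,\bar z,\bar t):(\bar x,\bar y)\in\phi(U)\}$ that covers $\phi$ and satisfies $\Phi^*\bar G=G$, where $\bar G$ is the metric of item 1 for $(\bar A,\bar B,\bar C)$. -/

import Mathlib

open scoped ContDiff

noncomputable section

namespace ThirdOrderODE

/-! ### Coordinate calculus -/

/-- The partial derivative `∂h/∂uᵢ` of a function of `n` real variables. -/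
def pd {n : ℕ} (i : Fin n) (h : (Fin n → ℝ) → ℝ) (u : Fin n → ℝ) : ℝ :=
  fderiv ℝ h u (Pi.single i 1)

/-- The coordinate differential `duᵢ`. -/
def dcoord {n : ℕ} (i : Fin n) : (Fin n → ℝ) →L[ℝ] ℝ :=
  ContinuousLinearMap.proj i

/-- The bilinear form with component matrix `g`. -/
def bilin {n : ℕ} (g : Matrix (Fin n) (Fin n) ℝ) (v w : Fin n → ℝ) : ℝ :=
  ∑ i, ∑ j, g i j * v i * w j

/-! ### The third-order equation and its invariant coframe

The coordinates on the second jet space are `j = (x, y, p, q)`, those on the six-dimensional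
space are `u = (x, y, p, q, α, γ)`. -/

/-- The point `(x, y)` under a point of the second jet space. -/
def basePt (j : Fin 4 → ℝ) : Fin 2 → ℝ := ![j 0, j 1]

/-- The projection `(x, y, p, q, α, γ) ↦ (x, y, p, q)`. -/
def jet (u : Fin 6 → ℝ) : Fin 4 → ℝ := ![u 0, u 1, u 2, u 3]

/-- The right-hand side `(3/2) q²/p + A(x,y) p³ + C(x,y) p² + B(x,y) p`. -/
def odeF (A B C : (Fin 2 → ℝ) → ℝ) (j : Fin 4 → ℝ) : ℝ :=
  3 / 2 * (j 3 ^ 2 / j 2) + A (basePt j) * j 2 ^ 3 + C (basePt j) * j 2 ^ 2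
    + B (basePt j) * j 2

/-- The jets `(x, y, p, q)` with `(x, y) ∈ U` and `p ≠ 0`. -/
def jetSpace (U : Set (Fin 2 → ℝ)) : Set (Fin 4 → ℝ) :=
  {j | basePt j ∈ U ∧ j 2 ≠ 0}

/-- The points `(x, y, p, q, α, γ)` with `(x, y) ∈ U`, `p ≠ 0` and `α ≠ 0`. -/
def totalSpace (U : Set (Fin 2 → ℝ)) : Set (Fin 6 → ℝ) :=
  {u | jet u ∈ jetSpace U ∧ u 4 ≠ 0}

section Coframe

variable (F : (Fin 4 → ℝ) → ℝ)

/-- `K = (F_qx + p F_qy + q F_qp + F F_qq)/6 - F_q²/9 - F_p/2`. -/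
def Kfun (j : Fin 4 → ℝ) : ℝ :=
  1 / 6 * (pd 0 (pd 3 F) j + j 2 * pd 1 (pd 3 F) j + j 3 * pd 2 (pd 3 F) j
    + F j * pd 3 (pd 3 F) j) - 1 / 9 * pd 3 F j ^ 2 - 1 / 2 * pd 2 F j

/-- `ω¹ = dy - p dx`. -/
def omega1 (u : Fin 6 → ℝ) : (Fin 6 → ℝ) →L[ℝ] ℝ := dcoord 1 - u 2 • dcoord 0

/-- `ω² = dp - q dx`. -/
def omega2 (u : Fin 6 → ℝ) : (Fin 6 → ℝ) →L[ℝ] ℝ := dcoord 2 - u 3 • dcoord 0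

/-- `ω³ = dq - F dx`. -/
def omega3 (u : Fin 6 → ℝ) : (Fin 6 → ℝ) →L[ℝ] ℝ := dcoord 3 - F (jet u) • dcoord 0

/-- `ω⁴ = dx`. -/
def omega4 (_u : Fin 6 → ℝ) : (Fin 6 → ℝ) →L[ℝ] ℝ := dcoord 0

/-- `θ¹ = α ω¹`. -/
def theta1 (u : Fin 6 → ℝ) : (Fin 6 → ℝ) →L[ℝ] ℝ := u 4 • omega1 u

/-- `θ² = (F_qq/6) (ω² + γ ω¹)`. -/
def theta2 (u : Fin 6 → ℝ) : (Fin 6 → ℝ) →L[ℝ] ℝ :=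
  (1 / 6 * pd 3 (pd 3 F) (jet u)) • (omega2 u + u 5 • omega1 u)

/-- `θ³ = (F_qq²/(36α)) (ω³ + (γ - F_q/3) ω² + (γ²/2 + K) ω¹)`. -/
def theta3 (u : Fin 6 → ℝ) : (Fin 6 → ℝ) →L[ℝ] ℝ :=
  (1 / (36 * u 4) * pd 3 (pd 3 F) (jet u) ^ 2) •
    (omega3 F u + (u 5 - 1 / 3 * pd 3 F (jet u)) • omega2 u
      + (1 / 2 * u 5 ^ 2 + Kfun F (jet u)) • omega1 u)

/-- `θ⁴ = (6α/F_qq) ω⁴`. -/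
def theta4 (u : Fin 6 → ℝ) : (Fin 6 → ℝ) →L[ℝ] ℝ :=
  (6 * u 4 / pd 3 (pd 3 F) (jet u)) • omega4 u

/-- `Ω¹ = F_qq⁻¹ (-F_qqq γ² + (2/3 F_qqq F_q + 1/3 F_qq² + 2 F_qqp) γ + F_qq K_q + 2 F_qqq K
- 2 F_qqy) ω¹ - γ ω⁴ + α⁻¹ dα`. -/
def Omega1 (u : Fin 6 → ℝ) : (Fin 6 → ℝ) →L[ℝ] ℝ :=
  let j := jet u
  let γ := u 5
  let Fq := pd 3 F j
  let Fqq := pd 3 (pd 3 F) j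
  let Fqqq := pd 3 (pd 3 (pd 3 F)) j
  let Fqqp := pd 2 (pd 3 (pd 3 F)) j
  let Fqqy := pd 1 (pd 3 (pd 3 F)) j
  let K := Kfun F j
  let Kq := pd 3 (Kfun F) j
  (1 / Fqq * (-Fqqq * γ ^ 2 + (2 / 3 * Fqqq * Fq + 1 / 3 * Fqq ^ 2 + 2 * Fqqp) * γ
      + Fqq * Kq + 2 * Fqqq * K - 2 * Fqqy)) • omega1 u
    - γ • omega4 u + (1 / u 4) • dcoord 4

/-- `Ω² = -(F_qq/(6α)) (γ²/2 + F_q γ/3 + K) ω⁴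
+ (1/(6α)) (-F_qqq γ²/2 + (F_qqq F_q/3 + F_qqp) γ + F_qqq K - F_qqy) ω²
+ (1/(6α)) (-F_qqq γ³/2 + (F_qq²/6 + F_qqq F_q/3 + F_qqp) γ² + (F_qq K_q - F_qqy + F_qqq K) γ
  - F_qq F_qy/3 - F_qq K_p - F_qq F_q K_q/3 + F_qq² K/3) ω¹ + (F_qq/(6α)) dγ`. -/
def Omega2 (u : Fin 6 → ℝ) : (Fin 6 → ℝ) →L[ℝ] ℝ :=
  let j := jet u
  let γ := u 5
  let Fq := pd 3 F j
  let Fqy := pd 1 (pd 3 F) j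
  let Fqq := pd 3 (pd 3 F) j
  let Fqqq := pd 3 (pd 3 (pd 3 F)) j
  let Fqqp := pd 2 (pd 3 (pd 3 F)) j
  let Fqqy := pd 1 (pd 3 (pd 3 F)) j
  let K := Kfun F j
  let Kq := pd 3 (Kfun F) j
  let Kp := pd 2 (Kfun F) j
  let c := 1 / (6 * u 4)
  (-c * Fqq * (1 / 2 * γ ^ 2 + 1 / 3 * Fq * γ + K)) • omega4 u
    + (c * (-(1 / 2) * Fqqq * γ ^ 2 + (1 / 3 * Fqqq * Fq + Fqqp) * γ
        + Fqqq * K - Fqqy)) • omega2 u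
    + (c * (-(1 / 2) * Fqqq * γ ^ 3
        + (1 / 6 * Fqq ^ 2 + 1 / 3 * Fqqq * Fq + Fqqp) * γ ^ 2
        + (Fqq * Kq - Fqqy + Fqqq * K) * γ
        - 1 / 3 * Fqq * Fqy - Fqq * Kp - 1 / 3 * Fqq * Fq * Kq
        + 1 / 3 * Fqq ^ 2 * K)) • omega1 u
    + (c * Fqq) • dcoord 5

/-- The invariant coframe `(θ¹, θ², θ³, θ⁴, Ω¹, Ω²)` of the equation `y''' = F(x, y, y', y'')`
modulo fiber-preserving transformations, on the region `F_qq ≠ 0`. -/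
def cartanCoframe (u : Fin 6 → ℝ) : Fin 6 → ((Fin 6 → ℝ) →L[ℝ] ℝ) :=
  ![theta1 u, theta2 F u, theta3 F u, theta4 F u, Omega1 F u, Omega2 F u]

/-- The null forms `τ¹ = 2θ¹ + θ⁴`, `τ² = Ω²`, `τ³ = Ω² + 2θ³`, `τ⁴ = θ⁴`. -/
def nullForms (u : Fin 6 → ℝ) : Fin 4 → ((Fin 6 → ℝ) →L[ℝ] ℝ) :=
  ![(2 : ℝ) • theta1 u + theta4 F u, Omega2 F u, Omega2 F u + (2 : ℝ) • theta3 F u, theta4 F u]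

/-- The degenerate symmetric tensor `G̃ = 2 τ¹ τ² + 2 τ³ τ⁴` (symmetric products). -/
def Gtilde (u : Fin 6 → ℝ) (v w : Fin 6 → ℝ) : ℝ :=
  nullForms F u 0 v * nullForms F u 1 w + nullForms F u 1 v * nullForms F u 0 w
    + nullForms F u 2 v * nullForms F u 3 w + nullForms F u 3 v * nullForms F u 2 w

end Coframe

/-! ### The four-dimensional space and its metric -/

/-- The four-manifold of points `m = (x, y, z, t)` with `(x, y) ∈ U`. -/
def fourSpace (U : Set (Fin 2 → ℝ)) : Set (Fin 4 → ℝ) := {m | basePt m ∈ U}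

/-- The projection `(x, y, p, q, α, γ) ↦ (x, y, z, t)`, `z = γ/p`, `t = q/p + γ`. -/
def proj (u : Fin 6 → ℝ) : Fin 4 → ℝ := ![u 0, u 1, u 5 / u 2, u 3 / u 2 + u 5]

/-- The component matrix, in the coordinates `(x, y, z, t)`, of
`G = -(t² + 2B) dx² + 2 dt dx + (2A - z²) dy² + 2 dz dy`. -/
def metricG (A B : (Fin 2 → ℝ) → ℝ) (m : Fin 4 → ℝ) : Matrix (Fin 4) (Fin 4) ℝ :=
  !![-(m 3 ^ 2 + 2 * B (basePt m)), 0, 0, 1;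
     0, 2 * A (basePt m) - m 2 ^ 2, 1, 0;
     0, 1, 0, 0;
     1, 0, 0, 0]

/-- A symmetric `4 × 4` matrix has split signature `(2, 2)`. -/
def IsSplit (g : Matrix (Fin 4) (Fin 4) ℝ) : Prop :=
  g.IsSymm ∧ ∃ S : Matrix (Fin 4) (Fin 4) ℝ, IsUnit S.det ∧
    S.transpose * g * S = Matrix.diagonal ![1, 1, -1, -1]

section Curvature

variable (g : (Fin 4 → ℝ) → Matrix (Fin 4) (Fin 4) ℝ)

/-- Christoffel symbols `Γᵏᵢⱼ = ½ gᵏˡ (∂ᵢ gⱼₗ + ∂ⱼ gᵢₗ - ∂ₗ gᵢⱼ)`. -/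
def christoffel (k i j : Fin 4) (m : Fin 4 → ℝ) : ℝ :=
  1 / 2 * ∑ l, (g m)⁻¹ k l * (pd i (fun m' => g m' j l) m + pd j (fun m' => g m' i l) m
    - pd l (fun m' => g m' i j) m)

/-- The curvature tensor
`Rᵏₗᵢⱼ = ∂ᵢ Γᵏⱼₗ - ∂ⱼ Γᵏᵢₗ + Γᵏᵢₐ Γᵃⱼₗ - Γᵏⱼₐ Γᵃᵢₗ`. -/
def riemann (k l i j : Fin 4) (m : Fin 4 → ℝ) : ℝ :=
  pd i (christoffel g k j l) m - pd j (christoffel g k i l) m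
    + ∑ a, (christoffel g k i a m * christoffel g a j l m
      - christoffel g k j a m * christoffel g a i l m)

/-- The Ricci tensor `Ricᵢⱼ = Rᵏᵢₖⱼ`. -/
def ricci (m : Fin 4 → ℝ) : Matrix (Fin 4) (Fin 4) ℝ :=
  Matrix.of fun i j => ∑ k, riemann g k i k j m

/-- The scalar curvature. -/
def scalarCurv (m : Fin 4 → ℝ) : ℝ := ∑ i, ∑ j, (g m)⁻¹ i j * ricci g m i j

/-- The Weyl tensor `Wᵢⱼₖₗ`, all indices down, in dimension four. -/
def weyl (i j k l : Fin 4) (m : Fin 4 → ℝ) : ℝ :=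
  ∑ a, g m i a * riemann g a j k l m
    - 1 / 2 * (g m i k * ricci g m j l - g m i l * ricci g m j k
      - g m j k * ricci g m i l + g m j l * ricci g m i k)
    + scalarCurv g m / 6 * (g m i k * g m j l - g m i l * g m j k)

/-- The Weyl tensor as an operator on 2-forms, `(W η)ᵢⱼ = ½ Wᵢⱼₖₗ ηᵏˡ`; a 2-form is given by its
skew-symmetric component matrix. -/
def weylOp (m : Fin 4 → ℝ) (η : Matrix (Fin 4) (Fin 4) ℝ) : Matrix (Fin 4) (Fin 4) ℝ :=
  Matrix.of fun i j =>
    1 / 2 * ∑ k, ∑ l, weyl g i j k l m * ((g m)⁻¹ * η * ((g m)⁻¹).transpose) k l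

end Curvature

/-- The Levi-Civita symbol, with `ε₀₁₂₃ = 1`. -/
def leviCivita (i j k l : Fin 4) : ℝ :=
  Matrix.det (Matrix.of fun a b : Fin 4 => if ![i, j, k, l] a = b then (1 : ℝ) else 0)

/-- The Hodge star on 2-forms, `(⋆η)ᵢⱼ = (o/2) |det g|^{1/2} εᵢⱼₖₗ ηᵏˡ`, where `o = 1` for the
orientation `du₀ ∧ du₁ ∧ du₂ ∧ du₃` and `o = -1` for the opposite one. -/
def hodge (o : ℝ) (g : Matrix (Fin 4) (Fin 4) ℝ) :
    Matrix (Fin 4) (Fin 4) ℝ →ₗ[ℝ] Matrix (Fin 4) (Fin 4) ℝ where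
  toFun η := Matrix.of fun i j =>
    o / 2 * Real.sqrt |g.det| * ∑ k, ∑ l, leviCivita i j k l * (g⁻¹ * η * (g⁻¹).transpose) k l
  map_add' η ζ := by
    ext i j
    simp only [Matrix.of_apply, Matrix.add_apply, Matrix.add_mul, mul_add,
      Finset.sum_add_distrib]
  map_smul' c η := by
    ext i j
    simp only [Matrix.of_apply, Matrix.smul_apply, Matrix.mul_smul, Matrix.smul_mul, smul_eq_mul,
      RingHom.id_apply, Finset.mul_sum]
    refine Finset.sum_congr rfl fun k _ => Finset.sum_congr rfl fun l _ => ?_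
    ring

/-- The space of 2-forms `η` with `⋆η = s η`: self-dual for `s = 1`, anti-self-dual
for `s = -1`. -/
def dualForms (s o : ℝ) (g : Matrix (Fin 4) (Fin 4) ℝ) :
    Submodule ℝ (Matrix (Fin 4) (Fin 4) ℝ) where
  carrier := {η | η.transpose = -η ∧ hodge o g η = s • η}
  zero_mem' := by simp
  add_mem' := by
    rintro η ζ ⟨h1, h2⟩ ⟨h3, h4⟩
    refine ⟨?_, ?_⟩
    · rw [Matrix.transpose_add, h1, h3, neg_add]
    · rw [map_add, h2, h4, smul_add]
  smul_mem' := by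
    rintro c η ⟨h1, h2⟩
    refine ⟨?_, ?_⟩
    · rw [Matrix.transpose_smul, h1, smul_neg]
    · rw [map_smul, h2, smul_comm]

/-- Self-dual 2-forms. -/
def selfDual (o : ℝ) (g : Matrix (Fin 4) (Fin 4) ℝ) := dualForms 1 o g

/-- Anti-self-dual 2-forms. -/
def antiSelfDual (o : ℝ) (g : Matrix (Fin 4) (Fin 4) ℝ) := dualForms (-1) o g

/-- Petrov type D of (the restriction to the three-dimensional space `V` of) an operator `T`:
the Jordan normal form is `diag(μ, μ, -2μ)` with `μ ≠ 0`. -/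
def IsPetrovD (V : Submodule ℝ (Matrix (Fin 4) (Fin 4) ℝ))
    (T : Matrix (Fin 4) (Fin 4) ℝ → Matrix (Fin 4) (Fin 4) ℝ) : Prop :=
  ∃ μ : ℝ, μ ≠ 0 ∧ ∃ b : Module.Basis (Fin 3) ℝ V,
    T (b 0) = μ • (b 0 : Matrix (Fin 4) (Fin 4) ℝ) ∧
    T (b 1) = μ • (b 1 : Matrix (Fin 4) (Fin 4) ℝ) ∧
    T (b 2) = (-2 * μ) • (b 2 : Matrix (Fin 4) (Fin 4) ℝ)

/-- Petrov type II of (the restriction to the three-dimensional space `V` of) an operator `T`: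
the Jordan normal form consists of a `2 × 2` block with eigenvalue `μ ≠ 0` and a `1 × 1` block
with eigenvalue `-2μ`. -/
def IsPetrovII (V : Submodule ℝ (Matrix (Fin 4) (Fin 4) ℝ))
    (T : Matrix (Fin 4) (Fin 4) ℝ → Matrix (Fin 4) (Fin 4) ℝ) : Prop :=
  ∃ μ : ℝ, μ ≠ 0 ∧ ∃ b : Module.Basis (Fin 3) ℝ V,
    T (b 0) = μ • (b 0 : Matrix (Fin 4) (Fin 4) ℝ) ∧
    T (b 1) = μ • (b 1 : Matrix (Fin 4) (Fin 4) ℝ) + b 0 ∧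
    T (b 2) = (-2 * μ) • (b 2 : Matrix (Fin 4) (Fin 4) ℝ)

/-- The self-dual part of the Weyl tensor of `g` at `m` has type D; the orientation is
`dx ∧ dy ∧ dt ∧ dz` in the coordinates `(x, y, z, t)`. -/
def SDTypeD (g : (Fin 4 → ℝ) → Matrix (Fin 4) (Fin 4) ℝ) (m : Fin 4 → ℝ) : Prop :=
  IsPetrovD (selfDual (-1) (g m)) (weylOp g m)

/-- The self-dual part of the Weyl tensor of `g` at `m` has type II (same orientation). -/
def SDTypeII (g : (Fin 4 → ℝ) → Matrix (Fin 4) (Fin 4) ℝ) (m : Fin 4 → ℝ) : Prop :=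
  IsPetrovII (selfDual (-1) (g m)) (weylOp g m)

/-- The anti-self-dual part of the Weyl tensor of `g` at `m` has type D (same orientation). -/
def ASDTypeD (g : (Fin 4 → ℝ) → Matrix (Fin 4) (Fin 4) ℝ) (m : Fin 4 → ℝ) : Prop :=
  IsPetrovD (antiSelfDual (-1) (g m)) (weylOp g m)

/-- `Q = A_xx - t A_x - B_yy + z B_y`. -/
def typeQ (A B : (Fin 2 → ℝ) → ℝ) (m : Fin 4 → ℝ) : ℝ :=
  pd 0 (pd 0 A) (basePt m) - m 3 * pd 0 A (basePt m) - pd 1 (pd 1 B) (basePt m)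
    + m 2 * pd 1 B (basePt m)

/-! ### Fiber-preserving transformations `x̄ = f(x)`, `ȳ = h(x, y)` -/

/-- The map `(x, y) ↦ (f(x), h(x, y))`. -/
def fpMap (f : ℝ → ℝ) (h : (Fin 2 → ℝ) → ℝ) (w : Fin 2 → ℝ) : Fin 2 → ℝ := ![f (w 0), h w]

/-- `(x, y) ↦ (f(x), h(x, y))` is a fiber-preserving transformation of the open set `U`, that is,
smooth and injective with nowhere vanishing Jacobian determinant `f'(x) h_y(x, y)`. -/
structure IsFiberPreserving (U : Set (Fin 2 → ℝ)) (f : ℝ → ℝ) (h : (Fin 2 → ℝ) → ℝ) : Prop where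
  smooth_fst : ContDiffOn ℝ ∞ f ((fun w : Fin 2 → ℝ => w 0) '' U)
  smooth_snd : ContDiffOn ℝ ∞ h U
  deriv_fst_ne : ∀ w ∈ U, deriv f (w 0) ≠ 0
  deriv_snd_ne : ∀ w ∈ U, pd 1 h w ≠ 0
  injOn : Set.InjOn (fpMap f h) U

/-- The total derivative `k_x + p k_y + q k_p + c k_q`, where `c` is the value of `y'''`. -/
def totalDeriv (c : ℝ) (k : (Fin 4 → ℝ) → ℝ) (j : Fin 4 → ℝ) : ℝ :=
  pd 0 k j + j 2 * pd 1 k j + j 3 * pd 2 k j + c * pd 3 k j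

/-- The transformed first derivative `p̄ = D ȳ / D x̄`; it does not depend on `q`, `y'''`. -/
def pBar (f : ℝ → ℝ) (h : (Fin 2 → ℝ) → ℝ) (j : Fin 4 → ℝ) : ℝ :=
  totalDeriv 0 (fun j' => h (basePt j')) j / deriv f (j 0)

/-- The transformed second derivative `q̄ = D p̄ / D x̄`; it does not depend on `y'''`. -/
def qBar (f : ℝ → ℝ) (h : (Fin 2 → ℝ) → ℝ) (j : Fin 4 → ℝ) : ℝ :=
  totalDeriv 0 (pBar f h) j / deriv f (j 0)

/-- The second prolongation `(x, y, p, q) ↦ (x̄, ȳ, p̄, q̄)`. -/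
def prolong (f : ℝ → ℝ) (h : (Fin 2 → ℝ) → ℝ) (j : Fin 4 → ℝ) : Fin 4 → ℝ :=
  ![f (j 0), h (basePt j), pBar f h j, qBar f h j]

/-- The value `D q̄ / D x̄` of `ȳ'''` at a jet along the equation `y''' = F`. -/
def thirdBar (f : ℝ → ℝ) (h : (Fin 2 → ℝ) → ℝ) (F : (Fin 4 → ℝ) → ℝ) (j : Fin 4 → ℝ) : ℝ :=
  totalDeriv (F j) (qBar f h) j / deriv f (j 0)

/-- The transformation carries the equation `y''' = F`, over the set `J` of jets, into the equation
`ȳ''' = F'`, given on the set `J'` of jets. -/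
def Transforms (f : ℝ → ℝ) (h : (Fin 2 → ℝ) → ℝ) (J : Set (Fin 4 → ℝ)) (F : (Fin 4 → ℝ) → ℝ)
    (J' : Set (Fin 4 → ℝ)) (F' : (Fin 4 → ℝ) → ℝ) : Prop :=
  ∀ j ∈ J, prolong f h j ∈ J' → F' (prolong f h j) = thirdBar f h F j

end ThirdOrderODE

end

open ThirdOrderODE

/-!
For `F = (3/2) q²/p + A p³ + C p² + B p` one has `F_q = 3q/p`, `F_qq = 3/p`, `F_qqq = F_qqy = 0` and
`K = -A p² - C p/2` (`Kfun_odeF`), so the coframe is explicit. Written in the differentials of `x`,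
`y`, `z = γ/p` and `t = q/p + γ`, the null forms involve nothing else, the variables `p` and `α`
cancel in `G̃`, and `G̃` is the pull-back of `G` (`Gtilde_odeF`). The fibres of the projection are
graphs over quadrants of the `(p, α)`-plane, hence connected.

The metric `G` has unit determinant and polynomial inverse. Its curvature 2-form is a combination of
`dx ∧ dt`, `dy ∧ dz` and `Q dx ∧ dy` (`riemann_metricG`), which gives `Ric = -G`. On 2-forms the Weyl
operator has the eigenvalues `1/3` and `-2/3` and, besides these, the single nilpotent entry `Q` from
`dz ∧ dt` to `dx ∧ dy` (`weylOp_skew`). The form `dx ∧ dy` is self-dual, so the anti-self-dual part is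
always of type D and the self-dual part is of type D or II according to whether `Q` vanishes. Since
`Q` is affine in `z` and `t` with slopes `B_y` and `-A_x`, the statements on generic points follow.

Invariance rests on the commutation rules of the total derivative `D` (`hasGrad_totalDeriv`). With
`s = 1/f'` and `λ = D log |h_y|` they give `F̄_q̄ = s (F_q + 3λ) + 3 s'`, `F̄_q̄q̄ = F_qq / (s h_y)` and
`K̄ = s² (K + λ F_q/3 - Dλ + λ²/2)` (`pd_transformed_q`, `pd_pd_transformed_q`, `Kfun_transformed`).
The lift `ᾱ = α/h_y`, `γ̄ = s (γ - λ)` then preserves each form of the coframe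
(`cartanCoframe_liftMap`).

If the transformed equation has the same form, then `3/p̄ = F̄_q̄q̄ = 3/(p s h_y)` forces `h_x = 0`
(`pd_snd_x_eq_zero`). Comparing powers of `p` in `K̄` and `F̄_p̄` yields the transformation law of
`A` and `B` (`coefficients_transform`), and with it the map `z̄ = (z - ∂_y log |h_y|)/h_y`,
`t̄ = s t + s'` is an isometry (`bilin_isometryMap`).
-/

noncomputable section

namespace ThirdOrderODE

/-! ### Gradients -/

/-- `k` is differentiable at `u` with partial derivatives `g`. -/
def HasGrad {n : ℕ} (k : (Fin n → ℝ) → ℝ) (g : Fin n → ℝ) (u : Fin n → ℝ) : Prop :=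
  HasFDerivAt k (∑ i, g i • dcoord i) u

section Gradient

variable {n : ℕ} {k l : (Fin n → ℝ) → ℝ} {g g' : Fin n → ℝ} {u : Fin n → ℝ}

theorem dcoord_apply (i : Fin n) (v : Fin n → ℝ) : dcoord i v = v i := rfl

theorem HasGrad.fderiv_apply (h : HasGrad k g u) (v : Fin n → ℝ) :
    fderiv ℝ k u v = ∑ i, g i * v i := by
  rw [HasFDerivAt.fderiv h]
  simp [dcoord_apply]

theorem HasGrad.pd (h : HasGrad k g u) (i : Fin n) : pd i k u = g i := by
  rw [ThirdOrderODE.pd, h.fderiv_apply]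
  simp [Pi.single_apply]

theorem hasGrad_of_hasFDerivAt {L : (Fin n → ℝ) →L[ℝ] ℝ} (h : HasFDerivAt k L u)
    (hg : ∀ i, L (Pi.single i 1) = g i) : HasGrad k g u := by
  have : (∑ i, g i • dcoord i) = L := by
    ext v
    conv_rhs => rw [← Finset.univ_sum_single v, map_sum]
    simp only [FunLike.coe_sum, Finset.sum_apply, FunLike.coe_smul,
      Pi.smul_apply, dcoord_apply, smul_eq_mul]
    refine Finset.sum_congr rfl fun i _ => ?_
    rw [← hg, show (Pi.single i (v i) : Fin n → ℝ) = v i • Pi.single i 1 by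
      rw [← Pi.single_smul]; simp, map_smul, smul_eq_mul, mul_comm]
  rw [HasGrad, this]; exact h

theorem hasGrad_pd (h : DifferentiableAt ℝ k u) : HasGrad k (fun i => ThirdOrderODE.pd i k u) u :=
  hasGrad_of_hasFDerivAt h.hasFDerivAt fun _ => rfl

theorem HasGrad.congr_grad (h : HasGrad k g u) (e : ∀ i, g i = g' i) : HasGrad k g' u := by
  rwa [← funext e]

theorem HasGrad.congr_fun (h : HasGrad k g u) (e : l =ᶠ[nhds u] k) : HasGrad l g u :=
  HasFDerivAt.congr_of_eventuallyEq h e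

theorem hasGrad_const (c : ℝ) : HasGrad (fun _ => c) (fun _ => 0) u :=
  hasGrad_of_hasFDerivAt (hasFDerivAt_const c u) (by simp)

theorem hasGrad_coord (i : Fin n) : HasGrad (fun v => v i) (Pi.single i 1) u :=
  hasGrad_of_hasFDerivAt (hasFDerivAt_apply i u) fun j => by
    simp [Pi.single_apply, eq_comm]

theorem HasGrad.add (h : HasGrad k g u) (h' : HasGrad l g' u) :
    HasGrad (fun v => k v + l v) (fun i => g i + g' i) u :=
  hasGrad_of_hasFDerivAt (HasFDerivAt.add h h') (by simp [dcoord_apply, Pi.single_apply])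

theorem HasGrad.sub (h : HasGrad k g u) (h' : HasGrad l g' u) :
    HasGrad (fun v => k v - l v) (fun i => g i - g' i) u :=
  hasGrad_of_hasFDerivAt (HasFDerivAt.sub h h') (by simp [dcoord_apply, Pi.single_apply])

theorem HasGrad.neg (h : HasGrad k g u) :
    HasGrad (fun v => -k v) (fun i => -g i) u :=
  hasGrad_of_hasFDerivAt (HasFDerivAt.neg h) (by simp [dcoord_apply, Pi.single_apply])

theorem HasGrad.mul (h : HasGrad k g u) (h' : HasGrad l g' u) :
    HasGrad (fun v => k v * l v) (fun i => g i * l u + k u * g' i) u :=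
  hasGrad_of_hasFDerivAt (HasFDerivAt.mul h h')
    (by intro i; simp [dcoord_apply, Pi.single_apply]; ring)

theorem HasGrad.scomp {φ : ℝ → ℝ} {d : ℝ} (hφ : HasDerivAt φ d (k u)) (h : HasGrad k g u) :
    HasGrad (fun v => φ (k v)) (fun i => d * g i) u :=
  hasGrad_of_hasFDerivAt (hφ.comp_hasFDerivAt u h)
    (by intro i; simp [dcoord_apply, Pi.single_apply])

theorem HasGrad.pow (h : HasGrad k g u) (m : ℕ) :
    HasGrad (fun v => k v ^ m) (fun i => m * k u ^ (m - 1) * g i) u :=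
  HasGrad.scomp (φ := fun x => x ^ m) (hasDerivAt_pow m (k u)) h

theorem HasGrad.inv (h : HasGrad k g u) (h0 : k u ≠ 0) :
    HasGrad (fun v => (k v)⁻¹) (fun i => -(k u ^ 2)⁻¹ * g i) u :=
  HasGrad.scomp (φ := fun x => x⁻¹) (hasDerivAt_inv h0) h

theorem HasGrad.div (h : HasGrad k g u) (h' : HasGrad l g' u) (h0 : l u ≠ 0) :
    HasGrad (fun v => k v / l v) (fun i => (g i * l u - k u * g' i) / l u ^ 2) u := by
  simp only [div_eq_mul_inv (k _)]
  refine (h.mul (h'.inv h0)).congr_grad fun i => ?_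
  field_simp
  ring

/-- The chain rule in coordinates. -/
theorem HasGrad.comp {m : ℕ} {φ : (Fin m → ℝ) → Fin n → ℝ} {u : Fin m → ℝ}
    {e : Fin n → Fin m → ℝ} (h : HasGrad k g (φ u)) (hφ : ∀ a, HasGrad (fun v => φ v a) (e a) u) :
    HasGrad (fun v => k (φ v)) (fun i => ∑ a, g a * e a i) u := by
  have hφ' : HasFDerivAt φ (ContinuousLinearMap.pi fun a => ∑ i, e a i • dcoord i) u :=
    hasFDerivAt_pi.2 hφ
  refine hasGrad_of_hasFDerivAt (HasFDerivAt.comp u h hφ') fun i => ?_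
  simp [dcoord_apply, Pi.single_apply]

theorem pd_congr {i : Fin n} (e : k =ᶠ[nhds u] l) : pd i k u = pd i l u := by
  rw [ThirdOrderODE.pd, ThirdOrderODE.pd, e.fderiv_eq]

theorem contDiffAt_pd (h : ContDiffAt ℝ ∞ k u) (i : Fin n) : ContDiffAt ℝ ∞ (pd i k) u :=
  (h.fderiv_right (m := ∞) le_rfl).clm_apply contDiffAt_const

/-- Symmetry of second partial derivatives. -/
theorem pd_comm (h : ContDiffAt ℝ ∞ k u) (i j : Fin n) : pd i (pd j k) u = pd j (pd i k) u := by
  have hs : IsSymmSndFDerivAt ℝ k u := h.isSymmSndFDerivAt (by simp; exact ENat.LEInfty.out)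
  have hd : DifferentiableAt ℝ (fderiv ℝ k) u :=
    (h.fderiv_right (m := ∞) le_rfl).differentiableAt (by simp)
  have key : ∀ a b : Fin n, pd a (pd b k) u
      = fderiv ℝ (fderiv ℝ k) u (Pi.single a 1) (Pi.single b 1) := by
    intro a b
    have : pd b k = fun v => fderiv ℝ k v (Pi.single b 1) := rfl
    rw [this, ThirdOrderODE.pd, fderiv_clm_apply hd (differentiableAt_const _)]
    simp
  rw [key, key, hs.eq]

end Gradient

theorem hasGrad_pd_of_contDiffAt {n : ℕ} {k : (Fin n → ℝ) → ℝ} {u : Fin n → ℝ}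
    (h : ContDiffAt ℝ ∞ k u) : HasGrad k (fun i => pd i k u) u :=
  hasGrad_pd (h.differentiableAt (by simp))

/-- The gradient of a function of `(x, y)`, regarded as a function of `(x, y, ·, ·)`. -/
theorem HasGrad.comp_basePt {a : (Fin 2 → ℝ) → ℝ} {g : Fin 2 → ℝ} {j : Fin 4 → ℝ}
    (h : HasGrad a g (basePt j)) :
    HasGrad (fun j' => a (basePt j')) ![g 0, g 1, 0, 0] j := by
  have e : ∀ c : Fin 2, HasGrad (fun j' : Fin 4 → ℝ => basePt j' c)
      (![Pi.single 0 1, Pi.single 1 1] c) j := by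
    intro c
    fin_cases c
    · exact hasGrad_coord 0
    · exact hasGrad_coord 1
  refine (h.comp e).congr_grad fun i => ?_
  fin_cases i <;> simp [Fin.sum_univ_two]

theorem contDiff_basePt : ContDiff ℝ ∞ basePt := by
  refine contDiff_pi.2 fun i => ?_
  fin_cases i
  · exact contDiff_apply ℝ ℝ 0
  · exact contDiff_apply ℝ ℝ 1

theorem contDiff_jet : ContDiff ℝ ∞ jet := by
  refine contDiff_pi.2 fun i => ?_
  fin_cases i <;> exact contDiff_apply ℝ ℝ _

/-! ### Curvature of the metric -/

section CurvatureOfG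

variable (A B : (Fin 2 → ℝ) → ℝ) (m : Fin 4 → ℝ)

theorem metricG_mul_inv : metricG A B m * !![0, 0, 0, 1;
     0, 0, 1, 0;
     0, 1, m 2 ^ 2 - 2 * A (basePt m), 0;
     1, 0, 0, m 3 ^ 2 + 2 * B (basePt m)] = 1 := by
  ext i j
  fin_cases i <;> fin_cases j <;> simp [metricG, Matrix.mul_apply, Fin.sum_univ_four]

theorem metricG_inv : (metricG A B m)⁻¹ = !![0, 0, 0, 1;
     0, 0, 1, 0;
     0, 1, m 2 ^ 2 - 2 * A (basePt m), 0;
     1, 0, 0, m 3 ^ 2 + 2 * B (basePt m)] :=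
  Matrix.inv_eq_right_inv (metricG_mul_inv A B m)

theorem metricG_det : (metricG A B m).det = 1 := by
  simp [metricG, Matrix.det_succ_row_zero, Fin.sum_univ_succ, Fin.succAbove]
  norm_num

/-- The first partial derivatives `∂ᵢ gⱼₗ` of the metric, in the order `j`, `l`, `i`. -/
def metricGrad : Fin 4 → Fin 4 → Fin 4 → ℝ :=
  ![![![-2 * pd 0 B (basePt m), -2 * pd 1 B (basePt m), 0, -2 * m 3], 0, 0, 0],
    ![0, ![2 * pd 0 A (basePt m), 2 * pd 1 A (basePt m), -2 * m 2, 0], 0, 0],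
    ![0, 0, 0, 0], ![0, 0, 0, 0]]

/-- The Christoffel symbols `Γᵏᵢⱼ` of the metric, in the order `k`, `i`, `j`. -/
def chrG : Fin 4 → Fin 4 → Fin 4 → ℝ :=
  ![![![m 3, 0, 0, 0], 0, 0, 0],
    ![0, ![0, m 2, 0, 0], 0, 0],
    ![![pd 1 B (basePt m), pd 0 A (basePt m), 0, 0],
      ![pd 0 A (basePt m), pd 1 A (basePt m) - 2 * A (basePt m) * m 2 + m 2 ^ 3, -m 2, 0],
      ![0, -m 2, 0, 0], 0],
    ![![-pd 0 B (basePt m) + m 3 ^ 3 + 2 * B (basePt m) * m 3, -pd 1 B (basePt m), 0, -m 3],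
      ![-pd 1 B (basePt m), -pd 0 A (basePt m), 0, 0], 0, ![-m 3, 0, 0, 0]]]

/-- The partial derivatives of the Christoffel symbols, in the order `k`, `i`, `j`, followed by
the direction of differentiation. -/
def chrGrad : Fin 4 → Fin 4 → Fin 4 → Fin 4 → ℝ :=
  let dAx : Fin 4 → ℝ := ![pd 0 (pd 0 A) (basePt m), pd 1 (pd 0 A) (basePt m), 0, 0]
  let dAy : Fin 4 → ℝ := ![pd 0 (pd 1 A) (basePt m), pd 1 (pd 1 A) (basePt m), 0, 0]
  let dBx : Fin 4 → ℝ := ![pd 0 (pd 0 B) (basePt m), pd 1 (pd 0 B) (basePt m), 0, 0]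
  let dBy : Fin 4 → ℝ := ![pd 0 (pd 1 B) (basePt m), pd 1 (pd 1 B) (basePt m), 0, 0]
  ![![![![0, 0, 0, 1], 0, 0, 0], 0, 0, 0],
    ![0, ![0, ![0, 0, 1, 0], 0, 0], 0, 0],
    ![![dBy, dAx, 0, 0],
      ![dAx, dAy + ![-2 * pd 0 A (basePt m) * m 2, -2 * pd 1 A (basePt m) * m 2,
          -2 * A (basePt m) + 3 * m 2 ^ 2, 0], ![0, 0, -1, 0], 0],
      ![0, ![0, 0, -1, 0], 0, 0], 0],
    ![![-dBx + ![2 * pd 0 B (basePt m) * m 3, 2 * pd 1 B (basePt m) * m 3, 0,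
          3 * m 3 ^ 2 + 2 * B (basePt m)], -dBy, 0, ![0, 0, 0, -1]],
      ![-dBy, -dAx, 0, 0], 0, ![![0, 0, 0, -1], 0, 0, 0]]]

variable {A B m}

theorem hasGrad_metricG (hA : ContDiffAt ℝ ∞ A (basePt m)) (hB : ContDiffAt ℝ ∞ B (basePt m))
    (j l : Fin 4) : HasGrad (fun m' => metricG A B m' j l) (metricGrad A B m j l) m := by
  have cA := (hasGrad_pd_of_contDiffAt hA).comp_basePt
  have cB := (hasGrad_pd_of_contDiffAt hB).comp_basePt
  have c0 : ∀ c : ℝ, HasGrad (fun _ : Fin 4 → ℝ => c) 0 m := fun c => hasGrad_const c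
  have h00 := (((hasGrad_coord (u := m) 3).pow 2).add ((hasGrad_const 2).mul cB)).neg
  have h11 := ((hasGrad_const 2).mul cA).sub ((hasGrad_coord (u := m) 2).pow 2)
  fin_cases j <;> fin_cases l <;> first
    | exact c0 _
    | (refine HasGrad.congr_grad h00 fun i => ?_
       fin_cases i <;> simp [metricGrad])
    | (refine HasGrad.congr_grad h11 fun i => ?_
       fin_cases i <;> simp [metricGrad])

theorem christoffel_metricG (hA : ContDiffAt ℝ ∞ A (basePt m))
    (hB : ContDiffAt ℝ ∞ B (basePt m)) (k i j : Fin 4) :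
    christoffel (metricG A B) k i j m = chrG A B m k i j := by
  simp only [christoffel, metricG_inv, (hasGrad_metricG hA hB _ _).pd, Fin.sum_univ_four]
  fin_cases k <;> fin_cases i <;> fin_cases j <;> simp [metricGrad, chrG] <;> ring

theorem hasGrad_chrG (hA : ContDiffAt ℝ ∞ A (basePt m)) (hB : ContDiffAt ℝ ∞ B (basePt m))
    (k i j : Fin 4) : HasGrad (fun m' => chrG A B m' k i j) (chrGrad A B m k i j) m := by
  have cA := (hasGrad_pd_of_contDiffAt hA).comp_basePt
  have cB := (hasGrad_pd_of_contDiffAt hB).comp_basePt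
  have cA0 := (hasGrad_pd_of_contDiffAt (contDiffAt_pd hA 0)).comp_basePt
  have cA1 := (hasGrad_pd_of_contDiffAt (contDiffAt_pd hA 1)).comp_basePt
  have cB0 := (hasGrad_pd_of_contDiffAt (contDiffAt_pd hB 0)).comp_basePt
  have cB1 := (hasGrad_pd_of_contDiffAt (contDiffAt_pd hB 1)).comp_basePt
  have c0 : HasGrad (fun _ : Fin 4 → ℝ => (0 : ℝ)) 0 m := hasGrad_const 0
  have z := hasGrad_coord (u := m) 2
  have t := hasGrad_coord (u := m) 3
  have h2 := (cA1.sub (((hasGrad_const 2).mul cA).mul z)).add (z.pow 3)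
  have h3 := (cB0.neg.add (t.pow 3)).add (((hasGrad_const 2).mul cB).mul t)
  fin_cases k <;> fin_cases i <;> fin_cases j <;> first
    | exact c0
    | exact cB1
    | exact cA0
    | (refine HasGrad.congr_grad z fun i => ?_
       fin_cases i <;> simp [chrGrad])
    | (refine HasGrad.congr_grad t fun i => ?_
       fin_cases i <;> simp [chrGrad])
    | (refine HasGrad.congr_grad z.neg fun i => ?_
       fin_cases i <;> simp [chrGrad])
    | (refine HasGrad.congr_grad t.neg fun i => ?_
       fin_cases i <;> simp [chrGrad])
    | (refine HasGrad.congr_grad cB1.neg fun i => ?_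
       fin_cases i <;> simp [chrGrad])
    | (refine HasGrad.congr_grad cA0.neg fun i => ?_
       fin_cases i <;> simp [chrGrad])
    | (refine HasGrad.congr_grad h2 fun i => ?_
       fin_cases i <;> simp [chrGrad] <;> ring)
    | (refine HasGrad.congr_grad h3 fun i => ?_
       fin_cases i <;> simp [chrGrad])

/-- The skew-symmetric matrix with the entries `a`, `b`, `c`, `d`, `e`, `f` in the positions
`01`, `02`, `03`, `12`, `13`, `23`. -/
def skew (a b c d e f : ℝ) : Matrix (Fin 4) (Fin 4) ℝ :=
  !![0, a, b, c; -a, 0, d, e; -b, -d, 0, f; -c, -e, -f, 0]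

variable (A B m) in
/-- The curvature 2-form of the metric: `Rᵏₗᵢⱼ` as a combination of `dx ∧ dt`, `dy ∧ dz` and
`dx ∧ dy`. -/
def curvG (k l i j : Fin 4) : ℝ :=
  skew 0 0 1 0 0 0 i j * !![-1, 0, 0, 0; 0, 0, 0, 0; 0, 0, 0, 0;
      -(m 3 ^ 2 + 2 * B (basePt m)), 0, 0, 1] k l
    + skew 0 0 0 1 0 0 i j * !![0, 0, 0, 0; 0, -1, 0, 0;
      0, 2 * A (basePt m) - m 2 ^ 2, 1, 0; 0, 0, 0, 0] k l
    + skew 1 0 0 0 0 0 i j * !![0, 0, 0, 0; 0, 0, 0, 0; typeQ A B m, 0, 0, 0;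
      0, -typeQ A B m, 0, 0] k l

theorem eventually_basePt {P : (Fin 2 → ℝ) → Prop} {m : Fin 4 → ℝ}
    (h : ∀ᶠ w in nhds (basePt m), P w) : ∀ᶠ m' in nhds m, P (basePt m') :=
  contDiff_basePt.continuous.continuousAt.eventually h

theorem riemann_swap (g : (Fin 4 → ℝ) → Matrix (Fin 4) (Fin 4) ℝ) (k l i j : Fin 4)
    (m : Fin 4 → ℝ) : riemann g k l j i m = -riemann g k l i j m := by
  simp only [riemann, Fin.sum_univ_four]
  ring

theorem curvG_swap (k l i j : Fin 4) : curvG A B m k l j i = -curvG A B m k l i j := by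
  have h : ∀ a b c d e f : ℝ, skew a b c d e f j i = -skew a b c d e f i j := by
    intro a b c d e f
    fin_cases i <;> fin_cases j <;> simp [skew]
  simp only [curvG, h]
  ring

set_option maxHeartbeats 2000000 in
theorem riemann_metricG {U : Set (Fin 2 → ℝ)} (hU : IsOpen U) (hA : ContDiffOn ℝ ∞ A U)
    (hB : ContDiffOn ℝ ∞ B U) (hm : basePt m ∈ U) (k l i j : Fin 4) :
    riemann (metricG A B) k l i j m = curvG A B m k l i j := by
  have aA : ∀ w ∈ U, ContDiffAt ℝ ∞ A w := fun w hw => hA.contDiffAt (hU.mem_nhds hw)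
  have aB : ∀ w ∈ U, ContDiffAt ℝ ∞ B w := fun w hw => hB.contDiffAt (hU.mem_nhds hw)
  have hc : ∀ k i j a, pd a (christoffel (metricG A B) k i j) m = chrGrad A B m k i j a := by
    intro k i j a
    rw [← (hasGrad_chrG (aA _ hm) (aB _ hm) k i j).pd a]
    refine pd_congr ?_
    filter_upwards [eventually_basePt (hU.mem_nhds hm)] with m' hm'
    exact christoffel_metricG (aA _ hm') (aB _ hm') k i j
  have sA := pd_comm (aA _ hm) 1 0
  have sB := pd_comm (aB _ hm) 1 0
  have key : ∀ i j, i < j → riemann (metricG A B) k l i j m = curvG A B m k l i j := by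
    intro i j hij
    simp only [riemann, hc, christoffel_metricG (aA _ hm) (aB _ hm), Fin.sum_univ_four]
    fin_cases i <;> fin_cases j <;> first
      | exact absurd hij (by decide)
      | (fin_cases k <;> fin_cases l <;>
          simp [chrGrad, chrG, curvG, skew, typeQ, sA, sB] <;> ring)
  rcases lt_trichotomy i j with h | h | h
  · exact key i j h
  · subst h
    have h1 := riemann_swap (metricG A B) k l i i m
    have h2 := curvG_swap (A := A) (B := B) (m := m) k l i i
    linarith
  · rw [riemann_swap, curvG_swap, key j i h]

end CurvatureOfG

/-! ### Ricci tensor and Petrov types -/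

section WeylOfG

variable {A B : (Fin 2 → ℝ) → ℝ} {m : Fin 4 → ℝ}

theorem ricci_metricG
    (hR : ∀ k l i j, riemann (metricG A B) k l i j m = curvG A B m k l i j) :
    ricci (metricG A B) m = -metricG A B m := by
  ext i j
  simp only [ricci, Matrix.of_apply, hR, Fin.sum_univ_four]
  fin_cases i <;> fin_cases j <;> simp [curvG, skew, metricG]

theorem scalarCurv_metricG
    (hR : ∀ k l i j, riemann (metricG A B) k l i j m = curvG A B m k l i j) :
    scalarCurv (metricG A B) m = -4 := by
  simp only [scalarCurv, ricci_metricG hR, metricG_inv, Fin.sum_univ_four]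
  simp [metricG]
  ring

/-- Raising both indices of a 2-form. -/
theorem raise_skew (a b c d e f : ℝ) :
    (metricG A B m)⁻¹ * skew a b c d e f * ((metricG A B m)⁻¹).transpose =
      skew (-f) (-e - (m 2 ^ 2 - 2 * A (basePt m)) * f) (-c) (-d)
        (-b + (m 3 ^ 2 + 2 * B (basePt m)) * f)
        (-a - (m 2 ^ 2 - 2 * A (basePt m)) * b + (m 3 ^ 2 + 2 * B (basePt m)) * e
          + (m 3 ^ 2 + 2 * B (basePt m)) * (m 2 ^ 2 - 2 * A (basePt m)) * f) := by
  rw [metricG_inv]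
  ext i j
  simp only [Matrix.mul_apply, Fin.sum_univ_four, Matrix.transpose_apply]
  fin_cases i <;> fin_cases j <;> simp [skew] <;> ring

/-- The Levi-Civita symbol is the Vandermonde product of its indices, divided by `12`; the integer
division is exact. -/
theorem leviCivita_eq (i j k l : Fin 4) : leviCivita i j k l =
    ((((j : ℤ) - i) * (k - i) * (l - i) * (k - j) * (l - j) * (l - k) / 12 : ℤ) : ℝ) := by
  have h : ∀ i j k l : Fin 4, Matrix.det (Matrix.of fun a b : Fin 4 =>
      if ![i, j, k, l] a = b then (1 : ℤ) else 0) =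
      ((j : ℤ) - i) * (k - i) * (l - i) * (k - j) * (l - j) * (l - k) / 12 := by
    decide +kernel
  rw [← h, leviCivita, Int.cast_det]
  congr 1
  ext a b
  simp

theorem hodge_skew (a b c d e f : ℝ) :
    hodge (-1) (metricG A B m) (skew a b c d e f) =
      skew (a + (m 2 ^ 2 - 2 * A (basePt m)) * b - (m 3 ^ 2 + 2 * B (basePt m)) * e
          - (m 3 ^ 2 + 2 * B (basePt m)) * (m 2 ^ 2 - 2 * A (basePt m)) * f)
        (-b + (m 3 ^ 2 + 2 * B (basePt m)) * f) d c
        (-e - (m 2 ^ 2 - 2 * A (basePt m)) * f) f := by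
  ext i j
  simp only [hodge, LinearMap.coe_mk, AddHom.coe_mk, Matrix.of_apply, raise_skew, metricG_det,
    leviCivita_eq, Fin.sum_univ_four]
  fin_cases i <;> fin_cases j <;> simp [skew] <;> ring

theorem weyl_metricG
    (hR : ∀ k l i j, riemann (metricG A B) k l i j m = curvG A B m k l i j) (i j k l : Fin 4) :
    weyl (metricG A B) i j k l m = ∑ a, metricG A B m i a * curvG A B m a j k l
      + 1 / 3 * (metricG A B m i k * metricG A B m j l - metricG A B m i l * metricG A B m j k) := by
  simp only [weyl, hR, scalarCurv_metricG hR, ricci_metricG hR, Matrix.neg_apply]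
  ring

/-- On coordinate 2-forms the Weyl operator is diagonal up to the single nilpotent entry `Q`, which
sends the `dz ∧ dt` component into the `dx ∧ dy` component. -/
theorem weylOp_skew
    (hR : ∀ k l i j, riemann (metricG A B) k l i j m = curvG A B m k l i j) (a b c d e f : ℝ) :
    weylOp (metricG A B) m (skew a b c d e f) =
      skew (a / 3 + typeQ A B m * f) (b / 3) (-2 * c / 3) (-2 * d / 3) (e / 3) (f / 3) := by
  ext i j
  simp only [weylOp, Matrix.of_apply, raise_skew, weyl_metricG hR, Fin.sum_univ_four]
  fin_cases i <;> fin_cases j <;> simp [skew, metricG, curvG] <;> ring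

theorem eq_skew_of_transpose {η : Matrix (Fin 4) (Fin 4) ℝ} (h : η.transpose = -η) :
    η = skew (η 0 1) (η 0 2) (η 0 3) (η 1 2) (η 1 3) (η 2 3) := by
  have h' : ∀ i j, η j i = -η i j := fun i j => congrFun (congrFun h i) j
  have h0 : ∀ i, η i i = 0 := fun i => by linarith [h' i i]
  ext i j
  fin_cases i <;> fin_cases j <;> simp [skew, h0, h' 0 1, h' 0 2, h' 0 3, h' 1 2, h' 1 3, h' 2 3]

theorem skew_transpose (a b c d e f : ℝ) :
    (skew a b c d e f).transpose = -skew a b c d e f := by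
  ext i j
  fin_cases i <;> fin_cases j <;> simp [skew]

theorem skew_inj {a b c d e f a' b' c' d' e' f' : ℝ}
    (h : skew a b c d e f = skew a' b' c' d' e' f') :
    a = a' ∧ b = b' ∧ c = c' ∧ d = d' ∧ e = e' ∧ f = f' :=
  ⟨congrFun (congrFun h 0) 1, congrFun (congrFun h 0) 2, congrFun (congrFun h 0) 3,
    congrFun (congrFun h 1) 2, congrFun (congrFun h 1) 3, congrFun (congrFun h 2) 3⟩

variable (A B m) in
/-- The self-dual forms of the metric, with the coefficients of `dx ∧ dy`, `dx ∧ dt + dy ∧ dz`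
and `dz ∧ dt` as parameters. -/
def sdForm (c : Fin 3 → ℝ) : Matrix (Fin 4) (Fin 4) ℝ :=
  skew (c 0) ((m 3 ^ 2 + 2 * B (basePt m)) / 2 * c 1) (c 2) (c 2)
    (-(m 2 ^ 2 - 2 * A (basePt m)) / 2 * c 1) (c 1)

variable (A B m) in
/-- The anti-self-dual forms of the metric, with the coefficients of `dx ∧ dz`, `dy ∧ dt` and
`dx ∧ dt - dy ∧ dz` as parameters. -/
def asdForm (c : Fin 3 → ℝ) : Matrix (Fin 4) (Fin 4) ℝ :=
  skew (-(m 2 ^ 2 - 2 * A (basePt m)) / 2 * c 0 + (m 3 ^ 2 + 2 * B (basePt m)) / 2 * c 1)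
    (c 0) (c 2) (-c 2) (c 1) 0

theorem mem_selfDual_iff {η : Matrix (Fin 4) (Fin 4) ℝ} :
    η ∈ selfDual (-1) (metricG A B m) ↔ ∃ c, η = sdForm A B m c := by
  constructor
  · rintro ⟨h1, h2⟩
    rw [eq_skew_of_transpose h1, hodge_skew, one_smul] at h2
    obtain ⟨h3, h4, h5, -, h6, -⟩ := skew_inj h2
    refine ⟨![η 0 1, η 2 3, η 0 3], ?_⟩
    rw [eq_skew_of_transpose h1]
    simp only [sdForm]
    congr 1 <;> simp [skew] <;> linarith
  · rintro ⟨c, rfl⟩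
    refine ⟨skew_transpose _ _ _ _ _ _, ?_⟩
    rw [sdForm, hodge_skew, one_smul]
    congr 1 <;> ring

theorem mem_antiSelfDual_iff {η : Matrix (Fin 4) (Fin 4) ℝ} :
    η ∈ antiSelfDual (-1) (metricG A B m) ↔ ∃ c, η = asdForm A B m c := by
  have hneg : ∀ a b c d e f, (-1 : ℝ) • skew a b c d e f
      = skew (-a) (-b) (-c) (-d) (-e) (-f) := by
    intro a b c d e f
    ext i j
    fin_cases i <;> fin_cases j <;> simp [skew]
  constructor
  · rintro ⟨h1, h2⟩
    rw [eq_skew_of_transpose h1, hodge_skew, hneg] at h2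
    obtain ⟨h3, h4, h5, -, h6, h7⟩ := skew_inj h2
    have hf : η 2 3 = 0 := by linarith
    rw [hf] at h3
    refine ⟨![η 0 2, η 1 3, η 0 3], ?_⟩
    rw [eq_skew_of_transpose h1]
    simp only [asdForm]
    congr 1
    simp [skew]
    linarith
  · rintro ⟨c, rfl⟩
    refine ⟨skew_transpose _ _ _ _ _ _, ?_⟩
    rw [asdForm, hodge_skew, hneg]
    congr 1 <;> ring

/-- A basis of a space of 2-forms that is parametrized linearly and injectively by `ℝ³`. -/
theorem exists_basis_of_param {V : Submodule ℝ (Matrix (Fin 4) (Fin 4) ℝ)}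
    (p : (Fin 3 → ℝ) →ₗ[ℝ] Matrix (Fin 4) (Fin 4) ℝ) (hp : Function.Injective p)
    (hV : ∀ η, η ∈ V ↔ ∃ c, η = p c) (e : Module.Basis (Fin 3) ℝ (Fin 3 → ℝ)) :
    ∃ b : Module.Basis (Fin 3) ℝ V, ∀ i, (b i : Matrix (Fin 4) (Fin 4) ℝ) = p (e i) := by
  have hr : LinearMap.range p = V := by
    ext η
    rw [hV]
    exact ⟨fun ⟨c, hc⟩ => ⟨c, hc.symm⟩, fun ⟨c, hc⟩ => ⟨c, hc.symm⟩⟩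
  subst hr
  exact ⟨e.map (LinearEquiv.ofInjective p hp), fun i => rfl⟩

variable (A B m) in
/-- `sdForm` as a linear map. -/
def sdMap : (Fin 3 → ℝ) →ₗ[ℝ] Matrix (Fin 4) (Fin 4) ℝ where
  toFun := sdForm A B m
  map_add' c c' := by
    ext i j
    fin_cases i <;> fin_cases j <;> simp [sdForm, skew] <;> ring
  map_smul' r c := by
    ext i j
    fin_cases i <;> fin_cases j <;> simp [sdForm, skew] <;> ring

variable (A B m) in
/-- `asdForm` as a linear map. -/
def asdMap : (Fin 3 → ℝ) →ₗ[ℝ] Matrix (Fin 4) (Fin 4) ℝ where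
  toFun := asdForm A B m
  map_add' c c' := by
    ext i j
    fin_cases i <;> fin_cases j <;> simp [asdForm, skew] <;> ring
  map_smul' r c := by
    ext i j
    fin_cases i <;> fin_cases j <;> simp [asdForm, skew] <;> ring

theorem sdMap_injective : Function.Injective (sdMap A B m) := by
  intro c c' h
  obtain ⟨h0, -, h2, -, -, h1⟩ := skew_inj (show sdForm A B m c = sdForm A B m c' from h)
  ext i
  fin_cases i <;> assumption

theorem asdMap_injective : Function.Injective (asdMap A B m) := by
  intro c c' h
  obtain ⟨-, h0, h2, -, h1, -⟩ := skew_inj (show asdForm A B m c = asdForm A B m c' from h)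
  ext i
  fin_cases i <;> assumption

theorem weylOp_sdMap
    (hR : ∀ k l i j, riemann (metricG A B) k l i j m = curvG A B m k l i j) (c : Fin 3 → ℝ) :
    weylOp (metricG A B) m (sdMap A B m c) =
      sdMap A B m ![c 0 / 3 + typeQ A B m * c 1, c 1 / 3, -2 * c 2 / 3] := by
  change weylOp _ m (sdForm A B m c) = sdForm A B m _
  rw [sdForm, weylOp_skew hR]
  simp only [sdForm]
  congr 1 <;> simp <;> ring

theorem weylOp_asdMap
    (hR : ∀ k l i j, riemann (metricG A B) k l i j m = curvG A B m k l i j) (c : Fin 3 → ℝ) :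
    weylOp (metricG A B) m (asdMap A B m c) =
      asdMap A B m ![c 0 / 3, c 1 / 3, -2 * c 2 / 3] := by
  change weylOp _ m (asdForm A B m c) = asdForm A B m _
  rw [asdForm, weylOp_skew hR]
  simp only [asdForm]
  congr 1 <;> simp <;> ring

theorem asdTypeD_metricG
    (hR : ∀ k l i j, riemann (metricG A B) k l i j m = curvG A B m k l i j) :
    ASDTypeD (metricG A B) m := by
  obtain ⟨b, hb⟩ := exists_basis_of_param (asdMap A B m) asdMap_injective
    (fun η => mem_antiSelfDual_iff) (Pi.basisFun ℝ (Fin 3))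
  refine ⟨1 / 3, by norm_num, b, ?_, ?_, ?_⟩ <;>
  · rw [hb, weylOp_asdMap hR, ← map_smul]
    congr 1
    ext i
    fin_cases i <;> simp <;> norm_num

theorem sdTypeD_of_typeQ_eq_zero
    (hR : ∀ k l i j, riemann (metricG A B) k l i j m = curvG A B m k l i j)
    (hQ : typeQ A B m = 0) : SDTypeD (metricG A B) m := by
  obtain ⟨b, hb⟩ := exists_basis_of_param (sdMap A B m) sdMap_injective
    (fun η => mem_selfDual_iff) (Pi.basisFun ℝ (Fin 3))
  refine ⟨1 / 3, by norm_num, b, ?_, ?_, ?_⟩ <;>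
  · rw [hb, weylOp_sdMap hR, ← map_smul, hQ]
    congr 1
    ext i
    fin_cases i <;> simp <;> norm_num

theorem sdTypeII_of_typeQ_ne_zero
    (hR : ∀ k l i j, riemann (metricG A B) k l i j m = curvG A B m k l i j)
    (hQ : typeQ A B m ≠ 0) : SDTypeII (metricG A B) m := by
  -- rescaling `dx ∧ dy` by `Q` turns the nilpotent entry into `1`
  let w : Fin 3 → ℝˣ := ![Units.mk0 _ hQ, 1, 1]
  obtain ⟨b, hb⟩ := exists_basis_of_param (sdMap A B m) sdMap_injective
    (fun η => mem_selfDual_iff) ((Pi.basisFun ℝ (Fin 3)).unitsSMul w)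
  refine ⟨1 / 3, by norm_num, b, ?_, ?_, ?_⟩
  · rw [hb, weylOp_sdMap hR, ← map_smul]
    congr 1
    ext i
    fin_cases i <;> simp [Module.Basis.unitsSMul_apply, w, Units.smul_def]
    ring
  · rw [hb, hb, weylOp_sdMap hR, ← map_smul, ← map_add]
    congr 1
    ext i
    fin_cases i <;> simp [Module.Basis.unitsSMul_apply, w, Units.smul_def]
  · rw [hb, weylOp_sdMap hR, ← map_smul]
    congr 1
    ext i
    fin_cases i <;> simp [Module.Basis.unitsSMul_apply, w]
    norm_num

/-- Type D means that `(T - μ) (T + 2μ)` annihilates the self-dual forms, which is impossible when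
the nilpotent entry `Q` does not vanish. -/
theorem typeQ_eq_zero_of_sdTypeD
    (hR : ∀ k l i j, riemann (metricG A B) k l i j m = curvG A B m k l i j)
    (hD : SDTypeD (metricG A B) m) : typeQ A B m = 0 := by
  obtain ⟨μ, hμ, b, h0, h1, h2⟩ := hD
  -- the Weyl operator, transported to the parameters of self-dual forms
  let T : (Fin 3 → ℝ) → Fin 3 → ℝ := fun c =>
    ![c 0 / 3 + typeQ A B m * c 1, c 1 / 3, -2 * c 2 / 3]
  have hb : ∀ i, ∃ c, (b i : Matrix (Fin 4) (Fin 4) ℝ) = sdMap A B m c :=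
    fun i => mem_selfDual_iff.1 (b i).2
  choose c hc using hb
  have t : ∀ (i : Fin 3) (ν : ℝ), weylOp (metricG A B) m (b i) = ν • (b i : Matrix (Fin 4) (Fin 4) ℝ) →
      T (c i) = ν • c i := by
    intro i ν h
    rw [hc, weylOp_sdMap hR, ← map_smul] at h
    exact sdMap_injective h
  have t0 := t 0 _ h0
  have t1 := t 1 _ h1
  have t2 := t 2 _ h2
  have hann : ∀ (ν : ℝ) (v : Fin 3 → ℝ), T v = ν • v → (ν = μ ∨ ν = -2 * μ) →
      (v 0 / 9 + 2 / 3 * typeQ A B m * v 1 + μ * (v 0 / 3 + typeQ A B m * v 1)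
        - 2 * μ ^ 2 * v 0 = 0) ∧ (1 / 3 - μ) * (1 / 3 + 2 * μ) * v 1 = 0 ∧
        (-2 / 3 - μ) * (-2 / 3 + 2 * μ) * v 2 = 0 := by
    intro ν v hv hν
    have e0 : v 0 / 3 + typeQ A B m * v 1 = ν * v 0 := congrFun hv 0
    have e1 : v 1 / 3 = ν * v 1 := congrFun hv 1
    have e2 : -2 * v 2 / 3 = ν * v 2 := congrFun hv 2
    have q : ν ^ 2 + μ * ν - 2 * μ ^ 2 = 0 := by rcases hν with rfl | rfl <;> ring
    refine ⟨?_, ?_, ?_⟩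
    · linear_combination (1 / 3 + ν + μ) * e0 + typeQ A B m * e1 + v 0 * q
    · linear_combination (1 / 3 + ν + μ) * e1 + v 1 * q
    · linear_combination (-2 / 3 + ν + μ) * e2 + v 2 * q
  have hall : ∀ v : Fin 3 → ℝ,
      (v 0 / 9 + 2 / 3 * typeQ A B m * v 1 + μ * (v 0 / 3 + typeQ A B m * v 1)
        - 2 * μ ^ 2 * v 0 = 0) ∧ (1 / 3 - μ) * (1 / 3 + 2 * μ) * v 1 = 0 ∧
        (-2 / 3 - μ) * (-2 / 3 + 2 * μ) * v 2 = 0 := by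
    intro v
    have hv : sdMap A B m v ∈ selfDual (-1) (metricG A B m) := mem_selfDual_iff.2 ⟨v, rfl⟩
    have hs := congrArg Subtype.val (b.sum_repr ⟨_, hv⟩)
    simp only [Fin.sum_univ_three, Submodule.coe_add, Submodule.coe_smul, hc, ← map_smul,
      ← map_add] at hs
    have hs' := sdMap_injective hs
    obtain ⟨x0, x1, x2⟩ := hann _ _ t0 (Or.inl rfl)
    obtain ⟨y0, y1, y2⟩ := hann _ _ t1 (Or.inl rfl)
    obtain ⟨z0, z1, z2⟩ := hann _ _ t2 (Or.inr rfl)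
    rw [← hs']
    generalize b.repr ⟨_, hv⟩ 0 = r0
    generalize b.repr ⟨_, hv⟩ 1 = r1
    generalize b.repr ⟨_, hv⟩ 2 = r2
    simp only [Pi.add_apply, Pi.smul_apply, smul_eq_mul]
    refine ⟨?_, ?_, ?_⟩
    · linear_combination r0 * x0 + r1 * y0 + r2 * z0
    · linear_combination r0 * x1 + r1 * y1 + r2 * z1
    · linear_combination r0 * x2 + r1 * y2 + r2 * z2
  -- the eigenvalues `1/3` and `-2/3` fix `μ = 1/3`, after which the `dz ∧ dt` column gives `Q`
  have k1 := (hall ![0, 1, 0]).2.1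
  have k2 := (hall ![0, 0, 1]).2.2
  have k0 := (hall ![0, 1, 0]).1
  simp at k1 k2 k0
  have hμ' : μ = 1 / 3 := by
    rcases k1 with h | h
    · linarith
    · rcases k2 with h' | h' <;> linarith
  subst hμ'
  linarith

theorem typeQ_ne_zero_of_sdTypeII
    (hR : ∀ k l i j, riemann (metricG A B) k l i j m = curvG A B m k l i j)
    (hII : SDTypeII (metricG A B) m) : typeQ A B m ≠ 0 := by
  intro hQ
  obtain ⟨μ, hμ, b, h0, h1, h2⟩ := hII
  have hb : ∀ i, ∃ c, (b i : Matrix (Fin 4) (Fin 4) ℝ) = sdMap A B m c :=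
    fun i => mem_selfDual_iff.1 (b i).2
  choose c hc using hb
  have hne : ∀ i, c i ≠ 0 := fun i h => b.ne_zero i (Subtype.ext (by rw [hc, h, map_zero]; rfl))
  rw [hc, weylOp_sdMap hR, hQ, ← map_smul] at h0 h2
  rw [hc, hc, weylOp_sdMap hR, hQ, ← map_smul, ← map_add] at h1
  have t0 := sdMap_injective h0
  have t1 := sdMap_injective h1
  have t2 := sdMap_injective h2
  have x0 := congrFun t0 0
  have x1 := congrFun t0 1
  have x2 := congrFun t0 2
  have y0 := congrFun t1 0
  have y1 := congrFun t1 1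
  have y2 := congrFun t1 2
  have z0 := congrFun t2 0
  have z1 := congrFun t2 1
  have z2 := congrFun t2 2
  simp only [Matrix.cons_val, Pi.add_apply, Pi.smul_apply, smul_eq_mul] at *
  -- for `Q = 0` the operator is annihilated by `(T - 1/3) (T + 2/3)`, so both `μ` and `-2μ`
  -- are among `1/3` and `-2/3`
  have hν : ∀ (ν : ℝ) (v : Fin 3 → ℝ), v ≠ 0 → v 0 / 3 + 0 * v 1 = ν * v 0 →
      v 1 / 3 = ν * v 1 → -2 * v 2 / 3 = ν * v 2 → (ν - 1 / 3) * (ν + 2 / 3) = 0 := by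
    intro ν v hv e0 e1 e2
    by_contra hν
    refine hv (funext fun i => mul_left_cancel₀ hν ?_)
    fin_cases i
    · change (ν - 1 / 3) * (ν + 2 / 3) * v 0 = (ν - 1 / 3) * (ν + 2 / 3) * 0
      linear_combination (-ν - 2 / 3) * e0
    · change (ν - 1 / 3) * (ν + 2 / 3) * v 1 = (ν - 1 / 3) * (ν + 2 / 3) * 0
      linear_combination (-ν - 2 / 3) * e1
    · change (ν - 1 / 3) * (ν + 2 / 3) * v 2 = (ν - 1 / 3) * (ν + 2 / 3) * 0
      linear_combination (-ν + 1 / 3) * e2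
  have m0 := hν _ _ (hne 0) x0 x1 x2
  have m2 := hν _ _ (hne 2) z0 z1 z2
  have hμ' : μ = 1 / 3 := by
    rcases mul_eq_zero.1 m0 with h | h
    · linarith
    · rcases mul_eq_zero.1 m2 with h' | h' <;> linarith
  subst hμ'
  refine hne 0 (funext fun i => ?_)
  fin_cases i
  · simp; linarith
  · simp; linarith
  · simp; linarith

end WeylOfG

/-! ### The coframe of the equation -/

theorem isOpen_jetSpace {U : Set (Fin 2 → ℝ)} (hU : IsOpen U) : IsOpen (jetSpace U) :=
  (hU.preimage contDiff_basePt.continuous).inter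
    (isOpen_ne.preimage (continuous_apply (2 : Fin 4)))

theorem isOpen_fourSpace {U : Set (Fin 2 → ℝ)} (hU : IsOpen U) : IsOpen (fourSpace U) :=
  hU.preimage contDiff_basePt.continuous

section OdeF

variable {U : Set (Fin 2 → ℝ)} {A B C : (Fin 2 → ℝ) → ℝ} {j : Fin 4 → ℝ}

theorem hasGrad_odeF (hA : ContDiffAt ℝ ∞ A (basePt j)) (hB : ContDiffAt ℝ ∞ B (basePt j))
    (hC : ContDiffAt ℝ ∞ C (basePt j)) (hp : j 2 ≠ 0) :
    HasGrad (odeF A B C)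
      ![pd 0 A (basePt j) * j 2 ^ 3 + pd 0 C (basePt j) * j 2 ^ 2 + pd 0 B (basePt j) * j 2,
        pd 1 A (basePt j) * j 2 ^ 3 + pd 1 C (basePt j) * j 2 ^ 2 + pd 1 B (basePt j) * j 2,
        -(3 / 2) * (j 3 ^ 2 / j 2 ^ 2) + 3 * A (basePt j) * j 2 ^ 2 + 2 * C (basePt j) * j 2
          + B (basePt j),
        3 * (j 3 / j 2)] j := by
  have cA := (hasGrad_pd_of_contDiffAt hA).comp_basePt
  have cB := (hasGrad_pd_of_contDiffAt hB).comp_basePt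
  have cC := (hasGrad_pd_of_contDiffAt hC).comp_basePt
  have p := hasGrad_coord (u := j) 2
  have q := hasGrad_coord (u := j) 3
  refine (((((hasGrad_const (3 / 2)).mul ((q.pow 2).div p hp)).add (cA.mul (p.pow 3))).add
    (cC.mul (p.pow 2))).add (cB.mul p)).congr_grad fun i => ?_
  fin_cases i <;> simp <;> field_simp

theorem hasGrad_odeF_q (hp : j 2 ≠ 0) : HasGrad (fun j : Fin 4 → ℝ => 3 * (j 3 / j 2))
    ![0, 0, -3 * (j 3 / j 2 ^ 2), 3 / j 2] j := by
  refine ((hasGrad_const 3).mul ((hasGrad_coord (u := j) 3).div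
    (hasGrad_coord (u := j) 2) hp)).congr_grad fun i => ?_
  fin_cases i <;> simp <;> field_simp

theorem hasGrad_odeF_qq (hp : j 2 ≠ 0) : HasGrad (fun j : Fin 4 → ℝ => 3 / j 2)
    ![0, 0, -3 / j 2 ^ 2, 0] j := by
  refine ((hasGrad_const 3).div (hasGrad_coord (u := j) 2) hp).congr_grad fun i => ?_
  fin_cases i <;> simp

variable (hU : IsOpen U) (hA : ContDiffOn ℝ ∞ A U) (hB : ContDiffOn ℝ ∞ B U)
  (hC : ContDiffOn ℝ ∞ C U)
include hU hA hB hC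

theorem pd_odeF_q : ∀ j ∈ jetSpace U, pd 3 (odeF A B C) j = 3 * (j 3 / j 2) := fun _ hj =>
  (hasGrad_odeF (hA.contDiffAt (hU.mem_nhds hj.1)) (hB.contDiffAt (hU.mem_nhds hj.1))
    (hC.contDiffAt (hU.mem_nhds hj.1)) hj.2).pd 3

theorem hasGrad_pd_odeF_q : ∀ j ∈ jetSpace U,
    HasGrad (pd 3 (odeF A B C)) ![0, 0, -3 * (j 3 / j 2 ^ 2), 3 / j 2] j := fun _ hj =>
  (hasGrad_odeF_q hj.2).congr_fun (Filter.eventuallyEq_of_mem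
    ((isOpen_jetSpace hU).mem_nhds hj) (pd_odeF_q hU hA hB hC))

theorem hasGrad_pd_odeF_qq : ∀ j ∈ jetSpace U,
    HasGrad (pd 3 (pd 3 (odeF A B C))) ![0, 0, -3 / j 2 ^ 2, 0] j := fun _ hj =>
  (hasGrad_odeF_qq hj.2).congr_fun (Filter.eventuallyEq_of_mem
    ((isOpen_jetSpace hU).mem_nhds hj) fun j hj => (hasGrad_pd_odeF_q hU hA hB hC j hj).pd 3)

theorem Kfun_odeF : ∀ j ∈ jetSpace U,
    Kfun (odeF A B C) j = -(A (basePt j) * j 2 ^ 2) - 1 / 2 * (C (basePt j) * j 2) := by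
  intro j hj
  have hp := hj.2
  have h1 := hasGrad_odeF (hA.contDiffAt (hU.mem_nhds hj.1)) (hB.contDiffAt (hU.mem_nhds hj.1))
    (hC.contDiffAt (hU.mem_nhds hj.1)) hj.2
  have h2 := hasGrad_pd_odeF_q hU hA hB hC j hj
  rw [Kfun, h1.pd, h1.pd, h2.pd, h2.pd, h2.pd, h2.pd, odeF]
  simp only [Matrix.cons_val]
  field_simp
  ring

theorem hasGrad_Kfun_odeF : ∀ j ∈ jetSpace U, HasGrad (Kfun (odeF A B C))
    ![-(pd 0 A (basePt j) * j 2 ^ 2) - 1 / 2 * (pd 0 C (basePt j) * j 2),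
      -(pd 1 A (basePt j) * j 2 ^ 2) - 1 / 2 * (pd 1 C (basePt j) * j 2),
      -2 * A (basePt j) * j 2 - 1 / 2 * C (basePt j), 0] j := by
  intro j hj
  have cA := (hasGrad_pd_of_contDiffAt (hA.contDiffAt (hU.mem_nhds hj.1))).comp_basePt
  have cC := (hasGrad_pd_of_contDiffAt (hC.contDiffAt (hU.mem_nhds hj.1))).comp_basePt
  have p := hasGrad_coord (u := j) 2
  refine (((cA.mul (p.pow 2)).neg.sub ((hasGrad_const (1 / 2)).mul (cC.mul p))).congr_fun
    (Filter.eventuallyEq_of_mem ((isOpen_jetSpace hU).mem_nhds hj)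
      (Kfun_odeF hU hA hB hC))).congr_grad fun i => ?_
  fin_cases i <;> simp
  ring

section Forms

variable {u : Fin 6 → ℝ} (hu : u ∈ totalSpace U) (v : Fin 6 → ℝ)
include hu

theorem theta2_odeF_apply : theta2 (odeF A B C) u v =
    1 / (2 * u 2) * (omega2 u v + u 5 * omega1 u v) := by
  rw [theta2, (hasGrad_pd_odeF_q hU hA hB hC _ hu.1).pd]
  simp [jet]
  ring

theorem theta3_odeF_apply : theta3 (odeF A B C) u v =
    1 / (4 * u 4 * u 2 ^ 2) * (omega3 (odeF A B C) u v + (u 5 - u 3 / u 2) * omega2 u v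
      + (1 / 2 * u 5 ^ 2 - A (basePt (jet u)) * u 2 ^ 2 - 1 / 2 * (C (basePt (jet u)) * u 2))
        * omega1 u v) := by
  rw [theta3, (hasGrad_pd_odeF_q hU hA hB hC _ hu.1).pd, pd_odeF_q hU hA hB hC _ hu.1,
    Kfun_odeF hU hA hB hC _ hu.1]
  simp [jet]
  ring

theorem theta4_odeF_apply : theta4 (odeF A B C) u v = 2 * u 4 * u 2 * v 0 := by
  have hp : u 2 ≠ 0 := hu.1.2
  rw [theta4, (hasGrad_pd_odeF_q hU hA hB hC _ hu.1).pd]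
  simp [jet, omega4, dcoord_apply]
  field_simp
  exact Or.inl (by ring)

theorem Omega1_odeF_apply : Omega1 (odeF A B C) u v =
    -(u 5 / u 2) * omega1 u v - u 5 * v 0 + 1 / u 4 * v 4 := by
  have hp : u 2 ≠ 0 := hu.1.2
  have h3 := hasGrad_pd_odeF_qq hU hA hB hC _ hu.1
  simp only [Omega1, (hasGrad_pd_odeF_q hU hA hB hC _ hu.1).pd, h3.pd,
    (hasGrad_Kfun_odeF hU hA hB hC _ hu.1).pd]
  simp [jet, omega4, dcoord_apply]
  field_simp
  ring

theorem Omega2_odeF_apply : Omega2 (odeF A B C) u v = 1 / (2 * u 4 * u 2) *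
    (-(1 / 2 * u 5 ^ 2 + u 3 / u 2 * u 5 - A (basePt (jet u)) * u 2 ^ 2
        - 1 / 2 * (C (basePt (jet u)) * u 2)) * v 0
      - u 5 / u 2 * omega2 u v
      + (-(1 / 2) * (u 5 ^ 2 / u 2) + A (basePt (jet u)) * u 2) * omega1 u v + v 5) := by
  have hp : u 2 ≠ 0 := hu.1.2
  have hα : u 4 ≠ 0 := hu.2
  have h2 := hasGrad_pd_odeF_q hU hA hB hC _ hu.1
  have h3 := hasGrad_pd_odeF_qq hU hA hB hC _ hu.1
  have h4 := hasGrad_Kfun_odeF hU hA hB hC _ hu.1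
  simp only [Omega2, h2.pd, h3.pd, h4.pd, pd_odeF_q hU hA hB hC _ hu.1,
    Kfun_odeF hU hA hB hC _ hu.1]
  simp [jet, omega4, dcoord_apply]
  field_simp
  ring

end Forms

end OdeF

theorem omega1_apply (u v : Fin 6 → ℝ) : omega1 u v = v 1 - u 2 * v 0 := rfl

theorem omega2_apply (u v : Fin 6 → ℝ) : omega2 u v = v 2 - u 3 * v 0 := rfl

theorem omega3_apply (F : (Fin 4 → ℝ) → ℝ) (u v : Fin 6 → ℝ) :
    omega3 F u v = v 3 - F (jet u) * v 0 := rfl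

/-! ### The projection to the four-space -/

theorem hasGrad_proj {u : Fin 6 → ℝ} (hp : u 2 ≠ 0) (i : Fin 4) :
    HasGrad (fun u => proj u i) (![![1, 0, 0, 0, 0, 0], ![0, 1, 0, 0, 0, 0],
      ![0, 0, -(u 5 / u 2 ^ 2), 0, 0, 1 / u 2],
      ![0, 0, -(u 3 / u 2 ^ 2), 1 / u 2, 0, 1]] i) u := by
  fin_cases i
  · refine (hasGrad_coord 0).congr_grad fun i => ?_
    fin_cases i <;> simp
  · refine (hasGrad_coord 1).congr_grad fun i => ?_
    fin_cases i <;> simp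
  · refine ((hasGrad_coord 5).div (hasGrad_coord 2) hp).congr_grad fun i => ?_
    fin_cases i <;> simp <;> field_simp
  · refine (((hasGrad_coord 3).div (hasGrad_coord 2) hp).add (hasGrad_coord 5)).congr_grad
      fun i => ?_
    fin_cases i <;> simp <;> field_simp

/-- The derivative of a map is computed componentwise. -/
theorem fderiv_apply_of_hasGrad {m n : ℕ} {φ : (Fin m → ℝ) → Fin n → ℝ} {u : Fin m → ℝ}
    {e : Fin n → Fin m → ℝ} (hφ : ∀ a, HasGrad (fun v => φ v a) (e a) u) (v : Fin m → ℝ)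
    (a : Fin n) : fderiv ℝ φ u v a = ∑ i, e a i * v i := by
  have hφ' : HasFDerivAt φ (ContinuousLinearMap.pi fun a => ∑ i, e a i • dcoord i) u :=
    hasFDerivAt_pi.2 hφ
  rw [hφ'.fderiv]
  simp [dcoord_apply]

theorem fderiv_proj {u : Fin 6 → ℝ} (hp : u 2 ≠ 0) (v : Fin 6 → ℝ) :
    fderiv ℝ proj u v = ![v 0, v 1, v 5 / u 2 - u 5 / u 2 ^ 2 * v 2,
      v 3 / u 2 - u 3 / u 2 ^ 2 * v 2 + v 5] := by
  ext i
  rw [fderiv_apply_of_hasGrad (hasGrad_proj hp)]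
  fin_cases i <;> simp [Fin.sum_univ_six] <;> ring

theorem contDiffOn_proj (U : Set (Fin 2 → ℝ)) : ContDiffOn ℝ ∞ proj (totalSpace U) := by
  have c : ∀ i : Fin 6, ContDiffOn ℝ ∞ (fun u : Fin 6 → ℝ => u i) (totalSpace U) :=
    fun i => (contDiff_apply ℝ ℝ i).contDiffOn
  refine contDiffOn_pi.2 fun i => ?_
  fin_cases i
  · exact c 0
  · exact c 1
  · exact (c 5).div (c 2) fun u hu => hu.1.2
  · exact ((c 3).div (c 2) fun u hu => hu.1.2).add (c 5)

theorem surjective_fderiv_proj {u : Fin 6 → ℝ} (hp : u 2 ≠ 0) :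
    Function.Surjective (fderiv ℝ proj u) := by
  intro w
  refine ⟨![w 0, w 1, 0, u 2 * (w 3 - u 2 * w 2), 0, u 2 * w 2], ?_⟩
  rw [fderiv_proj hp]
  ext i
  fin_cases i <;> simp <;> field_simp
  ring

/-- The fibres of the projection are graphs over the coordinates `p` and `α`. -/
theorem isConnected_fibre {U : Set (Fin 2 → ℝ)} {m : Fin 4 → ℝ} (hm : m ∈ fourSpace U) {a b : ℝ}
    (ha : a ≠ 0) (hb : b ≠ 0) :
    IsConnected {u | u ∈ totalSpace U ∧ proj u = m ∧ 0 < a * u 2 ∧ 0 < b * u 4} := by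
  have hconv : ∀ c : ℝ, c ≠ 0 → IsConnected {x : ℝ | 0 < c * x} := by
    intro c hc
    refine ⟨⟨c, mul_self_pos.2 hc⟩, Convex.isPreconnected fun x hx y hy s t hs ht hst => ?_⟩
    simp only [Set.mem_ofPred_eq, smul_eq_mul] at *
    rcases hs.eq_or_lt with rfl | hs'
    · have : t = 1 := by linarith
      subst this
      simpa using hy
    · nlinarith [mul_pos hs' hx, mul_nonneg ht hy.le]
  let σ : ℝ × ℝ → Fin 6 → ℝ := fun x =>
    ![m 0, m 1, x.1, x.1 * (m 3 - m 2 * x.1), x.2, m 2 * x.1]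
  have hσ : Continuous σ := by
    refine continuous_pi fun i => ?_
    fin_cases i <;> simp [σ] <;> fun_prop
  convert ((hconv a ha).prod (hconv b hb)).image σ hσ.continuousOn using 1
  ext u
  constructor
  · rintro ⟨hu, rfl, h1, h2⟩
    have hp : u 2 ≠ 0 := hu.1.2
    refine ⟨(u 2, u 4), ⟨h1, h2⟩, ?_⟩
    ext i
    fin_cases i <;> simp [σ, proj] <;> field_simp
    ring
  · rintro ⟨⟨p, α⟩, ⟨h1, h2⟩, rfl⟩
    simp only [Set.mem_ofPred_eq] at h1 h2
    have hp : p ≠ 0 := right_ne_zero_of_mul h1.ne'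
    have hα : α ≠ 0 := right_ne_zero_of_mul h2.ne'
    refine ⟨⟨⟨hm, hp⟩, hα⟩, ?_, h1, h2⟩
    ext i
    fin_cases i <;> simp [σ, proj] <;> field_simp
    ring

section Descent

variable {U : Set (Fin 2 → ℝ)} {A B C : (Fin 2 → ℝ) → ℝ}
  (hU : IsOpen U) (hA : ContDiffOn ℝ ∞ A U) (hB : ContDiffOn ℝ ∞ B U) (hC : ContDiffOn ℝ ∞ C U)
include hU hA hB hC

theorem fderiv_proj_eq_zero_iff {u : Fin 6 → ℝ} (hu : u ∈ totalSpace U) (v : Fin 6 → ℝ) :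
    fderiv ℝ proj u v = 0 ↔ ∀ i, nullForms (odeF A B C) u i v = 0 := by
  have hp : u 2 ≠ 0 := hu.1.2
  have hα : u 4 ≠ 0 := hu.2
  have e0 : nullForms (odeF A B C) u 0 v = 2 * u 4 * v 1 := by
    change 2 * (u 4 * omega1 u v) + theta4 (odeF A B C) u v = _
    rw [theta4_odeF_apply hU hA hB hC hu, omega1_apply]
    ring
  have e1 : nullForms (odeF A B C) u 1 v = Omega2 (odeF A B C) u v := rfl
  have e2 : nullForms (odeF A B C) u 2 v
      = Omega2 (odeF A B C) u v + 2 * theta3 (odeF A B C) u v := rfl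
  have e3 : nullForms (odeF A B C) u 3 v = theta4 (odeF A B C) u v := rfl
  have hi : (∀ i, nullForms (odeF A B C) u i v = 0) ↔ v 0 = 0 ∧ v 1 = 0 ∧
      Omega2 (odeF A B C) u v = 0 ∧ theta3 (odeF A B C) u v = 0 := by
    rw [Fin.forall_fin_succ, Fin.forall_fin_succ, Fin.forall_fin_two]
    change (nullForms (odeF A B C) u 0 v = 0 ∧ nullForms (odeF A B C) u 1 v = 0 ∧
      nullForms (odeF A B C) u 2 v = 0 ∧ nullForms (odeF A B C) u 3 v = 0) ↔ _
    rw [e0, e1, e2, e3, theta4_odeF_apply hU hA hB hC hu]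
    constructor
    · rintro ⟨h0, h1, h2, h3⟩
      refine ⟨by simpa [hp, hα] using h3, by simpa [hα] using h0, h1, by linarith⟩
    · rintro ⟨h0, h1, h2, h3⟩
      rw [h0, h1, h2, h3]
      simp
  rw [hi, fderiv_proj hp, Omega2_odeF_apply hU hA hB hC hu, theta3_odeF_apply hU hA hB hC hu,
    omega1_apply, omega2_apply, omega3_apply]
  constructor
  · intro h
    have h0 : v 0 = 0 := congrFun h 0
    have h1 : v 1 = 0 := congrFun h 1
    have h2 : v 5 / u 2 - u 5 / u 2 ^ 2 * v 2 = 0 := congrFun h 2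
    have h3 : v 3 / u 2 - u 3 / u 2 ^ 2 * v 2 + v 5 = 0 := congrFun h 3
    have h5 : v 5 = u 5 / u 2 * v 2 := by
      field_simp at h2 ⊢
      linarith
    have h4 : v 3 = u 3 / u 2 * v 2 - u 5 * v 2 := by
      rw [h5] at h3
      field_simp at h3 ⊢
      linarith
    refine ⟨h0, h1, ?_, ?_⟩ <;> rw [h0, h1] <;> simp only [h5, h4] <;> ring
  · rintro ⟨h0, h1, h2, h3⟩
    simp only [h0, h1, mul_zero, sub_zero, add_zero, sub_self] at h2 h3
    have h2' := (mul_eq_zero.1 h2).resolve_left (by positivity)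
    have h3' := (mul_eq_zero.1 h3).resolve_left (by positivity)
    have h5 : v 5 = u 5 / u 2 * v 2 := by linarith
    have h4 : v 3 = u 3 / u 2 * v 2 - u 5 * v 2 := by linarith
    ext i
    fin_cases i
    · exact h0
    · exact h1
    · simp [h5]
      field_simp
      ring
    · simp [h5, h4]
      field_simp
      ring

theorem Gtilde_odeF {u : Fin 6 → ℝ} (hu : u ∈ totalSpace U) (v w : Fin 6 → ℝ) :
    Gtilde (odeF A B C) u v w =
      bilin (metricG A B (proj u)) (fderiv ℝ proj u v) (fderiv ℝ proj u w) := by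
  have hp : u 2 ≠ 0 := hu.1.2
  have hα : u 4 ≠ 0 := hu.2
  have e0 : ∀ v, nullForms (odeF A B C) u 0 v = 2 * u 4 * v 1 := by
    intro v
    change 2 * (u 4 * omega1 u v) + theta4 (odeF A B C) u v = _
    rw [theta4_odeF_apply hU hA hB hC hu, omega1_apply]
    ring
  have e1 : ∀ v, nullForms (odeF A B C) u 1 v = Omega2 (odeF A B C) u v := fun _ => rfl
  have e2 : ∀ v, nullForms (odeF A B C) u 2 v
      = Omega2 (odeF A B C) u v + 2 * theta3 (odeF A B C) u v := fun _ => rfl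
  have e3 : ∀ v, nullForms (odeF A B C) u 3 v = theta4 (odeF A B C) u v := fun _ => rfl
  have hb : basePt (proj u) = basePt (jet u) := rfl
  simp only [Gtilde, e0, e1, e2, e3, theta4_odeF_apply hU hA hB hC hu,
    Omega2_odeF_apply hU hA hB hC hu, theta3_odeF_apply hU hA hB hC hu, omega1_apply,
    omega2_apply, omega3_apply, fderiv_proj hp, bilin, Fin.sum_univ_four, metricG, hb, odeF]
  simp [jet, proj]
  field_simp
  ring

theorem metricG_unique (H : (Fin 4 → ℝ) → Matrix (Fin 4) (Fin 4) ℝ)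
    (hH : ∀ u ∈ totalSpace U, ∀ v w, Gtilde (odeF A B C) u v w =
      bilin (H (proj u)) (fderiv ℝ proj u v) (fderiv ℝ proj u w))
    {m : Fin 4 → ℝ} (hm : m ∈ fourSpace U) : H m = metricG A B m := by
  obtain ⟨u, hu, rfl, -⟩ := (isConnected_fibre hm one_ne_zero one_ne_zero).nonempty
  have hb : ∀ (g : Matrix (Fin 4) (Fin 4) ℝ) i j, bilin g (Pi.single i 1) (Pi.single j 1) = g i j := by
    intro g i j
    simp [bilin, Pi.single_apply]
  ext i j
  obtain ⟨v, hv⟩ := surjective_fderiv_proj (u := u) hu.1.2 (Pi.single i 1)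
  obtain ⟨w, hw⟩ := surjective_fderiv_proj (u := u) hu.1.2 (Pi.single j 1)
  have := (hH u hu v w).symm.trans (Gtilde_odeF hU hA hB hC hu v w)
  rwa [hv, hw, hb, hb] at this

end Descent

/-! ### Signature, smoothness and generic points -/

section Topology

variable {U : Set (Fin 2 → ℝ)} {A B : (Fin 2 → ℝ) → ℝ}
  (hU : IsOpen U) (hA : ContDiffOn ℝ ∞ A U) (hB : ContDiffOn ℝ ∞ B U)

theorem isSplit_metricG (m : Fin 4 → ℝ) : IsSplit (metricG A B m) := by
  -- each of the two hyperbolic planes `(x, t)` and `(y, z)` is diagonalized separately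
  let κ := -(m 3 ^ 2 + 2 * B (basePt m))
  let β := 2 * A (basePt m) - m 2 ^ 2
  refine ⟨?_, !![1, 0, 1, 0; 0, 1, 0, 1; 0, (1 - β) / 2, 0, (-1 - β) / 2;
    (1 - κ) / 2, 0, (-1 - κ) / 2, 0], ?_, ?_⟩
  · ext i j
    fin_cases i <;> fin_cases j <;> simp [metricG]
  · rw [isUnit_iff_ne_zero]
    simp [Matrix.det_succ_row_zero, Fin.sum_univ_succ, Fin.succAbove]
    ring_nf
    norm_num
  · ext i j
    simp only [Matrix.mul_apply, Fin.sum_univ_four, Matrix.transpose_apply]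
    fin_cases i <;> fin_cases j <;> simp [metricG, κ, β] <;> ring

include hU hA hB

omit hU in
theorem contDiffOn_metricG (i j : Fin 4) :
    ContDiffOn ℝ ∞ (fun m => metricG A B m i j) (fourSpace U) := by
  have cA : ContDiffOn ℝ ∞ (fun m => A (basePt m)) (fourSpace U) :=
    hA.comp contDiff_basePt.contDiffOn fun _ h => h
  have cB : ContDiffOn ℝ ∞ (fun m => B (basePt m)) (fourSpace U) :=
    hB.comp contDiff_basePt.contDiffOn fun _ h => h
  have c : ∀ i : Fin 4, ContDiffOn ℝ ∞ (fun u : Fin 4 → ℝ => u i) (fourSpace U) :=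
    fun i => (contDiff_apply ℝ ℝ i).contDiffOn
  fin_cases i <;> fin_cases j <;> first
    | exact contDiffOn_const
    | exact (((c 3).pow 2).add (contDiffOn_const.mul cB)).neg
    | exact (contDiffOn_const.mul cA).sub ((c 2).pow 2)

theorem continuousOn_typeQ : ContinuousOn (typeQ A B) (fourSpace U) := by
  intro m hm
  have h : ∀ {k : (Fin 2 → ℝ) → ℝ}, ContDiffAt ℝ ∞ k (basePt m) →
      ContinuousAt (fun m => k (basePt m)) m := fun hk =>
    ContinuousAt.comp (f := basePt) hk.continuousAt contDiff_basePt.continuous.continuousAt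
  have aA := hA.contDiffAt (hU.mem_nhds hm)
  have aB := hB.contDiffAt (hU.mem_nhds hm)
  have c : ∀ i : Fin 4, ContinuousAt (fun m : Fin 4 → ℝ => m i) m :=
    fun i => continuousAt_apply i m
  exact ((((h (contDiffAt_pd (contDiffAt_pd aA 0) 0)).sub
    ((c 3).mul (h (contDiffAt_pd aA 0)))).sub (h (contDiffAt_pd (contDiffAt_pd aB 1) 1))).add
    ((c 2).mul (h (contDiffAt_pd aB 1)))).continuousWithinAt

theorem isOpen_typeQ_ne_zero : IsOpen {m | m ∈ fourSpace U ∧ typeQ A B m ≠ 0} :=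
  (continuousOn_typeQ hU hA hB).isOpen_inter_preimage (isOpen_fourSpace hU) isOpen_ne

omit hU hA hB in
/-- Along the line that moves `z` and `t` by `B_y s` and `-A_x s`, the function `Q` is affine in
`s` with slope `A_x² + B_y²`. -/
theorem mem_closure_typeQ_ne_zero {m : Fin 4 → ℝ} (hm : m ∈ fourSpace U)
    (h : pd 0 A (basePt m) ≠ 0 ∨ pd 1 B (basePt m) ≠ 0) :
    m ∈ closure {m' | m' ∈ fourSpace U ∧ typeQ A B m' ≠ 0} := by
  by_cases hQ : typeQ A B m = 0
  swap
  · exact subset_closure ⟨hm, hQ⟩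
  let γ : ℝ → Fin 4 → ℝ := fun s =>
    ![m 0, m 1, m 2 + s * pd 1 B (basePt m), m 3 - s * pd 0 A (basePt m)]
  have hγ : Continuous γ := by
    refine continuous_pi fun i => ?_
    fin_cases i <;> simp [γ] <;> fun_prop
  have hγ0 : γ 0 = m := by
    ext i
    fin_cases i <;> simp [γ]
  have hb : ∀ s, basePt (γ s) = basePt m := fun s => rfl
  have hpos : 0 < pd 0 A (basePt m) ^ 2 + pd 1 B (basePt m) ^ 2 := by
    rcases h with h | h <;> positivity
  have ht : Filter.Tendsto γ (nhdsWithin 0 {0}ᶜ) (nhds m) := by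
    have := hγ.tendsto 0
    rw [hγ0] at this
    exact this.mono_left nhdsWithin_le_nhds
  refine mem_closure_of_tendsto ht ?_
  filter_upwards [self_mem_nhdsWithin] with s hs
  refine ⟨hm, ?_⟩
  have : typeQ A B (γ s) = typeQ A B m
      + s * (pd 0 A (basePt m) ^ 2 + pd 1 B (basePt m) ^ 2) := by
    simp only [typeQ, hb]
    simp [γ]
    ring
  rw [this, hQ, zero_add]
  exact mul_ne_zero hs hpos.ne'

omit hA hB in
theorem forall_typeQ_eq_zero_iff : (∀ m ∈ fourSpace U, typeQ A B m = 0) ↔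
    ∀ w ∈ U, pd 0 A w = 0 ∧ pd 1 B w = 0 := by
  constructor
  · intro h w hw
    have hq : ∀ z t : ℝ, typeQ A B ![w 0, w 1, z, t] = pd 0 (pd 0 A) w - t * pd 0 A w
        - pd 1 (pd 1 B) w + z * pd 1 B w := by
      intro z t
      have : basePt ![w 0, w 1, z, t] = w := by
        ext i
        fin_cases i <;> rfl
      rw [typeQ, this]
      rfl
    have hm : ∀ z t : ℝ, ![w 0, w 1, z, t] ∈ fourSpace U := by
      intro z t
      have : basePt ![w 0, w 1, z, t] = w := by
        ext i
        fin_cases i <;> rfl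
      rwa [fourSpace, Set.mem_ofPred_eq, this]
    have h0 := h _ (hm 0 0)
    have h1 := h _ (hm 0 1)
    have h2 := h _ (hm 1 0)
    rw [hq] at h0 h1 h2
    constructor <;> linarith
  · intro h m hm
    have z : ∀ (k : (Fin 2 → ℝ) → ℝ) (i : Fin 2), (∀ w ∈ U, pd i k w = 0) →
        pd i (pd i k) (basePt m) = 0 := by
      intro k i hk
      have : pd i k =ᶠ[nhds (basePt m)] fun _ => 0 :=
        Filter.eventuallyEq_of_mem (hU.mem_nhds hm) hk
      rw [pd_congr this, (hasGrad_const 0).pd]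
    rw [typeQ, z A 0 fun w hw => (h w hw).1, z B 1 fun w hw => (h w hw).2, (h _ hm).1, (h _ hm).2]
    ring

end Topology

/-! ### Prolongation of fiber-preserving transformations -/

section TotalDerivative

variable {k l c : (Fin 4 → ℝ) → ℝ} {g g' : Fin 4 → ℝ} {j : Fin 4 → ℝ}

theorem totalDeriv_of_hasGrad (h : HasGrad k g j) (c : ℝ) :
    totalDeriv c k j = g 0 + j 2 * g 1 + j 3 * g 2 + c * g 3 := by
  simp only [totalDeriv, h.pd]

/-- The commutation rules `[∂ₚ, D] = ∂_y + F_p ∂_q` and `[∂_q, D] = ∂_p + F_q ∂_q`. -/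
theorem hasGrad_totalDeriv (hk : ContDiffAt ℝ ∞ k j) (hc : HasGrad c g j) :
    HasGrad (fun j' => totalDeriv (c j') k j') (fun i => totalDeriv (c j) (pd i k) j
      + ![0, 0, pd 1 k j, pd 2 k j] i + g i * pd 3 k j) j := by
  have d : ∀ i, HasGrad (pd i k) (fun a => pd a (pd i k) j) j :=
    fun i => hasGrad_pd_of_contDiffAt (contDiffAt_pd hk i)
  refine ((((d 0).add ((hasGrad_coord 2).mul (d 1))).add ((hasGrad_coord 3).mul (d 2))).add
    (hc.mul (d 3))).congr_grad fun i => ?_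
  simp only [totalDeriv]
  rw [pd_comm hk i 0, pd_comm hk i 1, pd_comm hk i 2, pd_comm hk i 3]
  fin_cases i <;> simp <;> ring

theorem contDiffAt_totalDeriv_zero (hk : ContDiffAt ℝ ∞ k j) :
    ContDiffAt ℝ ∞ (totalDeriv 0 k) j := by
  have d := fun i => contDiffAt_pd hk i
  have c : ∀ i : Fin 4, ContDiffAt ℝ ∞ (fun u : Fin 4 → ℝ => u i) j :=
    fun i => (contDiff_apply ℝ ℝ i).contDiffAt
  exact (((d 0).add ((c 2).mul (d 1))).add ((c 3).mul (d 2))).add (contDiffAt_const.mul (d 3))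

end TotalDerivative

theorem contDiffAt_deriv {f : ℝ → ℝ} {x : ℝ} (h : ContDiffAt ℝ ∞ f x) :
    ContDiffAt ℝ ∞ (deriv f) x := by
  have : deriv f = fun x => fderiv ℝ f x 1 := by
    ext x
    simp
  rw [this]
  exact (h.fderiv_right (m := ∞) le_rfl).clm_apply contDiffAt_const

/-- The reciprocal `1/f'`. -/
def recip (f : ℝ → ℝ) (x : ℝ) : ℝ := (deriv f x)⁻¹

/-- The logarithmic derivative `∂_x log |h_y|`. -/
def logX (h : (Fin 2 → ℝ) → ℝ) (w : Fin 2 → ℝ) : ℝ := pd 0 (pd 1 h) w / pd 1 h w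

/-- The logarithmic derivative `∂_y log |h_y|`. -/
def logY (h : (Fin 2 → ℝ) → ℝ) (w : Fin 2 → ℝ) : ℝ := pd 1 (pd 1 h) w / pd 1 h w

/-- The total derivative `λ = D log |h_y|`, a function of `(x, y, p)`. -/
def lam (h : (Fin 2 → ℝ) → ℝ) (j : Fin 4 → ℝ) : ℝ :=
  logX h (basePt j) + j 2 * logY h (basePt j)

/-- The second total derivative `Dλ = D² log |h_y|`. -/
def lamD (h : (Fin 2 → ℝ) → ℝ) (j : Fin 4 → ℝ) : ℝ :=
  pd 0 (logX h) (basePt j) + 2 * j 2 * pd 1 (logX h) (basePt j)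
    + j 2 ^ 2 * pd 1 (logY h) (basePt j) + j 3 * logY h (basePt j)

section Prolongation

variable {U : Set (Fin 2 → ℝ)} {f : ℝ → ℝ} {h : (Fin 2 → ℝ) → ℝ} {j : Fin 4 → ℝ}

theorem IsFiberPreserving.contDiffAt_fst (hφ : IsFiberPreserving U f h) (hU : IsOpen U)
    {w : Fin 2 → ℝ} (hw : w ∈ U) : ContDiffAt ℝ ∞ f (w 0) :=
  hφ.smooth_fst.contDiffAt ((isOpenMap_eval 0 U hU).mem_nhds ⟨w, hw, rfl⟩)

theorem IsFiberPreserving.contDiffAt_snd (hφ : IsFiberPreserving U f h) (hU : IsOpen U)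
    {w : Fin 2 → ℝ} (hw : w ∈ U) : ContDiffAt ℝ ∞ h w :=
  hφ.smooth_snd.contDiffAt (hU.mem_nhds hw)

variable (hU : IsOpen U) (hφ : IsFiberPreserving U f h)
include hU hφ

theorem contDiffAt_recip {w : Fin 2 → ℝ} (hw : w ∈ U) : ContDiffAt ℝ ∞ (recip f) (w 0) :=
  (contDiffAt_deriv (hφ.contDiffAt_fst hU hw)).inv (hφ.deriv_fst_ne w hw)

theorem contDiffAt_logX {w : Fin 2 → ℝ} (hw : w ∈ U) : ContDiffAt ℝ ∞ (logX h) w :=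
  (contDiffAt_pd (contDiffAt_pd (hφ.contDiffAt_snd hU hw) 1) 0).div
    (contDiffAt_pd (hφ.contDiffAt_snd hU hw) 1) (hφ.deriv_snd_ne w hw)

theorem contDiffAt_logY {w : Fin 2 → ℝ} (hw : w ∈ U) : ContDiffAt ℝ ∞ (logY h) w :=
  (contDiffAt_pd (contDiffAt_pd (hφ.contDiffAt_snd hU hw) 1) 1).div
    (contDiffAt_pd (hφ.contDiffAt_snd hU hw) 1) (hφ.deriv_snd_ne w hw)

/-- Symmetry of the second derivatives of `log |h_y|`. -/
theorem pd_logY {w : Fin 2 → ℝ} (hw : w ∈ U) : pd 0 (logY h) w = pd 1 (logX h) w := by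
  have c := contDiffAt_pd (hφ.contDiffAt_snd hU hw) 1
  have d0 := hasGrad_pd_of_contDiffAt (contDiffAt_pd c 0)
  have d1 := hasGrad_pd_of_contDiffAt (contDiffAt_pd c 1)
  have d := hasGrad_pd_of_contDiffAt c
  have e0 := (d0.div d (hφ.deriv_snd_ne w hw)).pd 1
  have e1 := (d1.div d (hφ.deriv_snd_ne w hw)).pd 0
  refine e1.trans (Eq.trans ?_ e0.symm)
  rw [pd_comm c 0 1]
  ring

variable (hj : basePt j ∈ U)
include hj

theorem contDiffAt_recip_jet : ContDiffAt ℝ ∞ (fun j : Fin 4 → ℝ => recip f (j 0)) j :=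
  ContDiffAt.comp (f := fun j : Fin 4 → ℝ => j 0) j (contDiffAt_recip hU hφ hj)
    (contDiff_apply ℝ ℝ (0 : Fin 4)).contDiffAt

theorem hasGrad_recip : HasGrad (fun j : Fin 4 → ℝ => recip f (j 0))
    ![deriv (recip f) (j 0), 0, 0, 0] j := by
  have hd : HasDerivAt (recip f) (deriv (recip f) (j 0)) (j 0) :=
    ((contDiffAt_recip hU hφ hj).differentiableAt (by simp)).hasDerivAt
  refine (HasGrad.scomp (k := fun j : Fin 4 → ℝ => j 0) hd (hasGrad_coord 0)).congr_grad
    fun i => ?_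
  fin_cases i <;> simp

theorem hasGrad_deriv_recip : HasGrad (fun j : Fin 4 → ℝ => deriv (recip f) (j 0))
    ![deriv (deriv (recip f)) (j 0), 0, 0, 0] j := by
  have hd : HasDerivAt (deriv (recip f)) (deriv (deriv (recip f)) (j 0)) (j 0) :=
    ((contDiffAt_deriv (contDiffAt_recip hU hφ hj)).differentiableAt (by simp)).hasDerivAt
  refine (HasGrad.scomp (k := fun j : Fin 4 → ℝ => j 0) hd (hasGrad_coord 0)).congr_grad
    fun i => ?_
  fin_cases i <;> simp

theorem hasGrad_stretch : HasGrad (fun j : Fin 4 → ℝ => pd 1 h (basePt j))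
    ![pd 1 h (basePt j) * logX h (basePt j), pd 1 h (basePt j) * logY h (basePt j), 0, 0] j := by
  have hη := hφ.deriv_snd_ne _ hj
  refine (hasGrad_pd_of_contDiffAt
    (contDiffAt_pd (hφ.contDiffAt_snd hU hj) 1)).comp_basePt.congr_grad fun i => ?_
  fin_cases i <;> simp [logX, logY] <;> field_simp

theorem hasGrad_logX : HasGrad (fun j : Fin 4 → ℝ => logX h (basePt j))
    ![pd 0 (logX h) (basePt j), pd 1 (logX h) (basePt j), 0, 0] j :=
  (hasGrad_pd_of_contDiffAt (contDiffAt_logX hU hφ hj)).comp_basePt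

theorem hasGrad_logY : HasGrad (fun j : Fin 4 → ℝ => logY h (basePt j))
    ![pd 1 (logX h) (basePt j), pd 1 (logY h) (basePt j), 0, 0] j := by
  rw [← pd_logY hU hφ hj]
  exact (hasGrad_pd_of_contDiffAt (contDiffAt_logY hU hφ hj)).comp_basePt

theorem hasGrad_lam : HasGrad (lam h) ![pd 0 (logX h) (basePt j) + j 2 * pd 1 (logX h) (basePt j),
    pd 1 (logX h) (basePt j) + j 2 * pd 1 (logY h) (basePt j), logY h (basePt j), 0] j := by
  refine ((hasGrad_logX hU hφ hj).add
    ((hasGrad_coord 2).mul (hasGrad_logY hU hφ hj))).congr_grad fun i => ?_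
  fin_cases i <;> simp

theorem pBar_eq : pBar f h j =
    recip f (j 0) * (pd 0 h (basePt j) + j 2 * pd 1 h (basePt j)) := by
  have d := (hasGrad_pd_of_contDiffAt (hφ.contDiffAt_snd hU hj)).comp_basePt
  rw [pBar, totalDeriv_of_hasGrad d, recip]
  simp only [Matrix.cons_val]
  ring

omit hφ hj in
theorem eventually_mem (hj : basePt j ∈ U) : ∀ᶠ j' in nhds j, basePt j' ∈ U :=
  eventually_basePt (hU.mem_nhds hj)

theorem hasGrad_pBar : HasGrad (pBar f h)
    ![deriv (recip f) (j 0) * (pd 0 h (basePt j) + j 2 * pd 1 h (basePt j))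
        + recip f (j 0) * (pd 0 (pd 0 h) (basePt j)
          + j 2 * (pd 1 h (basePt j) * logX h (basePt j))),
      recip f (j 0) * pd 1 h (basePt j) * lam h j,
      recip f (j 0) * pd 1 h (basePt j), 0] j := by
  have hη := hφ.deriv_snd_ne _ hj
  have c := hφ.contDiffAt_snd hU hj
  have e : pd 1 (pd 0 h) (basePt j) = pd 1 h (basePt j) * logX h (basePt j) := by
    rw [pd_comm c 1 0, logX]
    field_simp
  have d0 := (hasGrad_pd_of_contDiffAt (contDiffAt_pd c 0)).comp_basePt
  refine (((hasGrad_recip hU hφ hj).mul (d0.add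
    ((hasGrad_coord 2).mul (hasGrad_stretch hU hφ hj)))).congr_fun ?_).congr_grad fun i => ?_
  · filter_upwards [eventually_mem hU hj] with j' hj'
    exact pBar_eq hU hφ hj'
  · fin_cases i <;> simp [e, lam]
    ring

theorem contDiffAt_pBar : ContDiffAt ℝ ∞ (pBar f h) j := by
  have c : ContDiffAt ℝ ∞ (fun j' => h (basePt j')) j :=
    ContDiffAt.comp (f := basePt) j (hφ.contDiffAt_snd hU hj) contDiff_basePt.contDiffAt
  exact ((contDiffAt_totalDeriv_zero c).mul (contDiffAt_recip_jet hU hφ hj)).congr_of_eventuallyEq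
    (Filter.Eventually.of_forall fun j => div_eq_mul_inv _ _)

theorem contDiffAt_qBar : ContDiffAt ℝ ∞ (qBar f h) j :=
  ((contDiffAt_totalDeriv_zero (contDiffAt_pBar hU hφ hj)).mul
    (contDiffAt_recip_jet hU hφ hj)).congr_of_eventuallyEq
    (Filter.Eventually.of_forall fun _ => div_eq_mul_inv _ _)

theorem hasGrad_pd_pBar_y : HasGrad (pd 1 (pBar f h))
    ![deriv (recip f) (j 0) * pd 1 h (basePt j) * lam h j
        + recip f (j 0) * pd 1 h (basePt j) * logX h (basePt j) * lam h j
        + recip f (j 0) * pd 1 h (basePt j) *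
          (pd 0 (logX h) (basePt j) + j 2 * pd 1 (logX h) (basePt j)),
      recip f (j 0) * pd 1 h (basePt j) * logY h (basePt j) * lam h j
        + recip f (j 0) * pd 1 h (basePt j) *
          (pd 1 (logX h) (basePt j) + j 2 * pd 1 (logY h) (basePt j)),
      recip f (j 0) * pd 1 h (basePt j) * logY h (basePt j), 0] j := by
  refine ((((hasGrad_recip hU hφ hj).mul (hasGrad_stretch hU hφ hj)).mul
    (hasGrad_lam hU hφ hj)).congr_fun ?_).congr_grad fun i => ?_
  · filter_upwards [eventually_mem hU hj] with j' hj'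
    exact (hasGrad_pBar hU hφ hj').pd 1
  · fin_cases i <;> simp [-mul_eq_mul_right_iff, -mul_eq_mul_left_iff] <;> ring

theorem hasGrad_pd_pBar_p : HasGrad (pd 2 (pBar f h))
    ![deriv (recip f) (j 0) * pd 1 h (basePt j)
        + recip f (j 0) * pd 1 h (basePt j) * logX h (basePt j),
      recip f (j 0) * pd 1 h (basePt j) * logY h (basePt j), 0, 0] j := by
  refine (((hasGrad_recip hU hφ hj).mul (hasGrad_stretch hU hφ hj)).congr_fun ?_).congr_grad
    fun i => ?_
  · filter_upwards [eventually_mem hU hj] with j' hj'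
    exact (hasGrad_pBar hU hφ hj').pd 2
  · fin_cases i <;> simp [-mul_eq_mul_right_iff, -mul_eq_mul_left_iff] <;> ring

theorem hasGrad_pd_pBar_q : HasGrad (pd 3 (pBar f h)) 0 j := by
  refine (hasGrad_const 0).congr_fun ?_
  filter_upwards [eventually_mem hU hj] with j' hj'
  exact (hasGrad_pBar hU hφ hj').pd 3

theorem hasGrad_qBar : HasGrad (qBar f h)
    ![pd 0 (qBar f h) j, recip f (j 0) * (deriv (recip f) (j 0) * pd 1 h (basePt j) * lam h j
        + recip f (j 0) * pd 1 h (basePt j) * (lam h j ^ 2 + lamD h j)),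
      recip f (j 0) * pd 1 h (basePt j) * (deriv (recip f) (j 0) + 2 * recip f (j 0) * lam h j),
      recip f (j 0) ^ 2 * pd 1 h (basePt j)] j := by
  have d := (hasGrad_totalDeriv (contDiffAt_pBar hU hφ hj) (hasGrad_const 0)).mul
    (hasGrad_recip hU hφ hj)
  have d' : HasGrad (qBar f h) _ j := d.congr_fun
    (Filter.Eventually.of_forall fun _ => div_eq_mul_inv _ _)
  refine d'.congr_grad fun i => ?_
  fin_cases i
  · exact (d'.pd 0).symm
  · simp [totalDeriv_of_hasGrad (hasGrad_pd_pBar_y hU hφ hj), (hasGrad_pBar hU hφ hj).pd]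
    simp only [lam, lamD]
    ring
  · simp [totalDeriv_of_hasGrad (hasGrad_pd_pBar_p hU hφ hj), (hasGrad_pBar hU hφ hj).pd]
    simp only [lam]
    ring
  · simp [totalDeriv_of_hasGrad (hasGrad_pd_pBar_q hU hφ hj), (hasGrad_pBar hU hφ hj).pd]
    ring

theorem totalDeriv_pd_qBar_p (c : ℝ) : totalDeriv c (pd 2 (qBar f h)) j =
    pd 1 h (basePt j) * (deriv (recip f) (j 0) ^ 2 + recip f (j 0) * deriv (deriv (recip f)) (j 0)
      + 5 * recip f (j 0) * deriv (recip f) (j 0) * lam h j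
      + 2 * recip f (j 0) ^ 2 * (lam h j ^ 2 + lamD h j)) := by
  have s := hasGrad_recip hU hφ hj
  have d := (s.mul (hasGrad_stretch hU hφ hj)).mul ((hasGrad_deriv_recip hU hφ hj).add
    (((hasGrad_const 2).mul s).mul (hasGrad_lam hU hφ hj)))
  have d' : HasGrad (pd 2 (qBar f h)) _ j := d.congr_fun (by
    filter_upwards [eventually_mem hU hj] with j' hj'
    exact (hasGrad_qBar hU hφ hj').pd 2)
  rw [totalDeriv_of_hasGrad d']
  simp
  simp only [lam, lamD]
  ring

theorem totalDeriv_pd_qBar_q (c : ℝ) : totalDeriv c (pd 3 (qBar f h)) j =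
    pd 1 h (basePt j) * (2 * recip f (j 0) * deriv (recip f) (j 0)
      + recip f (j 0) ^ 2 * lam h j) := by
  have s := hasGrad_recip hU hφ hj
  have d := (s.pow 2).mul (hasGrad_stretch hU hφ hj)
  have d' : HasGrad (pd 3 (qBar f h)) _ j := d.congr_fun (by
    filter_upwards [eventually_mem hU hj] with j' hj'
    exact (hasGrad_qBar hU hφ hj').pd 3)
  rw [totalDeriv_of_hasGrad d']
  simp
  simp only [lam]
  ring

/-- The derivatives of `ȳ'''` along the equation with respect to `p` and `q`. -/
theorem hasGrad_thirdBar {F : (Fin 4 → ℝ) → ℝ} {g : Fin 4 → ℝ} (hF : HasGrad F g j) :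
    HasGrad (thirdBar f h F) ![pd 0 (thirdBar f h F) j, pd 1 (thirdBar f h F) j,
      recip f (j 0) * pd 1 h (basePt j) * (deriv (recip f) (j 0) ^ 2
        + recip f (j 0) * deriv (deriv (recip f)) (j 0)
        + 6 * recip f (j 0) * deriv (recip f) (j 0) * lam h j
        + 3 * recip f (j 0) ^ 2 * (lam h j ^ 2 + lamD h j) + recip f (j 0) ^ 2 * g 2),
      recip f (j 0) ^ 2 * pd 1 h (basePt j) * (recip f (j 0) * (g 3 + 3 * lam h j)
        + 3 * deriv (recip f) (j 0))] j := by
  have hx := hasGrad_qBar hU hφ hj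
  have d := (hasGrad_totalDeriv (contDiffAt_qBar hU hφ hj) hF).mul (hasGrad_recip hU hφ hj)
  have d' : HasGrad (thirdBar f h F) _ j := d.congr_fun
    (Filter.Eventually.of_forall fun _ => div_eq_mul_inv _ _)
  refine d'.congr_grad fun i => ?_
  fin_cases i
  · exact (d'.pd 0).symm
  · exact (d'.pd 1).symm
  · simp [totalDeriv_pd_qBar_p hU hφ hj, hx.pd 1, hx.pd 3]
    ring
  · simp [totalDeriv_pd_qBar_q hU hφ hj, hx.pd 2, hx.pd 3]
    ring

theorem hasGrad_prolong (a : Fin 4) : HasGrad (fun j => prolong f h j a)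
    (![![deriv f (j 0), 0, 0, 0], ![pd 0 h (basePt j), pd 1 h (basePt j), 0, 0],
      ![pd 0 (pBar f h) j, recip f (j 0) * pd 1 h (basePt j) * lam h j, recip f (j 0) * pd 1 h (basePt j), 0],
      ![pd 0 (qBar f h) j, recip f (j 0) * (deriv (recip f) (j 0) * pd 1 h (basePt j) * lam h j
          + recip f (j 0) * pd 1 h (basePt j) * (lam h j ^ 2 + lamD h j)),
        recip f (j 0) * pd 1 h (basePt j) * (deriv (recip f) (j 0) + 2 * recip f (j 0) * lam h j),
        recip f (j 0) ^ 2 * pd 1 h (basePt j)]] a) j := by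
  fin_cases a
  · have hd : HasDerivAt f (deriv f (j 0)) (j 0) :=
      ((hφ.contDiffAt_fst hU hj).differentiableAt (by simp)).hasDerivAt
    refine (HasGrad.scomp (k := fun j : Fin 4 → ℝ => j 0) hd (hasGrad_coord 0)).congr_grad
      fun i => ?_
    fin_cases i <;> simp
  · exact (hasGrad_pd_of_contDiffAt (hφ.contDiffAt_snd hU hj)).comp_basePt
  · refine (hasGrad_pBar hU hφ hj).congr_grad fun i => ?_
    fin_cases i
    · exact ((hasGrad_pBar hU hφ hj).pd 0).symm
    all_goals rfl
  · exact hasGrad_qBar hU hφ hj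

theorem contDiffAt_prolong : ContDiffAt ℝ ∞ (prolong f h) j := by
  refine contDiffAt_pi.2 fun a => ?_
  fin_cases a
  · exact ContDiffAt.comp (f := fun j : Fin 4 → ℝ => j 0) j (hφ.contDiffAt_fst hU hj)
      (contDiff_apply ℝ ℝ (0 : Fin 4)).contDiffAt
  · exact ContDiffAt.comp (f := basePt) j (hφ.contDiffAt_snd hU hj) contDiff_basePt.contDiffAt
  · exact contDiffAt_pBar hU hφ hj
  · exact contDiffAt_qBar hU hφ hj

end Prolongation

/-! ### Transformation of the derivatives of the equation -/

section Lift

variable {U : Set (Fin 2 → ℝ)} {f : ℝ → ℝ} {h : (Fin 2 → ℝ) → ℝ} {j : Fin 4 → ℝ}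

theorem recip_ne_zero (hφ : IsFiberPreserving U f h) (hj : basePt j ∈ U) : recip f (j 0) ≠ 0 :=
  inv_ne_zero (hφ.deriv_fst_ne _ hj)

theorem deriv_eq_inv_recip (f : ℝ → ℝ) (x : ℝ) : deriv f x = (recip f x)⁻¹ := (inv_inv _).symm

variable (hU : IsOpen U) (hφ : IsFiberPreserving U f h)
include hU hφ

/-- The partial derivatives of a function of the transformed jets, in terms of the gradient of its
pull-back. -/
theorem pd_of_pullback (hj : basePt j ∈ U) {k k' : (Fin 4 → ℝ) → ℝ} {g : Fin 4 → ℝ}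
    (hk' : DifferentiableAt ℝ k' (prolong f h j)) (hk : HasGrad k g j)
    (e : ∀ᶠ i in nhds j, k' (prolong f h i) = k i) :
    pd 3 k' (prolong f h j) = g 3 / (recip f (j 0) ^ 2 * pd 1 h (basePt j)) ∧
    pd 2 k' (prolong f h j) =
      (g 2 - g 3 / recip f (j 0) * (deriv (recip f) (j 0) + 2 * recip f (j 0) * lam h j))
        / (recip f (j 0) * pd 1 h (basePt j)) ∧
    pd 1 k' (prolong f h j) =
      (g 1 - (g 2 - g 3 / recip f (j 0) * (deriv (recip f) (j 0) + 2 * recip f (j 0) * lam h j))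
          * lam h j
        - g 3 / recip f (j 0) * (deriv (recip f) (j 0) * lam h j
          + recip f (j 0) * (lam h j ^ 2 + lamD h j))) / pd 1 h (basePt j) ∧
    ∀ F : (Fin 4 → ℝ) → ℝ, totalDeriv (thirdBar f h F j) k' (prolong f h j) =
      recip f (j 0) * (g 0 + j 2 * g 1 + j 3 * g 2 + F j * g 3) := by
  have hs := recip_ne_zero hφ hj
  have hη := hφ.deriv_snd_ne _ hj
  have c := (hasGrad_pd hk').comp fun a => hasGrad_prolong hU hφ hj a
  have c' := c.congr_fun (l := k) (by filter_upwards [e] with i hi using hi.symm)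
  have hg : ∀ i, g i = _ := fun i => (hk.pd i).symm.trans (c'.pd i)
  have g0 := hg 0
  have g1 := hg 1
  have g2 := hg 2
  have g3 := hg 3
  simp only [Fin.sum_univ_four, Matrix.cons_val, mul_zero, add_zero, zero_add] at g0 g1 g2 g3
  have e3 : pd 3 k' (prolong f h j) = g 3 / (recip f (j 0) ^ 2 * pd 1 h (basePt j)) := by
    rw [g3]
    field_simp
  have e2 : pd 2 k' (prolong f h j) =
      (g 2 - g 3 / recip f (j 0) * (deriv (recip f) (j 0) + 2 * recip f (j 0) * lam h j))
        / (recip f (j 0) * pd 1 h (basePt j)) := by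
    rw [g2, g3]
    field_simp
    ring
  refine ⟨e3, e2, ?_, fun F => ?_⟩
  · rw [g1, g2, g3]
    field_simp
    ring
  · have p0 : totalDeriv 0 (fun j' => h (basePt j')) j = pBar f h j * deriv f (j 0) :=
      (div_mul_cancel₀ _ (hφ.deriv_fst_ne _ hj)).symm
    have p1 : totalDeriv 0 (pBar f h) j = qBar f h j * deriv f (j 0) :=
      (div_mul_cancel₀ _ (hφ.deriv_fst_ne _ hj)).symm
    have p2 : totalDeriv (F j) (qBar f h) j = thirdBar f h F j * deriv f (j 0) :=
      (div_mul_cancel₀ _ (hφ.deriv_fst_ne _ hj)).symm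
    have b := hasGrad_pBar hU hφ hj
    have d := hasGrad_qBar hU hφ hj
    rw [totalDeriv_of_hasGrad
      (hasGrad_pd_of_contDiffAt (hφ.contDiffAt_snd hU hj)).comp_basePt] at p0
    rw [totalDeriv, b.pd 1, b.pd 2, b.pd 3] at p1
    rw [totalDeriv, d.pd 1, d.pd 2, d.pd 3] at p2
    simp only [Matrix.cons_val] at p0 p1 p2
    have hf := deriv_eq_inv_recip f (j 0)
    have hk : g 0 + j 2 * g 1 + j 3 * g 2 + F j * g 3 = deriv f (j 0) *
        totalDeriv (thirdBar f h F j) k' (prolong f h j) := by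
      have q2 : prolong f h j 2 = pBar f h j := rfl
      have q3 : prolong f h j 3 = qBar f h j := rfl
      rw [totalDeriv, q2, q3, g0, g1, g2, g3]
      linear_combination pd 1 k' (prolong f h j) * p0 + pd 2 k' (prolong f h j) * p1
        + pd 3 k' (prolong f h j) * p2
    rw [hk, hf]
    field_simp

theorem hasGrad_lamD (hj : basePt j ∈ U) : HasGrad (lamD h) ![pd 0 (lamD h) j, pd 1 (lamD h) j,
    2 * pd 1 (logX h) (basePt j) + 2 * j 2 * pd 1 (logY h) (basePt j), logY h (basePt j)] j := by
  have b : ∀ {k : (Fin 2 → ℝ) → ℝ}, ContDiffAt ℝ ∞ k (basePt j) → _ := fun hk =>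
    (hasGrad_pd_of_contDiffAt hk).comp_basePt
  have x0 := b (contDiffAt_pd (contDiffAt_logX hU hφ hj) 0)
  have x1 := b (contDiffAt_pd (contDiffAt_logX hU hφ hj) 1)
  have y1 := b (contDiffAt_pd (contDiffAt_logY hU hφ hj) 1)
  have p := hasGrad_coord (u := j) 2
  have d : HasGrad (lamD h) _ j := ((x0.add (((hasGrad_const 2).mul p).mul x1)).add
    ((p.pow 2).mul y1)).add ((hasGrad_coord 3).mul (hasGrad_logY hU hφ hj))
  refine d.congr_grad fun i => ?_
  fin_cases i
  · exact (d.pd 0).symm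
  · exact (d.pd 1).symm
  · simp
  · simp

end Lift

section TransformedEquation

variable {U : Set (Fin 2 → ℝ)} {A B C : (Fin 2 → ℝ) → ℝ} {f : ℝ → ℝ} {h : (Fin 2 → ℝ) → ℝ}
  {J' : Set (Fin 4 → ℝ)} {F' : (Fin 4 → ℝ) → ℝ} {j : Fin 4 → ℝ}
  (hU : IsOpen U) (hA : ContDiffOn ℝ ∞ A U) (hB : ContDiffOn ℝ ∞ B U) (hC : ContDiffOn ℝ ∞ C U)
  (hφ : IsFiberPreserving U f h) (hJ' : IsOpen J') (hF' : ContDiffOn ℝ ∞ F' J')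
  (hT : Transforms f h (jetSpace U) (odeF A B C) J' F')
include hU hφ hJ'

theorem eventually_mem_jetSpace (hj : j ∈ jetSpace U) (hj' : prolong f h j ∈ J') :
    ∀ᶠ i in nhds j, i ∈ jetSpace U ∧ prolong f h i ∈ J' :=
  Filter.Eventually.and ((isOpen_jetSpace hU).mem_nhds hj)
    ((contDiffAt_prolong hU hφ hj.1).continuousAt.eventually (hJ'.mem_nhds hj'))

include hA hB hC hF' hT

/-- `F̄_q̄ = (F_q + 3 λ) / f' + 3 (1/f')'`. -/
theorem pd_transformed_q (hj : j ∈ jetSpace U) (hj' : prolong f h j ∈ J') :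
    pd 3 F' (prolong f h j) =
      recip f (j 0) * (3 * (j 3 / j 2) + 3 * lam h j) + 3 * deriv (recip f) (j 0) := by
  have hs := recip_ne_zero hφ hj.1
  have hη := hφ.deriv_snd_ne _ hj.1
  have hF := hasGrad_odeF (hA.contDiffAt (hU.mem_nhds hj.1)) (hB.contDiffAt (hU.mem_nhds hj.1))
    (hC.contDiffAt (hU.mem_nhds hj.1)) hj.2
  have d := (pd_of_pullback hU hφ hj.1
    ((hF'.contDiffAt (hJ'.mem_nhds hj')).differentiableAt (by simp))
    (hasGrad_thirdBar hU hφ hj.1 hF) (by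
      filter_upwards [eventually_mem_jetSpace hU hφ hJ' hj hj'] with i hi
      exact hT i hi.1 hi.2)).1
  rw [d]
  simp only [Matrix.cons_val]
  field_simp

theorem pd_transformed_p (hj : j ∈ jetSpace U) (hj' : prolong f h j ∈ J') :
    pd 2 F' (prolong f h j) = recip f (j 0) ^ 2 * pd 2 (odeF A B C) j
      - recip f (j 0) * (3 * (j 3 / j 2))
        * (deriv (recip f) (j 0) + 2 * recip f (j 0) * lam h j)
      + recip f (j 0) * deriv (deriv (recip f)) (j 0) - 2 * deriv (recip f) (j 0) ^ 2
      - 3 * recip f (j 0) * deriv (recip f) (j 0) * lam h j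
      + 3 * recip f (j 0) ^ 2 * lamD h j - 3 * recip f (j 0) ^ 2 * lam h j ^ 2 := by
  have hs := recip_ne_zero hφ hj.1
  have hη := hφ.deriv_snd_ne _ hj.1
  have hp : j 2 ≠ 0 := hj.2
  have hF := hasGrad_odeF (hA.contDiffAt (hU.mem_nhds hj.1)) (hB.contDiffAt (hU.mem_nhds hj.1))
    (hC.contDiffAt (hU.mem_nhds hj.1)) hj.2
  have d := (pd_of_pullback hU hφ hj.1
    ((hF'.contDiffAt (hJ'.mem_nhds hj')).differentiableAt (by simp))
    (hasGrad_thirdBar hU hφ hj.1 hF) (by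
      filter_upwards [eventually_mem_jetSpace hU hφ hJ' hj hj'] with i hi
      exact hT i hi.1 hi.2)).2.1
  rw [d, hF.pd]
  simp only [Matrix.cons_val]
  field_simp
  ring

/-- The derivatives of `F̄_q̄` with respect to `q̄` and `ȳ` at a transformed jet, and its total
derivative along the transformed equation. -/
theorem pd_pd_transformed_q (hj : j ∈ jetSpace U) (hj' : prolong f h j ∈ J') :
    pd 3 (pd 3 F') (prolong f h j) = 3 / (j 2 * recip f (j 0) * pd 1 h (basePt j)) ∧
    pd 1 (pd 3 F') (prolong f h j) =
      (recip f (j 0) * (3 * (pd 1 (logX h) (basePt j) + j 2 * pd 1 (logY h) (basePt j)))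
        - (recip f (j 0) * (-3 * (j 3 / j 2 ^ 2) + 3 * logY h (basePt j))
          - 3 / j 2 * (deriv (recip f) (j 0) + 2 * recip f (j 0) * lam h j)) * lam h j
        - 3 / j 2 * (deriv (recip f) (j 0) * lam h j
          + recip f (j 0) * (lam h j ^ 2 + lamD h j))) / pd 1 h (basePt j) ∧
    totalDeriv (F' (prolong f h j)) (pd 3 F') (prolong f h j) =
      recip f (j 0) * (deriv (recip f) (j 0) * (3 * (j 3 / j 2) + 3 * lam h j)
        + recip f (j 0) * (-3 * (j 3 ^ 2 / j 2 ^ 2) + 3 * (odeF A B C j / j 2) + 3 * lamD h j)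
        + 3 * deriv (deriv (recip f)) (j 0)) := by
  have hs := recip_ne_zero hφ hj.1
  have hη := hφ.deriv_snd_ne _ hj.1
  have hp : j 2 ≠ 0 := hj.2
  have g := ((hasGrad_recip hU hφ hj.1).mul ((hasGrad_odeF_q hp).add
    ((hasGrad_const 3).mul (hasGrad_lam hU hφ hj.1)))).add
      ((hasGrad_const 3).mul (hasGrad_deriv_recip hU hφ hj.1))
  obtain ⟨d3, -, d1, d0⟩ := pd_of_pullback hU hφ hj.1
    ((contDiffAt_pd (hF'.contDiffAt (hJ'.mem_nhds hj')) 3).differentiableAt (by simp)) g (by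
      filter_upwards [eventually_mem_jetSpace hU hφ hJ' hj hj'] with i hi
      exact pd_transformed_q hU hA hB hC hφ hJ' hF' hT hi.1 hi.2)
  refine ⟨?_, ?_, ?_⟩
  · rw [d3]
    simp only [Matrix.cons_val]
    field_simp
    ring
  · rw [d1]
    simp only [Matrix.cons_val]
    field_simp
    ring
  · rw [hT j hj hj', d0]
    simp only [Matrix.cons_val, lam, lamD]
    field_simp
    ring

/-- The derivatives of `F̄_q̄q̄` at a transformed jet. -/
theorem pd_pd_transformed_qq (hj : j ∈ jetSpace U) (hj' : prolong f h j ∈ J') :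
    pd 3 (pd 3 (pd 3 F')) (prolong f h j) = 0 ∧
    pd 2 (pd 3 (pd 3 F')) (prolong f h j) =
      -3 / (j 2 * recip f (j 0) * pd 1 h (basePt j)) ^ 2 ∧
    pd 1 (pd 3 (pd 3 F')) (prolong f h j) =
      3 * logX h (basePt j) / (j 2 ^ 2 * recip f (j 0) * pd 1 h (basePt j) ^ 2) := by
  have hs := recip_ne_zero hφ hj.1
  have hη := hφ.deriv_snd_ne _ hj.1
  have hp : j 2 ≠ 0 := hj.2
  have g := (hasGrad_const 3).div (((hasGrad_coord 2).mul (hasGrad_recip hU hφ hj.1)).mul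
    (hasGrad_stretch hU hφ hj.1)) (mul_ne_zero (mul_ne_zero hp hs) hη)
  obtain ⟨d3, d2, d1, -⟩ := pd_of_pullback hU hφ hj.1 ((contDiffAt_pd (contDiffAt_pd
    (hF'.contDiffAt (hJ'.mem_nhds hj')) 3) 3).differentiableAt (by simp)) g (by
      filter_upwards [eventually_mem_jetSpace hU hφ hJ' hj hj'] with i hi
      exact (pd_pd_transformed_q hU hA hB hC hφ hJ' hF' hT hi.1 hi.2).1)
  refine ⟨?_, ?_, ?_⟩
  · rw [d3]
    simp
  · rw [d2]
    simp
    field_simp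
  · rw [d1]
    simp [lam]
    field_simp
    ring

/-- `K̄ = (K + λ F_q / 3 - Dλ + λ² / 2) / f'²`. -/
theorem Kfun_transformed (hj : j ∈ jetSpace U) (hj' : prolong f h j ∈ J') :
    Kfun F' (prolong f h j) = recip f (j 0) ^ 2 *
      (-(A (basePt j) * j 2 ^ 2) - 1 / 2 * (C (basePt j) * j 2) + lam h j * (j 3 / j 2)
        - lamD h j + 1 / 2 * lam h j ^ 2) := by
  have hp : j 2 ≠ 0 := hj.2
  have e : Kfun F' (prolong f h j) =
      1 / 6 * totalDeriv (F' (prolong f h j)) (pd 3 F') (prolong f h j)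
        - 1 / 9 * pd 3 F' (prolong f h j) ^ 2 - 1 / 2 * pd 2 F' (prolong f h j) := rfl
  have hF := hasGrad_odeF (hA.contDiffAt (hU.mem_nhds hj.1)) (hB.contDiffAt (hU.mem_nhds hj.1))
    (hC.contDiffAt (hU.mem_nhds hj.1)) hj.2
  rw [e, (pd_pd_transformed_q hU hA hB hC hφ hJ' hF' hT hj hj').2.2,
    pd_transformed_q hU hA hB hC hφ hJ' hF' hT hj hj',
    pd_transformed_p hU hA hB hC hφ hJ' hF' hT hj hj', hF.pd, odeF]
  simp only [Matrix.cons_val]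
  field_simp
  ring

omit hA hB hC hφ hT hU in
theorem contDiffAt_Kfun {j' : Fin 4 → ℝ} (hj' : j' ∈ J') : ContDiffAt ℝ ∞ (Kfun F') j' := by
  have c := hF'.contDiffAt (hJ'.mem_nhds hj')
  have cq := contDiffAt_pd c 3
  have d := fun i => contDiffAt_pd cq i
  have x : ∀ i : Fin 4, ContDiffAt ℝ ∞ (fun u : Fin 4 → ℝ => u i) j' :=
    fun i => (contDiff_apply ℝ ℝ i).contDiffAt
  exact ((contDiffAt_const.mul ((((d 0).add ((x 2).mul (d 1))).add ((x 3).mul (d 2))).add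
    (c.mul (d 3)))).sub (contDiffAt_const.mul (cq.pow 2))).sub
      (contDiffAt_const.mul (contDiffAt_pd c 2))

/-- The derivatives of `K̄` at a transformed jet. -/
theorem pd_Kfun_transformed (hj : j ∈ jetSpace U) (hj' : prolong f h j ∈ J') :
    pd 3 (Kfun F') (prolong f h j) = logX h (basePt j) / (j 2 * pd 1 h (basePt j)) ∧
    pd 2 (Kfun F') (prolong f h j) = (recip f (j 0) *
        (-2 * A (basePt j) * j 2 - 1 / 2 * C (basePt j) + logY h (basePt j) * (j 3 / j 2)
          - lam h j * (j 3 / j 2 ^ 2) - 2 * pd 1 (logX h) (basePt j)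
          - 2 * j 2 * pd 1 (logY h) (basePt j) + lam h j * logY h (basePt j))
      - logX h (basePt j) / j 2 * (deriv (recip f) (j 0) + 2 * recip f (j 0) * lam h j))
        / pd 1 h (basePt j) := by
  have hs := recip_ne_zero hφ hj.1
  have hη := hφ.deriv_snd_ne _ hj.1
  have hp : j 2 ≠ 0 := hj.2
  have cA := (hasGrad_pd_of_contDiffAt (hA.contDiffAt (hU.mem_nhds hj.1))).comp_basePt
  have cC := (hasGrad_pd_of_contDiffAt (hC.contDiffAt (hU.mem_nhds hj.1))).comp_basePt
  have p := hasGrad_coord (u := j) 2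
  have q := hasGrad_coord (u := j) 3
  have l := hasGrad_lam hU hφ hj.1
  have g := ((hasGrad_recip hU hφ hj.1).pow 2).mul (((((cA.mul (p.pow 2)).neg.sub
    ((hasGrad_const (1 / 2)).mul (cC.mul p))).add (l.mul (q.div p hp))).sub
    (hasGrad_lamD hU hφ hj.1)).add ((hasGrad_const (1 / 2)).mul (l.pow 2)))
  obtain ⟨d3, d2, -, -⟩ := pd_of_pullback hU hφ hj.1
    ((contDiffAt_Kfun hJ' hF' hj').differentiableAt (by simp)) g (by
      filter_upwards [eventually_mem_jetSpace hU hφ hJ' hj hj'] with i hi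
      exact Kfun_transformed hU hA hB hC hφ hJ' hF' hT hi.1 hi.2)
  refine ⟨?_, ?_⟩
  · rw [d3]
    simp [lam]
    field_simp
    ring
  · rw [d2]
    simp [lam]
    field_simp
    ring

end TransformedEquation

/-! ### The lift to the six-dimensional space -/

/-- The lift of a fiber-preserving transformation to `(x, y, p, q, α, γ)`: the second prolongation
together with `ᾱ = α / h_y` and `γ̄ = (γ - λ) / f'`. -/
def liftMap (f : ℝ → ℝ) (h : (Fin 2 → ℝ) → ℝ) (u : Fin 6 → ℝ) : Fin 6 → ℝ :=
  ![prolong f h (jet u) 0, prolong f h (jet u) 1, prolong f h (jet u) 2, prolong f h (jet u) 3,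
    u 4 / pd 1 h (basePt (jet u)), recip f (jet u 0) * (u 5 - lam h (jet u))]

theorem jet_liftMap (f : ℝ → ℝ) (h : (Fin 2 → ℝ) → ℝ) (u : Fin 6 → ℝ) :
    jet (liftMap f h u) = prolong f h (jet u) := by
  ext i
  fin_cases i <;> rfl

/-- The gradient of a function of `(x, y, p, q)`, regarded as a function of
`(x, y, p, q, α, γ)`. -/
theorem HasGrad.comp_jet {k : (Fin 4 → ℝ) → ℝ} {g : Fin 4 → ℝ} {u : Fin 6 → ℝ}
    (h : HasGrad k g (jet u)) :
    HasGrad (fun u' => k (jet u')) ![g 0, g 1, g 2, g 3, 0, 0] u := by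
  have e : ∀ c : Fin 4, HasGrad (fun u' : Fin 6 → ℝ => jet u' c)
      (![Pi.single 0 1, Pi.single 1 1, Pi.single 2 1, Pi.single 3 1] c) u := by
    intro c
    fin_cases c <;> exact hasGrad_coord _
  refine (h.comp e).congr_grad fun i => ?_
  fin_cases i <;> simp [Fin.sum_univ_four]

section Lift

variable {U : Set (Fin 2 → ℝ)} {A B C : (Fin 2 → ℝ) → ℝ} {f : ℝ → ℝ} {h : (Fin 2 → ℝ) → ℝ}
  {u : Fin 6 → ℝ} (hU : IsOpen U) (hφ : IsFiberPreserving U f h)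
include hU hφ

theorem contDiffAt_lam {j : Fin 4 → ℝ} (hj : basePt j ∈ U) : ContDiffAt ℝ ∞ (lam h) j :=
  (ContDiffAt.comp (f := basePt) j (contDiffAt_logX hU hφ hj) contDiff_basePt.contDiffAt).add
    ((contDiff_apply ℝ ℝ (2 : Fin 4)).contDiffAt.mul
      (ContDiffAt.comp (f := basePt) j (contDiffAt_logY hU hφ hj) contDiff_basePt.contDiffAt))

theorem contDiffAt_liftMap (hu : basePt (jet u) ∈ U) : ContDiffAt ℝ ∞ (liftMap f h) u := by
  have cj : ∀ {k : (Fin 4 → ℝ) → ℝ}, ContDiffAt ℝ ∞ k (jet u) →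
      ContDiffAt ℝ ∞ (fun u => k (jet u)) u := fun hk =>
    ContDiffAt.comp (f := jet) u hk contDiff_jet.contDiffAt
  have pr := contDiffAt_pi.1 (contDiffAt_prolong hU hφ hu)
  have x : ∀ i : Fin 6, ContDiffAt ℝ ∞ (fun u : Fin 6 → ℝ => u i) u :=
    fun i => (contDiff_apply ℝ ℝ i).contDiffAt
  have η : ContDiffAt ℝ ∞ (fun j => pd 1 h (basePt j)) (jet u) :=
    ContDiffAt.comp (f := basePt) _ (contDiffAt_pd (hφ.contDiffAt_snd hU hu) 1)
      contDiff_basePt.contDiffAt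
  refine contDiffAt_pi.2 fun i => ?_
  fin_cases i
  · exact cj (pr 0)
  · exact cj (pr 1)
  · exact cj (pr 2)
  · exact cj (pr 3)
  · exact (x 4).div (cj η) (hφ.deriv_snd_ne _ hu)
  · exact (cj (contDiffAt_recip_jet hU hφ hu)).mul ((x 5).sub (cj (contDiffAt_lam hU hφ hu)))

/-- The action of the lift on the forms `dx`, `ω¹`, `ω²`, `ω³`, `dα`, `dγ`. -/
theorem frame_liftMap (hu : basePt (jet u) ∈ U) (v : Fin 6 → ℝ) :
    fderiv ℝ (liftMap f h) u v 0 = (recip f (u 0))⁻¹ * v 0 ∧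
    omega1 (liftMap f h u) (fderiv ℝ (liftMap f h) u v) =
      pd 1 h (basePt (jet u)) * omega1 u v ∧
    omega2 (liftMap f h u) (fderiv ℝ (liftMap f h) u v) =
      recip f (u 0) * pd 1 h (basePt (jet u)) * (omega2 u v + lam h (jet u) * omega1 u v) ∧
    (∀ F F' : (Fin 4 → ℝ) → ℝ, F' (prolong f h (jet u)) = thirdBar f h F (jet u) →
      omega3 F' (liftMap f h u) (fderiv ℝ (liftMap f h) u v) =
      recip f (u 0) * pd 1 h (basePt (jet u)) * (recip f (u 0) * omega3 F u v
        + (deriv (recip f) (u 0) + 2 * recip f (u 0) * lam h (jet u)) * omega2 u v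
        + (deriv (recip f) (u 0) * lam h (jet u)
          + recip f (u 0) * (lam h (jet u) ^ 2 + lamD h (jet u))) * omega1 u v)) ∧
    fderiv ℝ (liftMap f h) u v 4 = (v 4 - u 4 * (logX h (basePt (jet u)) * v 0
      + logY h (basePt (jet u)) * v 1)) / pd 1 h (basePt (jet u)) ∧
    fderiv ℝ (liftMap f h) u v 5 = deriv (recip f) (u 0) * (u 5 - lam h (jet u)) * v 0
      + recip f (u 0) * (v 5 - lamD h (jet u) * v 0
        - (pd 1 (logX h) (basePt (jet u)) + u 2 * pd 1 (logY h) (basePt (jet u))) * omega1 u v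
        - logY h (basePt (jet u)) * omega2 u v) := by
  have hs := recip_ne_zero hφ hu
  have hη := hφ.deriv_snd_ne _ hu
  have cd : ∀ {i : Fin 6} {g : Fin 6 → ℝ}, HasGrad (fun u => liftMap f h u i) g u →
      fderiv ℝ (liftMap f h) u v i = ∑ a, g a * v a := by
    intro i g hg
    have hd := ((contDiffAt_liftMap hU hφ hu).differentiableAt (by simp)).hasFDerivAt
    rw [← hg.fderiv_apply, (hasFDerivAt_pi'.1 hd i).fderiv]
    rfl
  have pr := fun a => (hasGrad_prolong hU hφ hu a).comp_jet
  have X0 := cd (i := 0) (pr 0)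
  have X1 := cd (i := 1) (pr 1)
  have X2 := cd (i := 2) (pr 2)
  have X3 := cd (i := 3) (pr 3)
  have X4 := cd (i := 4) ((hasGrad_coord 4).div (hasGrad_stretch hU hφ hu).comp_jet hη)
  have X5 := cd (i := 5) ((hasGrad_recip hU hφ hu).comp_jet.mul
    ((hasGrad_coord 5).sub (hasGrad_lam hU hφ hu).comp_jet))
  have j0 : jet u 0 = u 0 := rfl
  have j1 : jet u 1 = u 1 := rfl
  have j2 : jet u 2 = u 2 := rfl
  have j3 : jet u 3 = u 3 := rfl
  have hf := deriv_eq_inv_recip f (u 0)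
  rw [j0] at hs
  have p0 : totalDeriv 0 (fun j' => h (basePt j')) (jet u)
      = pBar f h (jet u) * deriv f (jet u 0) :=
    (div_mul_cancel₀ _ (hφ.deriv_fst_ne _ hu)).symm
  have p1 : totalDeriv 0 (pBar f h) (jet u) = qBar f h (jet u) * deriv f (jet u 0) :=
    (div_mul_cancel₀ _ (hφ.deriv_fst_ne _ hu)).symm
  have b := hasGrad_pBar hU hφ hu
  have d := hasGrad_qBar hU hφ hu
  rw [totalDeriv_of_hasGrad
    (hasGrad_pd_of_contDiffAt (hφ.contDiffAt_snd hU hu)).comp_basePt] at p0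
  rw [totalDeriv, b.pd 1, b.pd 2, b.pd 3] at p1
  simp only [Matrix.cons_val, j0, j2, j3, hf] at p0 p1
  simp [Fin.sum_univ_six, j0, j2, hf] at X0 X1 X2 X3 X4 X5
  have l2 : liftMap f h u 2 = pBar f h (jet u) := rfl
  have l3 : liftMap f h u 3 = qBar f h (jet u) := rfl
  refine ⟨X0, ?_, ?_, ?_, ?_, ?_⟩
  · rw [omega1_apply, omega1_apply, X0, X1, l2]
    linear_combination v 0 * p0
  · rw [omega2_apply, omega1_apply, omega2_apply, X0, X2, l3]
    linear_combination v 0 * p1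
  · intro F F' hF
    have p2 : totalDeriv (F (jet u)) (qBar f h) (jet u)
        = thirdBar f h F (jet u) * deriv f (jet u 0) :=
      (div_mul_cancel₀ _ (hφ.deriv_fst_ne _ hu)).symm
    rw [totalDeriv, d.pd 1, d.pd 2, d.pd 3] at p2
    simp only [Matrix.cons_val, j0, j2, j3, hf] at p2
    rw [omega3_apply, omega1_apply, omega2_apply, omega3_apply, jet_liftMap, X0, X3, hF]
    linear_combination v 0 * p2
  · rw [X4]
    field_simp
    ring
  · rw [X5, omega1_apply, omega2_apply]
    simp only [lamD, j2, j3]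
    ring

theorem prolong_injective {j j' : Fin 4 → ℝ} (hj : basePt j ∈ U)
    (hj' : basePt j' ∈ U) (e : prolong f h j = prolong f h j') : j = j' := by
  have hb : basePt j = basePt j' := by
    refine hφ.injOn hj hj' (funext fun i => ?_)
    fin_cases i
    · exact congrFun e 0
    · exact congrFun e 1
  have h0 : j 0 = j' 0 := congrFun hb 0
  have h1 : j 1 = j' 1 := congrFun hb 1
  have hs := recip_ne_zero hφ hj
  have hη := hφ.deriv_snd_ne _ hj
  have e2 : pBar f h j = pBar f h j' := congrFun e 2
  rw [pBar_eq hU hφ hj, pBar_eq hU hφ hj', ← hb, ← h0] at e2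
  have h2 : j 2 = j' 2 := mul_right_cancel₀ hη (by linarith [mul_left_cancel₀ hs e2])
  have e3 : qBar f h j = qBar f h j' := congrFun e 3
  have l : lam h j = lam h j' := by rw [lam, lam, hb, h2]
  have hf : deriv f (j 0) ≠ 0 := hφ.deriv_fst_ne _ hj
  rw [qBar, qBar, ← h0, div_left_inj' hf,
    totalDeriv_of_hasGrad (hasGrad_pBar hU hφ hj), totalDeriv_of_hasGrad (hasGrad_pBar hU hφ hj'),
    ← hb, ← h0, ← h2, ← l] at e3
  simp only [Matrix.cons_val] at e3
  have h3 : j 3 = j' 3 := mul_right_cancel₀ (mul_ne_zero hs hη) (by linarith)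
  ext i
  fin_cases i <;> assumption

theorem bijOn_liftMap (J' : Set (Fin 4 → ℝ)) :
    Set.BijOn (liftMap f h) {u | u ∈ totalSpace U ∧ prolong f h (jet u) ∈ J'}
      {u' | jet u' ∈ J' ∧ jet u' ∈ prolong f h '' jetSpace U ∧ u' 4 ≠ 0} := by
  refine ⟨?_, ?_, ?_⟩
  · rintro u ⟨hu, hu'⟩
    refine ⟨by rwa [jet_liftMap], ⟨jet u, hu.1, (jet_liftMap f h u).symm⟩, ?_⟩
    exact div_ne_zero hu.2 (hφ.deriv_snd_ne _ hu.1.1)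
  · rintro u ⟨hu, -⟩ u' ⟨hu', -⟩ e
    have ej := congrArg jet e
    rw [jet_liftMap, jet_liftMap] at ej
    have hjet := prolong_injective hU hφ hu.1.1 hu'.1.1 ej
    have e4 : u 4 / pd 1 h (basePt (jet u)) = u' 4 / pd 1 h (basePt (jet u')) := congrFun e 4
    have e5 : recip f (jet u 0) * (u 5 - lam h (jet u))
        = recip f (jet u' 0) * (u' 5 - lam h (jet u')) := congrFun e 5
    rw [← hjet, div_left_inj' (hφ.deriv_snd_ne _ hu.1.1)] at e4
    rw [← hjet] at e5
    have e5' := mul_left_cancel₀ (recip_ne_zero hφ hu.1.1) e5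
    ext i
    fin_cases i
    · exact congrFun hjet 0
    · exact congrFun hjet 1
    · exact congrFun hjet 2
    · exact congrFun hjet 3
    · exact e4
    · simpa using e5'
  · rintro u' ⟨h1, ⟨j, hj, e⟩, h4⟩
    have hη := hφ.deriv_snd_ne _ hj.1
    have hs := recip_ne_zero hφ hj.1
    obtain ⟨u, hju, hu4, hu5⟩ : ∃ u : Fin 6 → ℝ, jet u = j ∧ u 4 = u' 4 * pd 1 h (basePt j) ∧
        u 5 = u' 5 / recip f (j 0) + lam h j := by
      refine ⟨![j 0, j 1, j 2, j 3, u' 4 * pd 1 h (basePt j), u' 5 / recip f (j 0) + lam h j],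
        ?_, rfl, rfl⟩
      ext i
      fin_cases i <;> rfl
    refine ⟨u, ⟨⟨by rwa [hju], by rw [hu4]; exact mul_ne_zero h4 hη⟩, by rwa [hju, e]⟩, ?_⟩
    have ej : prolong f h (jet u) = jet u' := by rw [hju, e]
    ext i
    fin_cases i
    · exact congrFun ej 0
    · exact congrFun ej 1
    · exact congrFun ej 2
    · exact congrFun ej 3
    · change u 4 / pd 1 h (basePt (jet u)) = u' 4
      rw [hju, hu4]
      field_simp
    · change recip f (jet u 0) * (u 5 - lam h (jet u)) = u' 5
      rw [hju, hu5]
      field_simp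
      ring

end Lift

section Coframe

variable {U : Set (Fin 2 → ℝ)} {A B C : (Fin 2 → ℝ) → ℝ} {f : ℝ → ℝ} {h : (Fin 2 → ℝ) → ℝ}
  {J' : Set (Fin 4 → ℝ)} {F' : (Fin 4 → ℝ) → ℝ} {u : Fin 6 → ℝ}
  (hU : IsOpen U) (hA : ContDiffOn ℝ ∞ A U) (hB : ContDiffOn ℝ ∞ B U) (hC : ContDiffOn ℝ ∞ C U)
  (hφ : IsFiberPreserving U f h) (hJ' : IsOpen J') (hF' : ContDiffOn ℝ ∞ F' J')
  (hT : Transforms f h (jetSpace U) (odeF A B C) J' F')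
include hU hA hB hC hφ hJ' hF' hT

/-- Invariance of the coframe under fiber-preserving transformations. -/
theorem cartanCoframe_liftMap (hu : u ∈ totalSpace U) (hu' : prolong f h (jet u) ∈ J')
    (i : Fin 6) : (cartanCoframe F' (liftMap f h u) i).comp (fderiv ℝ (liftMap f h) u) =
      cartanCoframe (odeF A B C) u i := by
  have hp : u 2 ≠ 0 := hu.1.2
  have hα : u 4 ≠ 0 := hu.2
  have hs : recip f (u 0) ≠ 0 := recip_ne_zero hφ hu.1.1
  have hη := hφ.deriv_snd_ne _ hu.1.1
  have j0 : jet u 0 = u 0 := rfl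
  have j2 : jet u 2 = u 2 := rfl
  have j3 : jet u 3 = u 3 := rfl
  have l4 : liftMap f h u 4 = u 4 / pd 1 h (basePt (jet u)) := rfl
  have l5 : liftMap f h u 5 = recip f (u 0) * (u 5 - lam h (jet u)) := rfl
  have dq := pd_transformed_q hU hA hB hC hφ hJ' hF' hT hu.1 hu'
  obtain ⟨dqq, dqy, -⟩ := pd_pd_transformed_q hU hA hB hC hφ hJ' hF' hT hu.1 hu'
  obtain ⟨dqqq, dqqp, dqqy⟩ := pd_pd_transformed_qq hU hA hB hC hφ hJ' hF' hT hu.1 hu'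
  have dK := Kfun_transformed hU hA hB hC hφ hJ' hF' hT hu.1 hu'
  obtain ⟨dKq, dKp⟩ := pd_Kfun_transformed hU hA hB hC hφ hJ' hF' hT hu.1 hu'
  rw [j0, j2] at dqq dqqp dqqy
  rw [j0, j2, j3] at dq dqy dK dKp
  rw [j2] at dKq
  ext v
  obtain ⟨X0, W1, W2, W3, X4, X5⟩ := frame_liftMap hU hφ hu.1.1 v
  specialize W3 (odeF A B C) F' (hT _ hu.1 hu')
  have hl : lam h (jet u) = logX h (basePt (jet u)) + u 2 * logY h (basePt (jet u)) := rfl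
  rw [ContinuousLinearMap.comp_apply]
  generalize fderiv ℝ (liftMap f h) u v = X at *
  fin_cases i
  · change liftMap f h u 4 * omega1 (liftMap f h u) X = u 4 * omega1 u v
    rw [W1, l4]
    field_simp
  · change theta2 F' (liftMap f h u) X = theta2 (odeF A B C) u v
    rw [theta2_odeF_apply hU hA hB hC hu, theta2]
    simp only [smul_apply, add_apply, smul_eq_mul,
      jet_liftMap, W1, W2, l5, dqq]
    field_simp
    ring
  · change theta3 F' (liftMap f h u) X = theta3 (odeF A B C) u v
    rw [theta3_odeF_apply hU hA hB hC hu, theta3]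
    simp only [smul_apply, add_apply, smul_eq_mul,
      jet_liftMap, W1, W2, W3, l4, l5, dqq, dq, dK]
    field_simp
    ring
  · change theta4 F' (liftMap f h u) X = theta4 (odeF A B C) u v
    rw [theta4_odeF_apply hU hA hB hC hu, theta4]
    simp only [smul_apply, smul_eq_mul, omega4, dcoord_apply,
      jet_liftMap, X0, l4, dqq]
    field_simp
    ring
  · change Omega1 F' (liftMap f h u) X = Omega1 (odeF A B C) u v
    rw [Omega1_odeF_apply hU hA hB hC hu, Omega1]
    simp only [smul_apply, add_apply,
      sub_apply, smul_eq_mul, omega4, dcoord_apply,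
      jet_liftMap, X0, X4, W1, l4, l5, dqq, dqqq, dqqp, dqqy, dKq, hl]
    rw [omega1_apply]
    field_simp
    ring
  · change Omega2 F' (liftMap f h u) X = Omega2 (odeF A B C) u v
    rw [Omega2_odeF_apply hU hA hB hC hu, Omega2]
    simp only [smul_apply, add_apply, smul_eq_mul, omega4,
      dcoord_apply, jet_liftMap, X0, X5, W1, W2, l4, l5, dqq, dqqq, dqqp, dqqy, dKq, dKp, dq, dqy,
      dK, hl]
    rw [omega1_apply, omega2_apply]
    field_simp
    ring

theorem Gtilde_liftMap (hu : u ∈ totalSpace U) (hu' : prolong f h (jet u) ∈ J')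
    (v w : Fin 6 → ℝ) : Gtilde F' (liftMap f h u) (fderiv ℝ (liftMap f h) u v)
      (fderiv ℝ (liftMap f h) u w) = Gtilde (odeF A B C) u v w := by
  have c := fun i v => DFunLike.congr_fun
    (cartanCoframe_liftMap hU hA hB hC hφ hJ' hF' hT hu hu' i) v
  have t1 : ∀ v, theta1 (liftMap f h u) (fderiv ℝ (liftMap f h) u v) = theta1 u v := c 0
  have t3 : ∀ v, theta3 F' (liftMap f h u) (fderiv ℝ (liftMap f h) u v)
      = theta3 (odeF A B C) u v := c 2
  have t4 : ∀ v, theta4 F' (liftMap f h u) (fderiv ℝ (liftMap f h) u v)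
      = theta4 (odeF A B C) u v := c 3
  have o2 : ∀ v, Omega2 F' (liftMap f h u) (fderiv ℝ (liftMap f h) u v)
      = Omega2 (odeF A B C) u v := c 5
  simp only [Gtilde, nullForms, Matrix.cons_val, add_apply,
    smul_apply, t1, t3, t4, o2]

end Coframe

/-! ### The isometry of the four-spaces -/

section Isometry

variable {U : Set (Fin 2 → ℝ)} {f : ℝ → ℝ} {h : (Fin 2 → ℝ) → ℝ}

/-- By the inverse function theorem the image of a fiber-preserving transformation is open. -/
theorem isOpen_image_fpMap (hU : IsOpen U) (hφ : IsFiberPreserving U f h) :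
    IsOpen (fpMap f h '' U) := by
  rw [isOpen_iff_mem_nhds]
  rintro _ ⟨w, hw, rfl⟩
  have hc : ContDiffAt ℝ ∞ (fpMap f h) w := by
    refine contDiffAt_pi.2 fun i => ?_
    fin_cases i
    · exact ContDiffAt.comp (f := fun w : Fin 2 → ℝ => w 0) w (hφ.contDiffAt_fst hU hw)
        (contDiff_apply ℝ ℝ (0 : Fin 2)).contDiffAt
    · exact hφ.contDiffAt_snd hU hw
  have hg : ∀ a, HasGrad (fun w => fpMap f h w a)
      (![![deriv f (w 0), 0], fun i => pd i h w] a) w := by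
    intro a
    fin_cases a
    · have hd : HasDerivAt f (deriv f (w 0)) (w 0) :=
        ((hφ.contDiffAt_fst hU hw).differentiableAt (by simp)).hasDerivAt
      refine (HasGrad.scomp (k := fun w : Fin 2 → ℝ => w 0) hd (hasGrad_coord 0)).congr_grad
        fun i => ?_
      fin_cases i <;> simp
    · exact hasGrad_pd_of_contDiffAt (hφ.contDiffAt_snd hU hw)
  have hs : HasStrictFDerivAt (fpMap f h) (fderiv ℝ (fpMap f h) w) w :=
    hc.hasStrictFDerivAt (by simp)
  have hsurj : (fderiv ℝ (fpMap f h) w).range = ⊤ := by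
    refine LinearMap.range_eq_top.2 fun y => ?_
    have h1 := hφ.deriv_fst_ne w hw
    have h2 := hφ.deriv_snd_ne w hw
    refine ⟨![y 0 / deriv f (w 0), (y 1 - pd 0 h w * (y 0 / deriv f (w 0))) / pd 1 h w], ?_⟩
    ext i
    rw [ContinuousLinearMap.coe_coe, fderiv_apply_of_hasGrad hg]
    fin_cases i <;> simp <;> field_simp
    ring
  rw [← hs.map_nhds_eq_of_surj hsurj]
  exact Filter.image_mem_map (hU.mem_nhds hw)

/-- A transformation between two equations of the form considered satisfies `h_x = 0`: otherwise
`F̄_q̄q̄ = 3 / p̄` and `F_qq = 3 / p` could not correspond. -/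
theorem pd_snd_x_eq_zero {A B C A' B' C' : (Fin 2 → ℝ) → ℝ} (hU : IsOpen U)
    (hA : ContDiffOn ℝ ∞ A U) (hB : ContDiffOn ℝ ∞ B U) (hC : ContDiffOn ℝ ∞ C U)
    (hφ : IsFiberPreserving U f h)
    (hA' : ContDiffOn ℝ ∞ A' (fpMap f h '' U)) (hB' : ContDiffOn ℝ ∞ B' (fpMap f h '' U))
    (hC' : ContDiffOn ℝ ∞ C' (fpMap f h '' U))
    (hF' : ContDiffOn ℝ ∞ (odeF A' B' C') (jetSpace (fpMap f h '' U)))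
    (hT : Transforms f h (jetSpace U) (odeF A B C) (jetSpace (fpMap f h '' U)) (odeF A' B' C'))
    {w : Fin 2 → ℝ} (hw : w ∈ U) : pd 0 h w = 0 := by
  have hV := isOpen_image_fpMap hU hφ
  have hη := hφ.deriv_snd_ne w hw
  -- a jet over `w` with `p ≠ 0` and `p̄ ≠ 0`
  obtain ⟨p, hp, hp'⟩ : ∃ p : ℝ, p ≠ 0 ∧ pd 0 h w + p * pd 1 h w ≠ 0 := by
    by_cases h1 : pd 0 h w + 1 * pd 1 h w = 0
    · refine ⟨2, two_ne_zero, fun h2 => hη ?_⟩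
      linarith
    · exact ⟨1, one_ne_zero, h1⟩
  obtain ⟨j, hb, h2⟩ : ∃ j : Fin 4 → ℝ, basePt j = w ∧ j 2 = p := by
    refine ⟨![w 0, w 1, p, 0], ?_, rfl⟩
    ext i
    fin_cases i <;> rfl
  subst hb
  subst h2
  have hs := recip_ne_zero hφ hw
  have hpb : prolong f h j 2 = recip f (j 0) * (pd 0 h (basePt j) + j 2 * pd 1 h (basePt j)) :=
    pBar_eq hU hφ hw
  have hj' : prolong f h j ∈ jetSpace (fpMap f h '' U) := by
    refine ⟨⟨basePt j, hw, rfl⟩, ?_⟩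
    rw [hpb]
    exact mul_ne_zero hs hp'
  have e1 := (hasGrad_pd_odeF_q hV hA' hB' hC' _ hj').pd 3
  have e2 := (pd_pd_transformed_q hU hA hB hC hφ (isOpen_jetSpace hV) hF' hT ⟨hw, hp⟩ hj').1
  rw [e2, hpb] at e1
  simp only [Matrix.cons_val] at e1
  field_simp at e1
  linarith

theorem contDiffOn_odeF {A B C : (Fin 2 → ℝ) → ℝ} (hA : ContDiffOn ℝ ∞ A U)
    (hB : ContDiffOn ℝ ∞ B U) (hC : ContDiffOn ℝ ∞ C U) :
    ContDiffOn ℝ ∞ (odeF A B C) (jetSpace U) := by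
  have b : ∀ {k : (Fin 2 → ℝ) → ℝ}, ContDiffOn ℝ ∞ k U →
      ContDiffOn ℝ ∞ (fun j => k (basePt j)) (jetSpace U) := fun hk =>
    hk.comp contDiff_basePt.contDiffOn fun _ h => h.1
  have c : ∀ i : Fin 4, ContDiffOn ℝ ∞ (fun u : Fin 4 → ℝ => u i) (jetSpace U) :=
    fun i => (contDiff_apply ℝ ℝ i).contDiffOn
  exact (((contDiffOn_const.mul (((c 3).pow 2).div (c 2) fun j hj => hj.2)).add
    ((b hA).mul ((c 2).pow 3))).add ((b hC).mul ((c 2).pow 2))).add ((b hB).mul (c 2))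

section Coefficients

variable {A B C A' B' C' : (Fin 2 → ℝ) → ℝ} (hU : IsOpen U)
  (hA : ContDiffOn ℝ ∞ A U) (hB : ContDiffOn ℝ ∞ B U) (hC : ContDiffOn ℝ ∞ C U)
  (hφ : IsFiberPreserving U f h)
  (hA' : ContDiffOn ℝ ∞ A' (fpMap f h '' U)) (hB' : ContDiffOn ℝ ∞ B' (fpMap f h '' U))
  (hC' : ContDiffOn ℝ ∞ C' (fpMap f h '' U))
  (hx : ∀ w ∈ U, pd 0 h w = 0)
include hU hφ hx

theorem logX_eq_zero {w : Fin 2 → ℝ} (hw : w ∈ U) : logX h w = 0 := by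
  rw [logX, pd_comm (hφ.contDiffAt_snd hU hw) 0 1,
    pd_congr (Filter.eventuallyEq_of_mem (hU.mem_nhds hw) hx), (hasGrad_const 0).pd, zero_div]

theorem pd_logX_eq_zero {w : Fin 2 → ℝ} (hw : w ∈ U) (i : Fin 2) : pd i (logX h) w = 0 := by
  rw [pd_congr (Filter.eventuallyEq_of_mem (hU.mem_nhds hw)
    fun w hw => logX_eq_zero hU hφ hx hw), (hasGrad_const 0).pd]

include hA hB hC hA' hB' hC'

/-- The transformation law of the coefficients `A` and `B`, obtained by comparing the powers of `p`
in `K̄` and `F̄_p̄`. -/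
theorem coefficients_transform
    (hT : Transforms f h (jetSpace U) (odeF A B C) (jetSpace (fpMap f h '' U)) (odeF A' B' C'))
    {w : Fin 2 → ℝ} (hw : w ∈ U) :
    A' (fpMap f h w) * pd 1 h w ^ 2 = A w + pd 1 (logY h) w - 1 / 2 * logY h w ^ 2 ∧
    B' (fpMap f h w) = recip f (w 0) ^ 2 * B w
      + recip f (w 0) * deriv (deriv (recip f)) (w 0) - 1 / 2 * deriv (recip f) (w 0) ^ 2 := by
  have hV := isOpen_image_fpMap hU hφ
  have hη := hφ.deriv_snd_ne w hw
  have hs : recip f (w 0) ≠ 0 := inv_ne_zero (hφ.deriv_fst_ne w hw)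
  have hF' := contDiffOn_odeF hA' hB' hC'
  have key : ∀ p : ℝ, p ≠ 0 →
      (-(A' (fpMap f h w) * (recip f (w 0) * (p * pd 1 h w)) ^ 2)
        - 1 / 2 * (C' (fpMap f h w) * (recip f (w 0) * (p * pd 1 h w))) =
      recip f (w 0) ^ 2 * (-(A w * p ^ 2) - 1 / 2 * (C w * p) - p ^ 2 * pd 1 (logY h) w
        + 1 / 2 * (p * logY h w) ^ 2)) ∧
      -(3 / 2) * (deriv (recip f) (w 0) + recip f (w 0) * (p * logY h w)) ^ 2
        + 3 * A' (fpMap f h w) * (recip f (w 0) * (p * pd 1 h w)) ^ 2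
        + 2 * C' (fpMap f h w) * (recip f (w 0) * (p * pd 1 h w)) + B' (fpMap f h w) =
      recip f (w 0) ^ 2 * (3 * A w * p ^ 2 + 2 * C w * p + B w)
        + recip f (w 0) * deriv (deriv (recip f)) (w 0) - 2 * deriv (recip f) (w 0) ^ 2
        - 3 * recip f (w 0) * deriv (recip f) (w 0) * (p * logY h w)
        + 3 * recip f (w 0) ^ 2 * (p ^ 2 * pd 1 (logY h) w)
        - 3 * recip f (w 0) ^ 2 * (p * logY h w) ^ 2 := by
    intro p hp
    obtain ⟨j, hb, h2, h3⟩ : ∃ j : Fin 4 → ℝ, basePt j = w ∧ j 2 = p ∧ j 3 = 0 := by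
      refine ⟨![w 0, w 1, p, 0], ?_, rfl, rfl⟩
      ext i
      fin_cases i <;> rfl
    subst hb
    subst h2
    have b0 : basePt j 0 = j 0 := rfl
    rw [b0] at hs ⊢
    have l0 := logX_eq_zero hU hφ hx hw
    have lx0 := pd_logX_eq_zero hU hφ hx hw 0
    have lx1 := pd_logX_eq_zero hU hφ hx hw 1
    have hl : lam h j = j 2 * logY h (basePt j) := by rw [lam, l0, zero_add]
    have hD : lamD h j = j 2 ^ 2 * pd 1 (logY h) (basePt j) := by
      rw [lamD, lx0, lx1, h3]
      ring
    have hpb : prolong f h j 2 = recip f (j 0) * (j 2 * pd 1 h (basePt j)) := by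
      have := pBar_eq hU hφ (j := j) hw
      rw [hx _ hw, zero_add] at this
      exact this
    have hne : recip f (j 0) * (j 2 * pd 1 h (basePt j)) ≠ 0 := mul_ne_zero hs (mul_ne_zero hp hη)
    have hqb : prolong f h j 3 = recip f (j 0) * (j 2 * pd 1 h (basePt j)) *
        (deriv (recip f) (j 0) + recip f (j 0) * (j 2 * logY h (basePt j))) := by
      have hxx : pd 0 (pd 0 h) (basePt j) = 0 := by
        rw [pd_congr (Filter.eventuallyEq_of_mem (hU.mem_nhds hw) hx), (hasGrad_const 0).pd]
      change qBar f h j = _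
      rw [qBar, totalDeriv_of_hasGrad (hasGrad_pBar hU hφ hw), deriv_eq_inv_recip f, hxx, h3, hl,
        hx _ hw, l0]
      simp only [Matrix.cons_val]
      field_simp
      ring
    have hbp : basePt (prolong f h j) = fpMap f h (basePt j) := rfl
    have hj' : prolong f h j ∈ jetSpace (fpMap f h '' U) :=
      ⟨⟨basePt j, hw, rfl⟩, by rw [hpb]; exact hne⟩
    have k1 := Kfun_odeF hV hA' hB' hC' _ hj'
    have k2 := Kfun_transformed hU hA hB hC hφ (isOpen_jetSpace hV) hF' hT ⟨hw, hp⟩ hj'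
    have p1 := (hasGrad_odeF (hA'.contDiffAt (hV.mem_nhds hj'.1))
      (hB'.contDiffAt (hV.mem_nhds hj'.1)) (hC'.contDiffAt (hV.mem_nhds hj'.1)) hj'.2).pd 2
    have p2 := pd_transformed_p hU hA hB hC hφ (isOpen_jetSpace hV) hF' hT ⟨hw, hp⟩ hj'
    have p3 := (hasGrad_odeF (hA.contDiffAt (hU.mem_nhds hw))
      (hB.contDiffAt (hU.mem_nhds hw)) (hC.contDiffAt (hU.mem_nhds hw)) hp).pd 2
    rw [k1, hl, hD, h3, hpb, hbp] at k2
    rw [p1, p3, hl, hD, h3, hpb, hqb, hbp] at p2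
    simp only [Matrix.cons_val] at p2
    rw [mul_pow (recip f (j 0) * (j 2 * pd 1 h (basePt j))),
      mul_div_cancel_left₀ _ (pow_ne_zero 2 hne)] at p2
    refine ⟨by rw [k2]; ring, by rw [p2]; ring⟩
  -- as polynomials in `p` the identities have degree two, so that three values determine them
  obtain ⟨k1, p1⟩ := key 1 one_ne_zero
  obtain ⟨k2, p2⟩ := key (-1) (by norm_num)
  obtain ⟨-, p3⟩ := key 2 two_ne_zero
  refine ⟨?_, ?_⟩
  · refine mul_left_cancel₀ (pow_ne_zero 2 hs) ?_
    linear_combination -(1 / 2) * k1 - 1 / 2 * k2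
  · linear_combination p1 + 1 / 3 * p2 - 1 / 3 * p3

end Coefficients

/-- The isometry induced by a transformation with `h_x = 0`: `z̄ = (z - ∂_y log |h_y|) / h_y` and
`t̄ = t / f' + (1 / f')'`. -/
def isometryMap (f : ℝ → ℝ) (h : (Fin 2 → ℝ) → ℝ) (m : Fin 4 → ℝ) : Fin 4 → ℝ :=
  ![f (m 0), h (basePt m), (m 2 - logY h (basePt m)) / pd 1 h (basePt m),
    recip f (m 0) * m 3 + deriv (recip f) (m 0)]

section IsometryMap

variable {m : Fin 4 → ℝ} (hU : IsOpen U) (hφ : IsFiberPreserving U f h)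
include hU hφ

theorem contDiffAt_isometryMap (hm : basePt m ∈ U) : ContDiffAt ℝ ∞ (isometryMap f h) m := by
  have b : ∀ {k : (Fin 2 → ℝ) → ℝ}, ContDiffAt ℝ ∞ k (basePt m) →
      ContDiffAt ℝ ∞ (fun m => k (basePt m)) m := fun hk =>
    ContDiffAt.comp (f := basePt) m hk contDiff_basePt.contDiffAt
  have x : ∀ i : Fin 4, ContDiffAt ℝ ∞ (fun u : Fin 4 → ℝ => u i) m :=
    fun i => (contDiff_apply ℝ ℝ i).contDiffAt
  refine contDiffAt_pi.2 fun i => ?_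
  fin_cases i
  · exact ContDiffAt.comp (f := fun m : Fin 4 → ℝ => m 0) m (hφ.contDiffAt_fst hU hm) (x 0)
  · exact b (hφ.contDiffAt_snd hU hm)
  · exact ((x 2).sub (b (contDiffAt_logY hU hφ hm))).div
      (b (contDiffAt_pd (hφ.contDiffAt_snd hU hm) 1)) (hφ.deriv_snd_ne _ hm)
  · exact ((contDiffAt_recip_jet hU hφ hm).mul (x 3)).add (ContDiffAt.comp
      (f := fun m : Fin 4 → ℝ => m 0) m (contDiffAt_deriv (contDiffAt_recip hU hφ hm)) (x 0))

theorem fderiv_isometryMap (hx : ∀ w ∈ U, pd 0 h w = 0) (hm : basePt m ∈ U) (v : Fin 4 → ℝ) :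
    fderiv ℝ (isometryMap f h) m v = ![(recip f (m 0))⁻¹ * v 0, pd 1 h (basePt m) * v 1,
      (v 2 - (pd 1 (logY h) (basePt m) + (m 2 - logY h (basePt m)) * logY h (basePt m)) * v 1)
        / pd 1 h (basePt m),
      (deriv (recip f) (m 0) * m 3 + deriv (deriv (recip f)) (m 0)) * v 0
        + recip f (m 0) * v 3] := by
  have hη := hφ.deriv_snd_ne _ hm
  have hd := ((contDiffAt_isometryMap hU hφ hm).differentiableAt (by simp)).hasFDerivAt
  have cd : ∀ {i : Fin 4} {g : Fin 4 → ℝ}, HasGrad (fun u => isometryMap f h u i) g m →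
      fderiv ℝ (isometryMap f h) m v i = ∑ a, g a * v a := by
    intro i g hg
    rw [← hg.fderiv_apply, (hasFDerivAt_pi'.1 hd i).fderiv]
    rfl
  have X0 := cd (i := 0) (hasGrad_prolong hU hφ hm 0)
  have X1 := cd (i := 1) (hasGrad_prolong hU hφ hm 1)
  have X2 := cd (i := 2) (((hasGrad_coord 2).sub (hasGrad_logY hU hφ hm)).div
    (hasGrad_stretch hU hφ hm) hη)
  have X3 := cd (i := 3) (((hasGrad_recip hU hφ hm).mul (hasGrad_coord 3)).add
    (hasGrad_deriv_recip hU hφ hm))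
  simp [Fin.sum_univ_four, hx _ hm, logX_eq_zero hU hφ hx hm, pd_logX_eq_zero hU hφ hx hm,
    deriv_eq_inv_recip f] at X0 X1 X2 X3
  ext i
  fin_cases i
  · exact X0
  · exact X1
  · refine X2.trans ?_
    simp
    field_simp
    ring
  · exact X3

omit hU in
theorem bijOn_isometryMap :
    Set.BijOn (isometryMap f h) (fourSpace U) (fourSpace (fpMap f h '' U)) := by
  refine ⟨fun m hm => ⟨basePt m, hm, rfl⟩, ?_, ?_⟩
  · intro m hm m' hm' e
    have hb : basePt m = basePt m' := by
      refine hφ.injOn hm hm' (funext fun i => ?_)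
      fin_cases i
      · exact congrFun e 0
      · exact congrFun e 1
    have h0 : m 0 = m' 0 := congrFun hb 0
    have e2 : (m 2 - logY h (basePt m)) / pd 1 h (basePt m)
        = (m' 2 - logY h (basePt m')) / pd 1 h (basePt m') := congrFun e 2
    have e3 : recip f (m 0) * m 3 + deriv (recip f) (m 0)
        = recip f (m' 0) * m' 3 + deriv (recip f) (m' 0) := congrFun e 3
    rw [← hb, div_left_inj' (hφ.deriv_snd_ne _ hm)] at e2
    rw [← h0, add_left_inj] at e3
    ext i
    fin_cases i
    · exact h0
    · exact congrFun hb 1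
    · simpa using e2
    · exact mul_left_cancel₀ (recip_ne_zero hφ hm) e3
  · rintro m' ⟨w, hw, e⟩
    have hη := hφ.deriv_snd_ne _ hw
    have hs : recip f (w 0) ≠ 0 := inv_ne_zero (hφ.deriv_fst_ne w hw)
    obtain ⟨m, hb, h2, h3⟩ : ∃ m : Fin 4 → ℝ, basePt m = w ∧
        m 2 = pd 1 h w * m' 2 + logY h w ∧
        m 3 = (m' 3 - deriv (recip f) (w 0)) / recip f (w 0) := by
      refine ⟨![w 0, w 1, pd 1 h w * m' 2 + logY h w,
        (m' 3 - deriv (recip f) (w 0)) / recip f (w 0)], ?_, rfl, rfl⟩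
      ext i
      fin_cases i <;> rfl
    subst hb
    have b0 : basePt m 0 = m 0 := rfl
    rw [b0] at hs h3
    refine ⟨m, hw, ?_⟩
    ext i
    fin_cases i
    · exact congrFun e 0
    · exact congrFun e 1
    · change (m 2 - logY h (basePt m)) / pd 1 h (basePt m) = m' 2
      rw [h2]
      field_simp
      ring
    · change recip f (m 0) * m 3 + deriv (recip f) (m 0) = m' 3
      rw [h3]
      field_simp
      ring

end IsometryMap

theorem bilin_isometryMap {A B A' B' : (Fin 2 → ℝ) → ℝ} {m : Fin 4 → ℝ} (hU : IsOpen U)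
    (hφ : IsFiberPreserving U f h) (hx : ∀ w ∈ U, pd 0 h w = 0) (hm : basePt m ∈ U)
    (eA : A' (fpMap f h (basePt m)) * pd 1 h (basePt m) ^ 2 =
      A (basePt m) + pd 1 (logY h) (basePt m) - 1 / 2 * logY h (basePt m) ^ 2)
    (eB : B' (fpMap f h (basePt m)) = recip f (m 0) ^ 2 * B (basePt m)
      + recip f (m 0) * deriv (deriv (recip f)) (m 0) - 1 / 2 * deriv (recip f) (m 0) ^ 2)
    (v w : Fin 4 → ℝ) :
    bilin (metricG A' B' (isometryMap f h m)) (fderiv ℝ (isometryMap f h) m v)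
      (fderiv ℝ (isometryMap f h) m w) = bilin (metricG A B m) v w := by
  have hη := hφ.deriv_snd_ne _ hm
  have hs := recip_ne_zero hφ hm
  have hb : basePt (isometryMap f h m) = fpMap f h (basePt m) := rfl
  have h2 : isometryMap f h m 2 = (m 2 - logY h (basePt m)) / pd 1 h (basePt m) := rfl
  have h3 : isometryMap f h m 3 = recip f (m 0) * m 3 + deriv (recip f) (m 0) := rfl
  have eA' : A' (fpMap f h (basePt m)) = (A (basePt m) + pd 1 (logY h) (basePt m)
      - 1 / 2 * logY h (basePt m) ^ 2) / pd 1 h (basePt m) ^ 2 := by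
    rw [← eA]
    field_simp
  simp only [bilin, metricG, hb, h2, h3, eA', eB, fderiv_isometryMap hU hφ hx hm,
    Fin.sum_univ_four]
  simp
  field_simp
  ring

end Isometry

end ThirdOrderODE

end

theorem theorem2 (U : Set (Fin 2 → ℝ)) (hU : IsOpen U) (A B C : (Fin 2 → ℝ) → ℝ)
    (hA : ContDiffOn ℝ ∞ A U) (hB : ContDiffOn ℝ ∞ B U) (hC : ContDiffOn ℝ ∞ C U) :
    -- the region `F_qq ≠ 0`, on which the coframe is defined, is all of the six-dimensional space
    (∀ u ∈ totalSpace U, pd 3 (pd 3 (odeF A B C)) (jet u) ≠ 0) ∧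
    -- the four-space is the leaf space of the distribution annihilated by the null forms:
    -- the projection is a smooth submersion onto it with this vertical distribution, and
    -- its fibres in each of the four components of signs of `p`, `α` are connected
    ContDiffOn ℝ ∞ proj (totalSpace U) ∧
    Set.MapsTo proj (totalSpace U) (fourSpace U) ∧
    (∀ u ∈ totalSpace U, Function.Surjective (fderiv ℝ proj u) ∧
      ∀ v, fderiv ℝ proj u v = 0 ↔ ∀ i, nullForms (odeF A B C) u i v = 0) ∧
    (∀ m ∈ fourSpace U, ∀ a b : ℝ, a ≠ 0 → b ≠ 0 →
      IsConnected {u | u ∈ totalSpace U ∧ proj u = m ∧ 0 < a * u 2 ∧ 0 < b * u 4}) ∧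
    -- the tensor built from the invariant coframe descends to `G`, and only to `G`
    (∀ u ∈ totalSpace U, ∀ v w, Gtilde (odeF A B C) u v w =
      bilin (metricG A B (proj u)) (fderiv ℝ proj u v) (fderiv ℝ proj u w)) ∧
    (∀ H : (Fin 4 → ℝ) → Matrix (Fin 4) (Fin 4) ℝ,
      (∀ u ∈ totalSpace U, ∀ v w, Gtilde (odeF A B C) u v w =
        bilin (H (proj u)) (fderiv ℝ proj u v) (fderiv ℝ proj u w)) →
      ∀ m ∈ fourSpace U, H m = metricG A B m) ∧
    -- `G` is a smooth metric of split signature, and it is Einstein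
    (∀ i j, ContDiffOn ℝ ∞ (fun m => metricG A B m i j) (fourSpace U)) ∧
    (∀ m ∈ fourSpace U, IsSplit (metricG A B m)) ∧
    (∀ m ∈ fourSpace U, ricci (metricG A B) m = -metricG A B m) ∧
    -- Petrov types
    (∀ m ∈ fourSpace U, ASDTypeD (metricG A B) m) ∧
    (∀ m ∈ fourSpace U, (SDTypeII (metricG A B) m ↔ typeQ A B m ≠ 0) ∧
      (SDTypeD (metricG A B) m ↔ typeQ A B m = 0)) ∧
    ((∀ m ∈ fourSpace U, SDTypeD (metricG A B) m) ↔ ∀ w ∈ U, pd 0 A w = 0 ∧ pd 1 B w = 0) ∧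
    IsOpen {m | m ∈ fourSpace U ∧ SDTypeII (metricG A B) m} ∧
    (∀ m ∈ fourSpace U, pd 0 A (basePt m) ≠ 0 ∨ pd 1 B (basePt m) ≠ 0 →
      m ∈ closure {m' | m' ∈ fourSpace U ∧ SDTypeII (metricG A B) m'}) ∧
    -- invariance: every fiber-preserving transformation, into whatever equation `ȳ''' = F'` it
    -- carries the given one, lifts to a map that preserves the coframe and the tensor `G̃`,
    -- so that the metric constructed from `F'` is again `G`
    (∀ (f : ℝ → ℝ) (h : (Fin 2 → ℝ) → ℝ), IsFiberPreserving U f h →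
      ∀ (J' : Set (Fin 4 → ℝ)) (F' : (Fin 4 → ℝ) → ℝ), IsOpen J' → ContDiffOn ℝ ∞ F' J' →
      Transforms f h (jetSpace U) (odeF A B C) J' F' →
      ∃ ψ : (Fin 6 → ℝ) → (Fin 6 → ℝ),
        ContDiffOn ℝ ∞ ψ {u | u ∈ totalSpace U ∧ prolong f h (jet u) ∈ J'} ∧
        Set.BijOn ψ {u | u ∈ totalSpace U ∧ prolong f h (jet u) ∈ J'}
          {u' | jet u' ∈ J' ∧ jet u' ∈ prolong f h '' jetSpace U ∧ u' 4 ≠ 0} ∧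
        ∀ u ∈ totalSpace U, prolong f h (jet u) ∈ J' →
          jet (ψ u) = prolong f h (jet u) ∧
          pd 3 (pd 3 F') (jet (ψ u)) ≠ 0 ∧
          (∀ i, (cartanCoframe F' (ψ u) i).comp (fderiv ℝ ψ u) =
            cartanCoframe (odeF A B C) u i) ∧
          ∀ v w, Gtilde F' (ψ u) (fderiv ℝ ψ u v) (fderiv ℝ ψ u w) =
            bilin (metricG A B (proj u)) (fderiv ℝ proj u v) (fderiv ℝ proj u w)) ∧
    -- if the transformed equation is again of the given form, the two metrics are isometric
    -- by a diffeomorphism that covers the transformation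
    (∀ (f : ℝ → ℝ) (h : (Fin 2 → ℝ) → ℝ), IsFiberPreserving U f h →
      ∀ A' B' C' : (Fin 2 → ℝ) → ℝ, ContDiffOn ℝ ∞ A' (fpMap f h '' U) →
      ContDiffOn ℝ ∞ B' (fpMap f h '' U) → ContDiffOn ℝ ∞ C' (fpMap f h '' U) →
      Transforms f h (jetSpace U) (odeF A B C) (jetSpace (fpMap f h '' U)) (odeF A' B' C') →
      ∃ Φ : (Fin 4 → ℝ) → (Fin 4 → ℝ),
        ContDiffOn ℝ ∞ Φ (fourSpace U) ∧
        Set.BijOn Φ (fourSpace U) (fourSpace (fpMap f h '' U)) ∧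
        ∀ m ∈ fourSpace U, basePt (Φ m) = fpMap f h (basePt m) ∧
          ∀ v w, bilin (metricG A' B' (Φ m)) (fderiv ℝ Φ m v) (fderiv ℝ Φ m w) =
            bilin (metricG A B m) v w) := by
  have hR : ∀ m ∈ fourSpace U, ∀ k l i j,
      riemann (metricG A B) k l i j m = curvG A B m k l i j :=
    fun m hm => riemann_metricG hU hA hB hm
  have hII : ∀ m ∈ fourSpace U, (SDTypeII (metricG A B) m ↔ typeQ A B m ≠ 0) := fun m hm =>
    ⟨typeQ_ne_zero_of_sdTypeII (hR m hm), sdTypeII_of_typeQ_ne_zero (hR m hm)⟩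
  have hD : ∀ m ∈ fourSpace U, (SDTypeD (metricG A B) m ↔ typeQ A B m = 0) := fun m hm =>
    ⟨typeQ_eq_zero_of_sdTypeD (hR m hm), sdTypeD_of_typeQ_eq_zero (hR m hm)⟩
  have hset : {m | m ∈ fourSpace U ∧ SDTypeII (metricG A B) m}
      = {m | m ∈ fourSpace U ∧ typeQ A B m ≠ 0} :=
    Set.ext fun m => and_congr_right fun hm => hII m hm
  refine ⟨?_, contDiffOn_proj U, fun u hu => hu.1.1, ?_, ?_, ?_, ?_, contDiffOn_metricG hA hB, ?_,
    ?_, ?_, fun m hm => ⟨hII m hm, hD m hm⟩, ?_, ?_, ?_, ?_, ?_⟩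
  · intro u hu
    rw [(hasGrad_pd_odeF_q hU hA hB hC _ hu.1).pd]
    exact div_ne_zero three_ne_zero hu.1.2
  · exact fun u hu => ⟨surjective_fderiv_proj hu.1.2, fderiv_proj_eq_zero_iff hU hA hB hC hu⟩
  · exact fun m hm a b ha hb => isConnected_fibre hm ha hb
  · exact fun u hu v w => Gtilde_odeF hU hA hB hC hu v w
  · exact fun H hH m hm => metricG_unique hU hA hB hC H hH hm
  · exact fun m _ => isSplit_metricG m
  · exact fun m hm => ricci_metricG (hR m hm)
  · exact fun m hm => asdTypeD_metricG (hR m hm)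
  · rw [← forall_typeQ_eq_zero_iff hU]
    exact forall₂_congr hD
  · rw [hset]
    exact isOpen_typeQ_ne_zero hU hA hB
  · intro m hm h
    rw [hset]
    exact mem_closure_typeQ_ne_zero hm h
  · intro f h hφ J' F' hJ' hF' hT
    refine ⟨liftMap f h, fun u hu => (contDiffAt_liftMap hU hφ hu.1.1.1).contDiffWithinAt,
      bijOn_liftMap hU hφ J', fun u hu hu' => ⟨jet_liftMap f h u, ?_,
        cartanCoframe_liftMap hU hA hB hC hφ hJ' hF' hT hu hu', fun v w => ?_⟩⟩
    · rw [jet_liftMap, (pd_pd_transformed_q hU hA hB hC hφ hJ' hF' hT hu.1 hu').1]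
      exact div_ne_zero three_ne_zero (mul_ne_zero (mul_ne_zero hu.1.2
        (recip_ne_zero hφ hu.1.1)) (hφ.deriv_snd_ne _ hu.1.1))
    · rw [Gtilde_liftMap hU hA hB hC hφ hJ' hF' hT hu hu', Gtilde_odeF hU hA hB hC hu]
  · intro f h hφ A' B' C' hA' hB' hC' hT
    have hx : ∀ w ∈ U, pd 0 h w = 0 := fun w hw =>
      pd_snd_x_eq_zero hU hA hB hC hφ hA' hB' hC' (contDiffOn_odeF hA' hB' hC') hT hw
    refine ⟨isometryMap f h, fun m hm => (contDiffAt_isometryMap hU hφ hm).contDiffWithinAt,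
      bijOn_isometryMap hφ, fun m hm => ⟨rfl, ?_⟩⟩
    obtain ⟨eA, eB⟩ := coefficients_transform hU hA hB hC hφ hA' hB' hC' hx hT hm
    exact bilin_isometryMap hU hφ hx hm eA eB
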